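/- **Notation.** A composition is a finite (possibly empty) tuple of non-negative integers; it is reduced if it is empty or its last entry is nonzero. A partition is a (possibly empty) weakly decreasing tuple of positive integers. Write $\ell$ for length, $*$ for concatenation, $\mathrm{rev}$ for reversal. Let $\Sigma$ be the set of pairs $(\mu|\lambda)$ with $\mu$ a reduced composition and $\lambda$ a partition. Let $\mathbb{k}$ be a field of characteristic $0$ (for example $\mathbb{Q}(q,t)$). Let $\xi_i(f)=\dfrac{x_if-x_{i+1}s_i(f)}{x_i-x_{i+1}}$, where $s_i$ swaps $x_i,x_{i+1}$. The key polynomials $\mathcal K_\alpha\in\mathbb{k}[x_1,\dots,x_n]$, $\alpha\in\mathbb{Z}_{\ge0}^n$, are the unique family with $\mathcal K_\alpha=x^\alpha$ if $\alpha_1\ge\dots\ge\alpha_n$, and $\mathcal K_{s_i(\alpha)}=\xi_i(\mathcal K_\alpha)$ if $\alpha_i>\alpha_{i+1}$. For $0\le k\le n$ put $$W_k^{(n)}(f)=\sum_{w}w\Big(f\prod_{k<i<j\le n}\frac1{1-x_j/x_i}\Big),$$ the sum being over the permutations $w$ of $\{1,\dots,n\}$ that fix $1,\dots,k$, and let $W_k=\lim_nW_k^{(n)}$: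 for a function $f$ in the inverse limit of the rings $\mathbb{k}[x_1,\dots,x_n]$ along the maps $x_{n+1}\mapsto0$, the restriction of $W_kf$ to $x_1,\dots,x_n$ ($n\ge k$) is $W_k^{(n)}$ applied to the restriction of $f$. The almost symmetric Schur functions $s_{(\mu|\lambda)}$, $(\mu|\lambda)\in\Sigma$, are defined by $s_{(\mu|\emptyset)}=\mathcal K_\mu$ and $$s_{(\mu_1,\dots,\mu_{r-1}|\mu_r,\lambda_1,\dots,\lambda_l)}=W_{r-1}\big(s_{(\mu_1,\dots,\mu_r|\lambda_1,\dots,\lambda_l)}\big)\quad\text{if }\mu_r\ge\lambda_1 .$$ For a composition $\gamma$ of length $n$ let $dg'(\gamma)=\{(i,j):1\le i\le n,\ 1\le j\le\gamma_i\}$ ($i$ is the column, $j$ the row) and $\widehat{dg}(\gamma)=dg'(\gamma)\cup\{(i,0):1\le i\le n\}$. For $u=(i,j)\in dg'(\gamma)$ let $d(u)=(i,j-1)$ and $$a(u)=\#\{(i',j)\in dg'(\gamma):i'<i,\ \gamma_{i'}\le\gamma_i\}+\#\{(i',j-1)\in\widehat{dg}(\gamma):i'>i,\ \gamma_{i'}<\gamma_i\}.$$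 Two distinct boxes attack each other if they are in the same row, or in consecutive rows with the lower one strictly to the right of the upper one. The reading order goes through the rows from top to bottom, and from right to left in each row. For a labelling $\tau$ of $\widehat{dg}(\gamma)$ by elements of a totally ordered set: $\tau$ is non-attacking if attacking boxes have distinct labels; $\mathrm{Des}(\tau)=\{u\in dg'(\gamma):\tau(u)>\tau(d(u))\}$; $\mathrm{Inv}(\tau)$ is the set of attacking pairs $(u,v)$ with $u$ before $v$ in reading order and $\tau(u)>\tau(v)$; and $$\mathrm{coinv}(\tau)=\sum_{u\in dg'(\gamma)}a(u)-\Big(|\mathrm{Inv}(\tau)|-|\{i<j:\gamma_i\le\gamma_j\}|-\sum_{u\in\mathrm{Des}(\tau)}a(u)\Big).$$ For $(\mu|\lambda)\in\Sigma$ and $\sigma:dg'(\mu*\mathrm{rev}(\lambda))\to\{1,2,\dots\}$ let $\sigma^\star$ be the labelling of $\widehat{dg}(\mu*\mathrm{rev}(\lambda))$ that extends $\sigma$ by $\sigma^\star(j,0)=j$ for $1\le j\le\ell(\mu)$ and $\sigma^\star(j,0)=\omega+j-\ell(\mu)-1$ for $\ell(\mu)<j\le\ell(\mu)+\ell(\lambda)$,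 where $\omega$ is the first infinite ordinal. Let $\mathcal L(\mu|\lambda)$ be the set of $\sigma$ such that $\sigma^\star$ is non-attacking, $\mathrm{coinv}(\sigma^\star)=0$ and $\mathrm{Des}(\sigma^\star)=\emptyset$. For $(\alpha|\nu)\in\Sigma$ with $\ell(\alpha)\le\ell(\mu)$ let $L_{(\alpha|\nu)}(\mu|\lambda)$ be the set of $\sigma\in\mathcal L(\mu|\lambda)$ with values in $\{1,\dots,\ell(\mu)+\ell(\nu)\}$ such that $|\sigma^{-1}(i)|=\alpha_i$ for $1\le i\le\ell(\mu)$ (with $\alpha_i=0$ for $i>\ell(\alpha)$) and $|\sigma^{-1}(\ell(\mu)+i)|=\nu_i$ for $1\le i\le\ell(\nu)$. Write $\mathfrak X_k=x_{k+1}+x_{k+2}+\cdots$, and let $m_\nu[\mathfrak X_k]$ be the monomial symmetric function in the variables $x_{k+1},x_{k+2},\dots$. **Theorem.** Let $(\mu|\lambda)\in\Sigma$. The functions $x^\alpha m_\nu[\mathfrak X_{\ell(\mu)}]$, for $(\alpha|\nu)\in\Sigma$ with $\ell(\alpha)\le\ell(\mu)$, are linearly independent over $\mathbb{k}$, and $s_{(\mu|\lambda)}$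 is a finite linear combination of them, $$s_{(\mu|\lambda)}=\sum_{(\alpha|\nu)\in\Sigma,\ \ell(\alpha)\le\ell(\mu)}K^{(\mu|\lambda)}_{(\alpha|\nu)}\,x^\alpha m_\nu[\mathfrak X_{\ell(\mu)}].$$ Put $K^{(\mu|\lambda)}_{(\alpha|\nu)}=0$ if $\ell(\alpha)>\ell(\mu)$. Then every almost symmetric Kostka coefficient $K^{(\mu|\lambda)}_{(\alpha|\nu)}$, $(\alpha|\nu)\in\Sigma$, is a non-negative integer. Moreover, if $\ell(\alpha)\le\ell(\mu)$, then $L_{(\alpha|\nu)}(\mu|\lambda)$ is finite and $$K^{(\mu|\lambda)}_{(\alpha|\nu)}=|L_{(\alpha|\nu)}(\mu|\lambda)|.$$ -/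

import Mathlib

noncomputable section

namespace AlmostSym

/-! ### Compositions and partitions -/

/-- A composition is a finite list of natural numbers; it is reduced if it is empty or its last
entry is nonzero. -/
def IsReducedComp (μ : List ℕ) : Prop := ∀ h : μ ≠ [], μ.getLast h ≠ 0

/-- A partition is a weakly decreasing list of positive integers. -/
def IsPartition (l : List ℕ) : Prop := l.SortedGE ∧ ∀ a ∈ l, 1 ≤ a

/-- The set `Σ` of pairs `(μ|λ)` with `μ` a reduced composition and `λ` a partition. -/
structure SigmaPair where
  comp : List ℕ
  part : List ℕ
  comp_reduced : IsReducedComp comp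
  part_partition : IsPartition part

/-! ### Polynomials in finitely many variables

The variables `x_1, …, x_n` are `X 0, …, X (n - 1)` in `MvPolynomial (Fin n) 𝕜`. -/

section Polynomials

variable (𝕜 : Type*) [Field 𝕜] {n : ℕ}

/-- The field of rational functions in `x_1, …, x_n`. -/
abbrev RatFun (n : ℕ) := FractionRing (MvPolynomial (Fin n) 𝕜)

variable {𝕜}

/-- A polynomial regarded as a rational function. -/
def toRat (f : MvPolynomial (Fin n) 𝕜) : RatFun 𝕜 n := algebraMap _ _ f

/-- A rational function that happens to be a polynomial, regarded as a polynomial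
(`toRat` is injective). -/
def ofRat (r : RatFun 𝕜 n) : MvPolynomial (Fin n) 𝕜 := Function.invFun toRat r

/-- Isobaric divided difference operator
`f ↦ (x_i f - x_j s_{ij}(f)) / (x_i - x_j)`; it is used with `j = i + 1`. -/
def isobaric (i j : Fin n) (f : MvPolynomial (Fin n) 𝕜) : MvPolynomial (Fin n) 𝕜 :=
  ofRat ((toRat (MvPolynomial.X i) * toRat f -
      toRat (MvPolynomial.X j) * toRat (MvPolynomial.rename (Equiv.swap i j) f)) /
    (toRat (MvPolynomial.X i) - toRat (MvPolynomial.X j)))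

/-- Partial Weyl symmetrizer `W_k^{(n)}`: the sum over all permutations `w` of `{1, …, n}` fixing
`1, …, k` of `w (f ∏_{k < i < j ≤ n} 1 / (1 - x_j / x_i))`. -/
def weylSymm (k n : ℕ) (f : MvPolynomial (Fin n) 𝕜) : MvPolynomial (Fin n) 𝕜 :=
  ofRat (∑ w ∈ Finset.univ.filter
      (fun w : Equiv.Perm (Fin n) => ∀ i : Fin n, i.val < k → w i = i),
    toRat (MvPolynomial.rename w f) *
      ∏ p ∈ Finset.univ.filter (fun p : Fin n × Fin n => k ≤ p.1.val ∧ p.1 < p.2),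
        1 / (1 - toRat (MvPolynomial.X (w p.2)) / toRat (MvPolynomial.X (w p.1))))

/-! ### Key polynomials -/

/-- The defining properties of the family of key polynomials in `n` variables. -/
def IsKeyFamily (κ : (Fin n → ℕ) → MvPolynomial (Fin n) 𝕜) : Prop :=
  (∀ a : Fin n → ℕ, Antitone a → κ a = ∏ i, MvPolynomial.X i ^ a i) ∧
  ∀ (a : Fin n → ℕ) (i j : Fin n), j.val = i.val + 1 → a j < a i →
    κ (a ∘ Equiv.swap i j) = isobaric i j (κ a)

theorem weight_swap_lt (a : Fin n → ℕ) (i j : Fin n) (hij : j.val = i.val + 1)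
    (h : a i < a j) :
    ∑ m, m.val * (a ∘ Equiv.swap i j) m < ∑ m, m.val * a m := by
  have hne : i ≠ j := by rintro rfl; omega
  have hj : j ∈ Finset.univ.erase i := Finset.mem_erase.2 ⟨hne.symm, Finset.mem_univ _⟩
  rw [← Finset.add_sum_erase _ _ (Finset.mem_univ i), ← Finset.add_sum_erase _ _ hj,
    ← Finset.add_sum_erase (a := i) Finset.univ (fun m => m.val * a m) (Finset.mem_univ i),
    ← Finset.add_sum_erase (a := j) _ (fun m => m.val * a m) hj]
  have : ∑ m ∈ (Finset.univ.erase i).erase j, m.val * (a ∘ Equiv.swap i j) m =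
      ∑ m ∈ (Finset.univ.erase i).erase j, m.val * a m := by
    refine Finset.sum_congr rfl fun m hm => ?_
    simp only [Finset.mem_erase] at hm
    simp [Equiv.swap_apply_of_ne_of_ne hm.2.1 hm.1]
  rw [this]
  simp only [Function.comp, Equiv.swap_apply_left, Equiv.swap_apply_right, hij]
  nlinarith

open Classical in
/-- The key polynomial of `a`, by sorting `a` one adjacent transposition at a time; by
`isKeyFamily_keyPoly` and `IsKeyFamily.eq_keyPoly` these are the unique key family. -/
def keyPoly (a : Fin n → ℕ) : MvPolynomial (Fin n) 𝕜 :=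
  if h : ∃ p : Fin n × Fin n, p.2.val = p.1.val + 1 ∧ a p.1 < a p.2 then
    isobaric h.choose.1 h.choose.2 (keyPoly (a ∘ Equiv.swap h.choose.1 h.choose.2))
  else ∏ i, MvPolynomial.X i ^ a i
termination_by ∑ m, m.val * a m
decreasing_by exact weight_swap_lt a _ _ h.choose_spec.1 h.choose_spec.2

theorem toRat_injective : Function.Injective (toRat : MvPolynomial (Fin n) 𝕜 → _) :=
  IsFractionRing.injective _ _

theorem ofRat_toRat (f : MvPolynomial (Fin n) 𝕜) : ofRat (toRat f) = f :=
  Function.leftInverse_invFun toRat_injective f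

theorem sub_dvd_sub_rename_swap (i j : Fin n) (f : MvPolynomial (Fin n) 𝕜) :
    (MvPolynomial.X i - MvPolynomial.X j : MvPolynomial (Fin n) 𝕜) ∣
      f - MvPolynomial.rename (Equiv.swap i j) f := by
  rw [← Ideal.mem_span_singleton, ← Ideal.Quotient.eq]
  set I := Ideal.span {(MvPolynomial.X i - MvPolynomial.X j : MvPolynomial (Fin n) 𝕜)}
  have hX : Ideal.Quotient.mk I (MvPolynomial.X i) = Ideal.Quotient.mk I (MvPolynomial.X j) :=
    Ideal.Quotient.eq.2 (Ideal.mem_span_singleton_self _)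
  have : Ideal.Quotient.mkₐ 𝕜 I =
      (Ideal.Quotient.mkₐ 𝕜 I).comp (MvPolynomial.rename (Equiv.swap i j)) := by
    refine MvPolynomial.algHom_ext fun m => ?_
    simp only [AlgHom.comp_apply, MvPolynomial.rename_X, Ideal.Quotient.mkₐ_eq_mk]
    by_cases h1 : m = i
    · rw [h1, Equiv.swap_apply_left, hX]
    · by_cases h2 : m = j
      · rw [h2, Equiv.swap_apply_right, hX]
      · rw [Equiv.swap_apply_of_ne_of_ne h1 h2]
  exact DFunLike.congr_fun this f

/-- The isobaric divided difference of a polynomial is a polynomial. -/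
theorem sub_mul_isobaric (i j : Fin n) (hij : i ≠ j) (f : MvPolynomial (Fin n) 𝕜) :
    (MvPolynomial.X i - MvPolynomial.X j) * isobaric i j f =
      MvPolynomial.X i * f - MvPolynomial.X j * MvPolynomial.rename (Equiv.swap i j) f := by
  have hne : (MvPolynomial.X i - MvPolynomial.X j : MvPolynomial (Fin n) 𝕜) ≠ 0 :=
    sub_ne_zero.2 fun h => hij (MvPolynomial.X_injective h)
  obtain ⟨g, hg⟩ := sub_dvd_sub_rename_swap i j f
  have key : MvPolynomial.X i * f - MvPolynomial.X j * MvPolynomial.rename (Equiv.swap i j) f =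
      (MvPolynomial.X i - MvPolynomial.X j) * (f + MvPolynomial.X j * g) := by
    linear_combination MvPolynomial.X j * hg
  have : isobaric i j f = f + MvPolynomial.X j * g := by
    rw [isobaric, ← ofRat_toRat (f + MvPolynomial.X j * g)]
    congr 1
    have hne' : toRat (MvPolynomial.X i - MvPolynomial.X j : MvPolynomial (Fin n) 𝕜) ≠ 0 :=
      fun h => hne (toRat_injective (h.trans (map_zero (algebraMap _ _)).symm))
    have e := congrArg toRat key
    simp only [toRat, map_sub, map_mul] at e hne' ⊢
    rw [e, mul_div_cancel_left₀ _ hne']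
  rw [this, key]

theorem X_sub_ne (i j : Fin n) (hij : i ≠ j) :
    (MvPolynomial.X i - MvPolynomial.X j : MvPolynomial (Fin n) 𝕜) ≠ 0 :=
  sub_ne_zero.2 fun h => hij (MvPolynomial.X_injective h)

theorem rename_rename_swap (w v : Equiv.Perm (Fin n)) (f : MvPolynomial (Fin n) 𝕜) :
    MvPolynomial.rename w (MvPolynomial.rename v f) = MvPolynomial.rename (w * v) f := by
  rw [MvPolynomial.rename_rename]; rfl

theorem isobaric_comm (i j k l : Fin n) (hij : i ≠ j) (hkl : k ≠ l) (hik : i ≠ k) (hil : i ≠ l)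
    (hjk : j ≠ k) (hjl : j ≠ l) (f : MvPolynomial (Fin n) 𝕜) :
    isobaric i j (isobaric k l f) = isobaric k l (isobaric i j f) := by
  have hs : Equiv.swap k l * Equiv.swap i j = Equiv.swap i j * Equiv.swap k l := by
    ext m; simp only [Equiv.Perm.mul_apply, Equiv.swap_apply_def]; grind
  have e1 := sub_mul_isobaric i j hij (isobaric k l f)
  have e2 := sub_mul_isobaric k l hkl f
  have e3 := sub_mul_isobaric k l hkl (isobaric i j f)
  have e4 := sub_mul_isobaric i j hij f
  have e2' := congrArg (MvPolynomial.rename (Equiv.swap i j)) e2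
  have e4' := congrArg (MvPolynomial.rename (Equiv.swap k l)) e4
  simp only [map_sub, map_mul, MvPolynomial.rename_X, rename_rename_swap, hs,
    Equiv.swap_apply_of_ne_of_ne hik.symm hjk.symm,
    Equiv.swap_apply_of_ne_of_ne hil.symm hjl.symm,
    Equiv.swap_apply_of_ne_of_ne hik hil, Equiv.swap_apply_of_ne_of_ne hjk hjl] at e2' e4'
  apply mul_left_cancel₀ (mul_ne_zero (X_sub_ne (𝕜 := 𝕜) i j hij) (X_sub_ne k l hkl))
  linear_combination (MvPolynomial.X k - MvPolynomial.X l) * e1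
    + MvPolynomial.X i * e2 - MvPolynomial.X j * e2'
    - (MvPolynomial.X i - MvPolynomial.X j) * e3
    - MvPolynomial.X k * e4 + MvPolynomial.X l * e4'

theorem rename_isobaric (i j : Fin n) (hij : i ≠ j) (f : MvPolynomial (Fin n) 𝕜) :
    MvPolynomial.rename (Equiv.swap i j) (isobaric i j f) = isobaric i j f := by
  have e := sub_mul_isobaric i j hij f
  have e' := congrArg (MvPolynomial.rename (Equiv.swap i j)) e
  simp only [map_sub, map_mul, MvPolynomial.rename_X, rename_rename_swap,
    Equiv.swap_apply_left, Equiv.swap_apply_right, Equiv.swap_mul_self] at e'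
  have h1 : MvPolynomial.rename (1 : Equiv.Perm (Fin n)) f = f := MvPolynomial.rename_id_apply f
  rw [h1] at e'
  apply mul_left_cancel₀ (X_sub_ne (𝕜 := 𝕜) i j hij)
  linear_combination -e - e'

theorem isobaric_braid (i j k : Fin n) (hij : i ≠ j) (hjk : j ≠ k) (hik : i ≠ k)
    (f : MvPolynomial (Fin n) 𝕜) :
    isobaric i j (isobaric j k (isobaric i j f)) =
      isobaric j k (isobaric i j (isobaric j k f)) := by
  have hs : Equiv.swap i j * (Equiv.swap j k * Equiv.swap i j) =
      Equiv.swap j k * (Equiv.swap i j * Equiv.swap j k) := by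
    ext m; simp only [Equiv.Perm.mul_apply, Equiv.swap_apply_def]; grind
  set p1 := isobaric i j f with hp1
  set p2 := isobaric j k p1 with hp2
  set q1 := isobaric j k f with hq1
  set q2 := isobaric i j q1 with hq2
  have a1 := sub_mul_isobaric i j hij f
  have a2 := sub_mul_isobaric j k hjk p1
  have a3 := sub_mul_isobaric i j hij p2
  have b1 := sub_mul_isobaric j k hjk f
  have b2 := sub_mul_isobaric i j hij q1
  have b3 := sub_mul_isobaric j k hjk q2
  rw [← hp1] at a1
  rw [← hp2] at a2
  rw [← hq1] at b1
  rw [← hq2] at b2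
  have a1' := congrArg (MvPolynomial.rename (Equiv.swap j k)) a1
  have a1'' := congrArg (MvPolynomial.rename (Equiv.swap i j)) a1'
  have a2' := congrArg (MvPolynomial.rename (Equiv.swap i j)) a2
  have b1' := congrArg (MvPolynomial.rename (Equiv.swap i j)) b1
  have b1'' := congrArg (MvPolynomial.rename (Equiv.swap j k)) b1'
  have b2' := congrArg (MvPolynomial.rename (Equiv.swap j k)) b2
  have r1 : MvPolynomial.rename (Equiv.swap i j) p1 = p1 := rename_isobaric i j hij f
  have r2 : MvPolynomial.rename (Equiv.swap j k) q1 = q1 := rename_isobaric j k hjk f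
  simp only [map_sub, map_mul, MvPolynomial.rename_X, Equiv.swap_apply_left,
    Equiv.swap_apply_right, Equiv.swap_apply_of_ne_of_ne hij hik,
    Equiv.swap_apply_of_ne_of_ne hik.symm hjk.symm, r1, r2] at a1' a1'' a2' b1' b1'' b2'
  simp only [rename_rename_swap, hs] at a1' a1'' a2' b1' b1'' b2'
  apply mul_left_cancel₀ (mul_ne_zero (mul_ne_zero (X_sub_ne (𝕜 := 𝕜) i j hij)
    (X_sub_ne i k hik)) (X_sub_ne j k hjk))
  generalize (MvPolynomial.X i : MvPolynomial (Fin n) 𝕜) = x at *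
  generalize (MvPolynomial.X j : MvPolynomial (Fin n) 𝕜) = y at *
  generalize (MvPolynomial.X k : MvPolynomial (Fin n) 𝕜) = z at *
  linear_combination (x - z) * (y - z) * a3 + (x - z) * x * a2 - y * (y - z) * a2'
    + x * y * a1 - x * z * a1' + y * z * a1''
    - (x - y) * (x - z) * b3 - y * (x - z) * b2 + z * (x - y) * b2'
    - x ^ 2 * b1 + y ^ 2 * b1' - z ^ 2 * b1''

theorem keyPoly_swap (a : Fin n → ℕ) (i j : Fin n) (hij : j.val = i.val + 1) (h : a i < a j) :
    keyPoly a = isobaric (𝕜 := 𝕜) i j (keyPoly (a ∘ Equiv.swap i j)) := by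
  induction hw : ∑ m, m.val * a m using Nat.strong_induction_on generalizing a i j with
  | _ w ih =>
  subst hw
  have confl : ∀ i j k l : Fin n, j.val = i.val + 1 → l.val = k.val + 1 → a i < a j → a k < a l →
      i < k → isobaric (𝕜 := 𝕜) i j (keyPoly (a ∘ Equiv.swap i j)) =
        isobaric k l (keyPoly (a ∘ Equiv.swap k l)) := by
    intro i j k l hij hkl h1 h2 hik
    have n1 : i ≠ j := by rintro rfl; omega
    have n2 : k ≠ l := by rintro rfl; omega
    have w1 := weight_swap_lt a i j hij h1
    have w2 := weight_swap_lt a k l hkl h2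
    have n3 : i ≠ k := hik.ne
    have n4 : i ≠ l := by rintro rfl; omega
    by_cases hjk : j = k
    · subst hjk
      have u1 : (a ∘ Equiv.swap i j) j < (a ∘ Equiv.swap i j) l := by
        simpa [Equiv.swap_apply_of_ne_of_ne n4.symm n2.symm] using h1.trans h2
      have v1 : (a ∘ Equiv.swap j l) i < (a ∘ Equiv.swap j l) j := by
        simpa [Equiv.swap_apply_of_ne_of_ne n1 n4] using h1.trans h2
      have u2 : ((a ∘ Equiv.swap i j) ∘ Equiv.swap j l) i <
          ((a ∘ Equiv.swap i j) ∘ Equiv.swap j l) j := by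
        simpa [Equiv.swap_apply_of_ne_of_ne n4.symm n2.symm,
          Equiv.swap_apply_of_ne_of_ne n1 n4] using h2
      have v2 : ((a ∘ Equiv.swap j l) ∘ Equiv.swap i j) j <
          ((a ∘ Equiv.swap j l) ∘ Equiv.swap i j) l := by
        simpa [Equiv.swap_apply_of_ne_of_ne n4.symm n2.symm,
          Equiv.swap_apply_of_ne_of_ne n1 n4] using h1
      have w3 := weight_swap_lt _ j l hkl u1
      have w4 := weight_swap_lt _ i j hij v1
      rw [ih _ w1 _ j l hkl u1 rfl, ih _ (w3.trans w1) _ i j hij u2 rfl,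
        ih _ w2 _ i j hij v1 rfl, ih _ (w4.trans w2) _ j l hkl v2 rfl,
        isobaric_braid i j l n1 n2 n4]
      congr 4
      funext m
      simp only [Function.comp, Equiv.swap_apply_def]; grind
    · have n5 : j ≠ l := by rintro rfl; exact n3 (Fin.ext (by omega))
      have u1 : (a ∘ Equiv.swap i j) k < (a ∘ Equiv.swap i j) l := by
        simpa [Equiv.swap_apply_of_ne_of_ne n3.symm (Ne.symm hjk),
          Equiv.swap_apply_of_ne_of_ne n4.symm n5.symm] using h2
      have v1 : (a ∘ Equiv.swap k l) i < (a ∘ Equiv.swap k l) j := by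
        simpa [Equiv.swap_apply_of_ne_of_ne n3 n4, Equiv.swap_apply_of_ne_of_ne hjk n5] using h1
      rw [ih _ w1 _ k l hkl u1 rfl, ih _ w2 _ i j hij v1 rfl,
        isobaric_comm i j k l n1 n2 n3 n4 hjk n5]
      congr 3
      funext m
      simp only [Function.comp, Equiv.swap_apply_def]; grind
  have hex : ∃ p : Fin n × Fin n, p.2.val = p.1.val + 1 ∧ a p.1 < a p.2 := ⟨(i, j), hij, h⟩
  have e : keyPoly (𝕜 := 𝕜) a = isobaric hex.choose.1 hex.choose.2
      (keyPoly (a ∘ Equiv.swap hex.choose.1 hex.choose.2)) := by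
    rw [keyPoly, dif_pos hex]
  have hs := hex.choose_spec
  rw [e]
  generalize hex.choose = p at hs
  obtain ⟨k, l⟩ := p
  simp only at hs ⊢
  rcases lt_trichotomy i k with hlt | heq | hgt
  · exact (confl i j k l hij hs.1 h hs.2 hlt).symm
  · subst heq
    have : j = l := Fin.ext (by omega)
    rw [this]
  · exact confl k l i j hs.1 hij hs.2 h hgt

/-- The polynomials `keyPoly` have the defining properties of the key polynomials. -/
theorem isKeyFamily_keyPoly : IsKeyFamily (keyPoly : (Fin n → ℕ) → MvPolynomial (Fin n) 𝕜) := by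
  constructor
  · intro a ha
    rw [keyPoly, dif_neg]
    rintro ⟨p, h1, h2⟩
    exact absurd (ha (show p.1 ≤ p.2 from by rw [Fin.le_def]; omega)) (not_le.2 h2)
  · intro a i j hij h
    rw [keyPoly_swap (a ∘ Equiv.swap i j) i j hij (by simpa using h)]
    congr 2
    funext m
    simp

/-- The defining properties determine the key polynomials. -/
theorem IsKeyFamily.eq_keyPoly {κ : (Fin n → ℕ) → MvPolynomial (Fin n) 𝕜} (hκ : IsKeyFamily κ) :
    κ = keyPoly := by
  funext a
  induction hw : ∑ m, m.val * a m using Nat.strong_induction_on generalizing a with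
  | _ w ih =>
  subst hw
  by_cases hex : ∃ p : Fin n × Fin n, p.2.val = p.1.val + 1 ∧ a p.1 < a p.2
  · obtain ⟨⟨i, j⟩, hij, h⟩ := hex
    rw [keyPoly_swap a i j hij h, ← ih _ (weight_swap_lt a i j hij h) _ rfl,
      ← hκ.2 _ i j hij (by simpa using h)]
    congr 1
    funext m
    simp
  · have ha : Antitone a := by
      push Not at hex
      cases n with
      | zero => exact fun x => x.elim0
      | succ n =>
        rw [Fin.antitone_iff_succ_le]
        exact fun i => hex (i.castSucc, i.succ) (by simp)
    rw [hκ.1 a ha, isKeyFamily_keyPoly.1 a ha]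

end Polynomials

/-! ### Almost symmetric functions -/

section AlmostSymmetric

variable (𝕜 : Type*) [Field 𝕜]

/-- Functions of `x_1, x_2, …` are recorded by their restrictions to `x_1, …, x_n`, i.e. the values
at `x_{n+1} = x_{n+2} = … = 0`, for all `n`. The inverse limit of the polynomial rings along the maps
`x_{n+1} ↦ 0`, in which almost symmetric functions live, consists of the compatible sequences. -/
abbrev PolySeq := ∀ n : ℕ, MvPolynomial (Fin n) 𝕜

variable {𝕜}

/-- Regard a polynomial in `x_1, …, x_m` as a function of `x_1, x_2, …`: its `n`-th restriction
is obtained by setting `x_i = 0` for all `i > n`. -/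
def extend {m : ℕ} (f : MvPolynomial (Fin m) 𝕜) : PolySeq 𝕜 := fun n =>
  MvPolynomial.aeval
    (fun i : Fin m => if h : i.val < n then (MvPolynomial.X ⟨i.val, h⟩ : MvPolynomial (Fin n) 𝕜)
      else 0) f

/-- The operator `W_k`, the limit over `n` of the operators `W_k^{(n)}`. The latter commute with
setting `x_{n+1} = 0` for `n ≥ k`, and `weylSymm k n` is the identity for `n ≤ k`. -/
def weylLim (k : ℕ) (F : PolySeq 𝕜) : PolySeq 𝕜 := fun n => weylSymm k n (F n)

variable (𝕜)

/-- The recursion `s_(μ|∅) = 𝒦_μ`,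
`s_(μ_1, …, μ_{r-1} | μ_r, λ_1, …, λ_l) = W_{r-1} s_(μ_1, …, μ_r | λ_1, …, λ_l)`. -/
def schurRec : List ℕ → List ℕ → PolySeq 𝕜
  | μ, [] => extend (keyPoly (fun i : Fin μ.length => μ.get i))
  | μ, a :: l => weylLim μ.length (schurRec (μ ++ [a]) l)

/-- The almost symmetric Schur function `s_(μ|λ)`. -/
def almostSchur (p : SigmaPair) : PolySeq 𝕜 := schurRec 𝕜 p.comp p.part

/-- The monomial `x^α`. -/
def monomialSeq (α : List ℕ) : PolySeq 𝕜 :=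
  extend (∏ i : Fin α.length, MvPolynomial.X i ^ α.get i)

open Classical in
/-- The monomial symmetric function `m_ν[x_{k+1} + x_{k+2} + ⋯]`. -/
def msymmSeq (k : ℕ) (ν : List ℕ) : PolySeq 𝕜 := fun n =>
  MvPolynomial.rename Subtype.val
    (MvPolynomial.msymm {i : Fin n // k ≤ i.val} 𝕜 (Nat.Partition.ofMultiset (ν : Multiset ℕ)))

/-- Index set of the monomial basis of `𝒫(k)⁺`. -/
abbrev BasisIndex (k : ℕ) := {q : SigmaPair // q.comp.length ≤ k}

/-- The monomial basis `x^α m_ν[x_{k+1} + x_{k+2} + ⋯]`, `(α|ν) ∈ Σ`, `ℓ(α) ≤ k`, of `𝒫(k)⁺`. -/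
def monomialBasis (k : ℕ) (q : BasisIndex k) : PolySeq 𝕜 :=
  monomialSeq 𝕜 q.1.comp * msymmSeq 𝕜 k q.1.part

/-- The coefficients of `s_(μ|λ)` in the monomial basis of `𝒫(ℓ(μ))⁺`. -/
def kostkaCoeffs (p : SigmaPair) : BasisIndex p.comp.length →₀ 𝕜 :=
  Function.invFun (Finsupp.linearCombination 𝕜 (monomialBasis 𝕜 p.comp.length)) (almostSchur 𝕜 p)

/-- The almost symmetric Kostka coefficient `K^(μ|λ)_(α|ν)`, with `p = (μ|λ)`, `q = (α|ν)`. -/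
def kostka (p q : SigmaPair) : 𝕜 :=
  if h : q.comp.length ≤ p.comp.length then kostkaCoeffs 𝕜 p ⟨q, h⟩ else 0

end AlmostSymmetric

/-! ### Labellings of diagrams

Boxes are pairs `(i, j)` with `i ≥ 1` the column and `j` the row. -/

section Labellings

/-- The part `γ_i`, for `1 ≤ i ≤ ℓ(γ)`. -/
def height (γ : List ℕ) (i : ℕ) : ℕ := γ.getD (i - 1) 0

/-- The column diagram `dg'(γ)`. -/
def dg (γ : List ℕ) : Finset (ℕ × ℕ) :=
  (Finset.Icc 1 γ.length).biUnion fun i => (Finset.Icc 1 (height γ i)).image fun j => (i, j)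

/-- The augmented diagram of `γ`, with the extra boxes `(i, 0)`. -/
def augDg (γ : List ℕ) : Finset (ℕ × ℕ) :=
  dg γ ∪ (Finset.Icc 1 γ.length).image fun i => (i, 0)

/-- The number `a(u)` of boxes in the arm of `u`. -/
def armCard (γ : List ℕ) (u : ℕ × ℕ) : ℕ :=
  ((dg γ).filter fun v => v.2 = u.2 ∧ v.1 < u.1 ∧ height γ v.1 ≤ height γ u.1).card +
  ((augDg γ).filter fun v => v.2 + 1 = u.2 ∧ u.1 < v.1 ∧ height γ v.1 < height γ u.1).card

/-- Two boxes attack each other if they are in the same row, or in consecutive rows with the lower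
box to the right of the upper one. -/
def Attack (u v : ℕ × ℕ) : Prop :=
  u ≠ v ∧ (u.2 = v.2 ∨ (u.2 = v.2 + 1 ∧ u.1 < v.1) ∨ (v.2 = u.2 + 1 ∧ v.1 < u.1))

/-- `u` comes before `v` in the reading order: rows from top to bottom, and from right to left in
each row. -/
def ReadsBefore (u v : ℕ × ℕ) : Prop := v.2 < u.2 ∨ (u.2 = v.2 ∧ v.1 < u.1)

/-! The statistics of a labelling `τ` of the augmented diagram of `γ` (the values of `τ` at other
boxes are not used). Labels are ordinals. -/

def NonAttacking (γ : List ℕ) (τ : ℕ × ℕ → Ordinal.{0}) : Prop :=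
  ∀ u ∈ augDg γ, ∀ v ∈ augDg γ, Attack u v → τ u ≠ τ v

open Classical in
/-- The set of descents. -/
def descents (γ : List ℕ) (τ : ℕ × ℕ → Ordinal.{0}) : Finset (ℕ × ℕ) :=
  (dg γ).filter fun u => τ (u.1, u.2 - 1) < τ u

open Classical in
/-- The set of inversions. -/
def inversions (γ : List ℕ) (τ : ℕ × ℕ → Ordinal.{0}) : Finset ((ℕ × ℕ) × (ℕ × ℕ)) :=
  (augDg γ ×ˢ augDg γ).filter fun p =>
    Attack p.1 p.2 ∧ ReadsBefore p.1 p.2 ∧ τ p.2 < τ p.1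

/-- `inv = |Inv| - |{i < j : γ_i ≤ γ_j}| - ∑_{u ∈ Des} a(u)`. -/
def inv (γ : List ℕ) (τ : ℕ × ℕ → Ordinal.{0}) : ℤ :=
  (inversions γ τ).card -
    ((Finset.Icc 1 γ.length ×ˢ Finset.Icc 1 γ.length).filter fun p =>
      p.1 < p.2 ∧ height γ p.1 ≤ height γ p.2).card -
    ∑ u ∈ descents γ τ, (armCard γ u : ℤ)

/-- `coinv = ∑_u a(u) - inv`. -/
def coinv (γ : List ℕ) (τ : ℕ × ℕ → Ordinal.{0}) : ℤ :=
  ∑ u ∈ dg γ, (armCard γ u : ℤ) - inv γ τ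

/-- The composition `μ * rev(λ)`. -/
def shape (p : SigmaPair) : List ℕ := p.comp ++ p.part.reverse

/-- The labelling `σ⋆` of the augmented diagram of `μ * rev(λ)`: it extends `σ` by `j` on the boxes
`(j, 0)` with `j ≤ ℓ(μ)` and by `ω + j - ℓ(μ) - 1` on those with `j > ℓ(μ)`. -/
def star (p : SigmaPair) (σ : {u // u ∈ dg (shape p)} → ℕ) (u : ℕ × ℕ) : Ordinal.{0} :=
  if h : u ∈ dg (shape p) then ((σ ⟨u, h⟩ : ℕ) : Ordinal)
  else if u.1 ≤ p.comp.length then (u.1 : Ordinal)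
  else Ordinal.omega0 + ((u.1 - p.comp.length - 1 : ℕ) : Ordinal)

/-- The set `ℒ(μ|λ)` of labellings by positive integers. -/
def labellings (p : SigmaPair) : Set ({u // u ∈ dg (shape p)} → ℕ) :=
  {σ | (∀ u, 1 ≤ σ u) ∧ NonAttacking (shape p) (star p σ) ∧ coinv (shape p) (star p σ) = 0 ∧
    descents (shape p) (star p σ) = ∅}

/-- The number of boxes with label `i`. -/
def content {γ : List ℕ} (σ : {u // u ∈ dg γ} → ℕ) (i : ℕ) : ℕ :=
  (Finset.univ.filter fun u => σ u = i).card

/-- The set `L_(α|ν)(μ|λ)`, with `p = (μ|λ)` and `q = (α|ν)`, `ℓ(α) ≤ ℓ(μ)`: labellings in `ℒ(μ|λ)`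
with labels at most `ℓ(μ) + ℓ(ν)`, in which `i ≤ ℓ(μ)` occurs `α_i` times (`α` being padded by
zeros), and `ℓ(μ) + i` occurs `ν_i` times for `1 ≤ i ≤ ℓ(ν)`. -/
def kostkaLabellings (p q : SigmaPair) : Set ({u // u ∈ dg (shape p)} → ℕ) :=
  {σ | σ ∈ labellings p ∧ (∀ u, σ u ≤ p.comp.length + q.part.length) ∧
    (∀ i ∈ Finset.Icc 1 p.comp.length, content σ i = height q.comp i) ∧
    ∀ i ∈ Finset.Icc 1 q.part.length, content σ (p.comp.length + i) = height q.part i}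

end Labellings

end AlmostSym

end

/-! In n ≥ ℓ(μ)+ℓ(λ) variables, s_(μ|λ) is one key polynomial, and key polynomials are generating
functions of labellings of the kind counted by the theorem. Write ξ for the isobaric divided
differences.

Reduction to key polynomials. For i > k one has W_k ξ_i = W_k: pairing each permutation w with w s_i
shows that 2 W_k f depends only on ξ_i f, and ξ_i is idempotent (`weylRat_isobaric`). Moreover W_k
fixes polynomials symmetric after the k-th variable, by a Vandermonde identity
(`sum_prod_vandermonde`). Hence W_k sends 𝒦_a to 𝒦_b, where b is a with the entries after the k-th
sorted increasingly, and the recursion yields the key polynomial of (μ, 0, …, 0, rev λ)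
(`schurRec_eq_keyPoly`).

Combinatorial formula for 𝒦_h (`keyPoly_eq_bodySum`). Let F_h be the generating function of the
labellings with basement 1, …, n that are non-attacking and have neither descents nor coinversion
triples, basement boxes included in the weight. It satisfies the recursion of the key polynomials,
for two reasons. Let q = p+1.

If h_p ≤ h_q, then F_h is symmetric in x_p and x_q (`rename_augSum`). Group the labellings that
agree once the labels p and q are identified. Within a group, the boxes labelled p or q, taken in
reading order, form a binary word whose constraints involve only consecutive letters, and the
generating function of such words is symmetric (`map_wordSum`).

If h_q < h_p and h' is h with these two heights exchanged, then F_{h'} = F_h + x_q H with H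
symmetric in x_p and x_q. The labellings of h' in which column p stays below the shifted column q
contribute x_q H, again by counting words (`exists_sum_uncrossed`). The others correspond to the
labellings of h by exchanging the columns p and q from a suitable row upwards (`sum_crossed`). That
the triples with a third column survive the exchange is a counting matter: a pair of columns has no
coinversion triple exactly when its number of inversions is maximal (`PairNonAttacking.pairInv_le`).
Since F_{h'} and H are symmetric, ξ F_h = F_{h'}. For weakly decreasing h there is a single
labelling.

Comparison with ℒ(μ|λ). Without descents, coinv is a sum over pairs of columns of the non-negative
differences between the maximal and the actual number of inversions, so coinv = 0 excludes
coinversion triples (`good_iff_coinv`). The infinite basement labels agree with the finite ones: in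
the columns of rev λ the first row is strictly increasing, so labels at most n are automatically
bounded by the column number after padding (`labelsOf_mem_iff`).

Coefficients. Each monomial occurs in exactly one basis function, with coefficient 1, so the basis
is independent. The coefficient of x^α m_ν in a function symmetric after the ℓ(μ)-th variable is
that of x^(α,ν,0,…), which counts labellings of the prescribed content. -/

noncomputable section

namespace AlmostSym

/-! ### Generating functions of binary words with constraints on consecutive letters -/

section Words

/-- The possible constraints on two consecutive letters of a binary word. -/
inductive Gap
  | alt | forced | le | free | top

/-- The relation imposed by a constraint; a letter is recorded by whether it is `1`. -/
def Gap.rel : Gap → Prop → Prop → Prop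
  | .alt, a, b => a ↔ ¬ b
  | .forced, a, b => a ∧ ¬ b
  | .le, a, b => a → b
  | .free, _, _ => True
  | .top, a, b => a ∧ b

/-- The word of length `N` with letter `1` at the positions in `E` satisfies the constraints. -/
def WordOK (g : ℕ → Gap) (N : ℕ) (E : Finset ℕ) : Prop :=
  ∀ k, k + 1 < N → (g k).rel (k ∈ E) (k + 1 ∈ E)

variable {A : Type*} [CommRing A] (x₀ x₁ : A)

/-- The weight of a word of length `N`. -/
def wordWeight (N : ℕ) (E : Finset ℕ) : A := ∏ k ∈ Finset.range N, if k ∈ E then x₁ else x₀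

open Classical in
/-- The generating function of the words of length `n + 1`. -/
def wordSum (g : ℕ → Gap) (n : ℕ) : A :=
  ∑ E ∈ (Finset.range (n + 1)).powerset with WordOK g (n + 1) E, wordWeight x₀ x₁ (n + 1) E

open Classical in
/-- The generating function of the words of length `n + 1` with last letter `0`. -/
def wordSum₀ (g : ℕ → Gap) (n : ℕ) : A :=
  ∑ E ∈ (Finset.range (n + 1)).powerset with WordOK g (n + 1) E ∧ n ∉ E,
    wordWeight x₀ x₁ (n + 1) E

open Classical in
/-- The generating function of the words of length `n + 1` with last letter `1`. -/
def wordSum₁ (g : ℕ → Gap) (n : ℕ) : A :=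
  ∑ E ∈ (Finset.range (n + 1)).powerset with WordOK g (n + 1) E ∧ n ∈ E,
    wordWeight x₀ x₁ (n + 1) E

theorem wordSum_eq (g : ℕ → Gap) (n : ℕ) :
    wordSum x₀ x₁ g n = wordSum₀ x₀ x₁ g n + wordSum₁ x₀ x₁ g n := by
  classical
  rw [wordSum, wordSum₀, wordSum₁, add_comm (Finset.sum _ _), ← Finset.filter_filter, ← Finset.filter_filter,
    Finset.sum_filter_add_sum_filter_not]

theorem wordOK_succ (g : ℕ → Gap) (n : ℕ) (E : Finset ℕ) :
    WordOK g (n + 2) E ↔ WordOK g (n + 1) E ∧ (g n).rel (n ∈ E) (n + 1 ∈ E) := by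
  constructor
  · intro h
    exact ⟨fun k hk => h k (by omega), h n (by omega)⟩
  · rintro ⟨h1, h2⟩ k hk
    rcases Nat.lt_or_ge (k + 1) (n + 1) with h | h
    · exact h1 k h
    · obtain rfl : k = n := by omega
      exact h2

theorem wordOK_insert (g : ℕ → Gap) (n : ℕ) (E : Finset ℕ) :
    WordOK g (n + 1) (insert (n + 1) E) ↔ WordOK g (n + 1) E := by
  refine forall₂_congr fun k hk => ?_
  have h1 : k ≠ n + 1 := by omega
  have h2 : k + 1 ≠ n + 1 := by omega
  simp only [Finset.mem_insert, h1, h2, false_or]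

theorem wordSum₀_zero (g : ℕ → Gap) : wordSum₀ x₀ x₁ g 0 = x₀ := by
  classical
  have : (Finset.range 1).powerset.filter (fun E => WordOK g 1 E ∧ 0 ∉ E) = {∅} := by
    ext E
    rw [Finset.mem_filter, Finset.mem_powerset, Finset.mem_singleton]
    constructor
    · rintro ⟨h1, -, h2⟩
      refine Finset.eq_empty_of_forall_notMem fun x hx => h2 ?_
      have := Finset.mem_range.1 (h1 hx)
      obtain rfl : x = 0 := by omega
      exact hx
    · rintro rfl
      simp [WordOK]
  rw [wordSum₀, this]
  simp [wordWeight]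

theorem wordSum₁_zero (g : ℕ → Gap) : wordSum₁ x₀ x₁ g 0 = x₁ := by
  classical
  have : (Finset.range 1).powerset.filter (fun E => WordOK g 1 E ∧ 0 ∈ E) = {{0}} := by
    ext E
    rw [Finset.mem_filter, Finset.mem_powerset, Finset.mem_singleton]
    constructor
    · rintro ⟨h1, -, h2⟩
      exact Finset.Subset.antisymm h1 (by simpa using h2)
    · rintro rfl
      simp [WordOK]
  rw [wordSum₁, this]
  simp [wordWeight]

theorem wordWeight_succ_of_notMem (n : ℕ) (E : Finset ℕ) (h : n ∉ E) :
    wordWeight x₀ x₁ (n + 1) E = wordWeight x₀ x₁ n E * x₀ := by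
  rw [wordWeight, Finset.prod_range_succ, if_neg h, wordWeight]

theorem wordWeight_insert (n : ℕ) (E : Finset ℕ) :
    wordWeight x₀ x₁ (n + 1) (insert n E) = wordWeight x₀ x₁ n E * x₁ := by
  rw [wordWeight, Finset.prod_range_succ, if_pos (Finset.mem_insert_self _ _), wordWeight]
  congr 1
  refine Finset.prod_congr rfl fun k hk => ?_
  have : k ≠ n := (Finset.mem_range.1 hk).ne
  simp [this]

open Classical in
theorem wordSum₀_succ (g : ℕ → Gap) (n : ℕ) :
    wordSum₀ x₀ x₁ g (n + 1) =
      ((if (g n).rel False False then wordSum₀ x₀ x₁ g n else 0) +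
        if (g n).rel True False then wordSum₁ x₀ x₁ g n else 0) * x₀ := by
  have hE : ∀ E ∈ (Finset.range (n + 1)).powerset, n + 1 ∉ E := fun E hE h => by
    simpa using Finset.mem_powerset.1 hE h
  rw [wordSum₀, wordSum₀, wordSum₁, Finset.sum_filter, Finset.range_add_one,
    Finset.sum_powerset_insert (by simp), Finset.sum_filter, Finset.sum_filter]
  simp only [Finset.mem_insert_self, not_true, and_false, if_false, Finset.sum_const_zero, add_zero]
  have : ∀ P : Prop, ∀ [Decidable P], ∀ a : A, (if P then a else 0) = (if P then 1 else 0) * a := by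
    intro P _ a; split_ifs <;> simp
  rw [this ((g n).rel False False), this ((g n).rel True False), Finset.mul_sum, Finset.mul_sum,
    ← Finset.sum_add_distrib, Finset.sum_mul]
  refine Finset.sum_congr rfl fun E h => ?_
  rw [wordOK_succ, wordWeight_succ_of_notMem _ _ _ _ (hE E h)]
  have h' := hE E h
  by_cases hn : n ∈ E <;> by_cases h1 : WordOK g (n + 1) E <;>
    simp only [hn, h', h1, not_true, not_false_iff, and_true, and_false, true_and, false_and,
      if_true, if_false, mul_zero, zero_mul, add_zero, zero_add] <;>
    split_ifs <;> simp

open Classical in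
theorem wordSum₁_succ (g : ℕ → Gap) (n : ℕ) :
    wordSum₁ x₀ x₁ g (n + 1) =
      ((if (g n).rel False True then wordSum₀ x₀ x₁ g n else 0) +
        if (g n).rel True True then wordSum₁ x₀ x₁ g n else 0) * x₁ := by
  have hE : ∀ E ∈ (Finset.range (n + 1)).powerset, n + 1 ∉ E := fun E hE h => by
    simpa using Finset.mem_powerset.1 hE h
  rw [wordSum₁, wordSum₀, wordSum₁, Finset.sum_filter, Finset.range_add_one,
    Finset.sum_powerset_insert (by simp), Finset.sum_filter, Finset.sum_filter]
  rw [add_eq_right.2 (Finset.sum_eq_zero fun E h => if_neg fun h' => hE E h h'.2)]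
  have : ∀ P : Prop, ∀ [Decidable P], ∀ a : A, (if P then a else 0) = (if P then 1 else 0) * a := by
    intro P _ a; split_ifs <;> simp
  rw [this ((g n).rel False True), this ((g n).rel True True), Finset.mul_sum, Finset.mul_sum,
    ← Finset.sum_add_distrib, Finset.sum_mul]
  refine Finset.sum_congr rfl fun E h => ?_
  rw [wordOK_succ, wordOK_insert, wordWeight_insert]
  by_cases hn : n ∈ E <;> by_cases h1 : WordOK g (n + 1) E <;>
    simp only [hn, h1, not_true, not_false_iff, and_true, and_false, true_and, false_and,
      Finset.mem_insert, true_or, or_true,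
      if_true, if_false, mul_zero, zero_mul, add_zero, zero_add] <;>
    split_ifs <;> simp_all

variable {x₀ x₁} {s : A →+* A} (h₀ : s x₀ = x₁) (h₁ : s x₁ = x₀)
include h₀ h₁

/-- Constraints `alt` that come in pairs, `mid k` telling that position `k` is in the middle of
such a pair. -/
def PairedAt (g : ℕ → Gap) (mid : ℕ → Prop) (k : ℕ) : Prop :=
  (mid k → g k = .alt ∧ ¬ mid (k + 1)) ∧
    (¬ mid k → (g k = .alt ∧ mid (k + 1)) ∨
      (¬ mid (k + 1) ∧ (g k = .forced ∨ g k = .le ∨ g k = .free)))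

/-- The pair (S, R) is carried along the word. A pair of consecutive `alt` multiplies both by x₀x₁,
`forced` gives (x₀x₁R, 0), `le` gives ((x₀+x₁)S − x₀x₁R, S) and `free` gives ((x₀+x₁)S, S). All
these keep S and R invariant under s; only in the middle of an `alt` pair does the total lack the
form S. -/
theorem exists_wordSum_form (g : ℕ → Gap) (mid : ℕ → Prop) (h : ¬ mid 0) (n : ℕ)
    (hg : ∀ k < n, PairedAt g mid k) :
    ∃ S R : A, s S = S ∧ s R = R ∧
      (¬ mid n → wordSum₀ x₀ x₁ g n = S - x₁ * R ∧ wordSum₁ x₀ x₁ g n = x₁ * R) ∧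
      (mid n → wordSum₀ x₀ x₁ g n = x₀ * x₁ * R ∧ wordSum₁ x₀ x₁ g n = x₁ * S - x₁ ^ 2 * R) := by
  induction n with
  | zero =>
    -- A single letter has sums x₀ and x₁, that is S = x₀ + x₁ and R = 1.
    refine ⟨x₀ + x₁, 1, by rw [map_add, h₀, h₁, add_comm], map_one s, fun _ => ?_, fun h' => ?_⟩
    · rw [wordSum₀_zero, wordSum₁_zero]; constructor <;> ring
    · exact absurd h' h
  | succ n ih =>
    obtain ⟨S, R, hS, hR, e1, e2⟩ := ih fun k hk => hg k (by omega)
    obtain ⟨a1, a2⟩ := hg n (by omega)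
    rw [wordSum₀_succ, wordSum₁_succ]
    by_cases hm : mid n
    · obtain ⟨b1, b2⟩ := a1 hm
      obtain ⟨c1, c2⟩ := e2 hm
      refine ⟨x₀ * x₁ * S, x₀ * x₁ * R, by simp [hS, h₀, h₁, mul_comm], by simp [hR, h₀, h₁, mul_comm],
        fun _ => ?_, fun h' => absurd h' b2⟩
      simp [b1, c1, c2, Gap.rel]
      constructor <;> ring
    · obtain ⟨c1, c2⟩ := e1 hm
      rcases a2 hm with ⟨b1, b2⟩ | ⟨b2, b1 | b1 | b1⟩
      · refine ⟨S, R, hS, hR, fun h' => absurd b2 h', fun _ => ?_⟩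
        simp [b1, c1, c2, Gap.rel]
        constructor <;> ring
      · refine ⟨x₀ * x₁ * R, 0, by simp [hR, h₀, h₁, mul_comm], map_zero s, fun _ => ?_,
          fun h' => absurd h' b2⟩
        simp [b1, c2, Gap.rel]
        try ring
      · refine ⟨x₀ * S - x₀ * x₁ * R + x₁ * S, S, ?_, hS, fun _ => ?_, fun h' => absurd h' b2⟩
        · simp [hR, hS, h₀, h₁]; ring
        simp [b1, c1, c2, Gap.rel]
        constructor <;> ring
      · refine ⟨(x₀ + x₁) * S, S, ?_, hS, fun _ => ?_, fun h' => absurd h' b2⟩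
        · simp [hS, h₀, h₁, add_comm]
        simp [b1, c1, c2, Gap.rel]
        constructor <;> ring

theorem map_wordSum (g : ℕ → Gap) (mid : ℕ → Prop) (n : ℕ) (h : ¬ mid 0) (h' : ¬ mid n)
    (hg : ∀ k < n, PairedAt g mid k) :
    s (wordSum x₀ x₁ g n) = wordSum x₀ x₁ g n := by
  obtain ⟨S, R, hS, hR, e1, -⟩ := exists_wordSum_form h₀ h₁ g mid h n hg
  obtain ⟨c1, c2⟩ := e1 h'
  rw [wordSum_eq, c1, c2, sub_add_cancel, hS]

/-- From `top` on, one last letter is impossible at each position, so the sums alternate between the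
forms (0, x₁²R) and (x₁R, 0) or vanish. The final `forced` turns the first form into x₁ · x₀x₁R. -/
theorem exists_wordSum_eq_mul (g : ℕ → Gap) (mid : ℕ → Prop) (n k₀ : ℕ) (h : ¬ mid 0)
    (hk₀ : k₀ < n) (hm : ¬ mid k₀) (hg : ∀ k < k₀, PairedAt g mid k) (ht : g k₀ = .top)
    (hn : ∀ k, k₀ < k → k ≤ n → g k = .alt ∨ g k = .forced) (hl : g n = .forced) :
    ∃ H : A, s H = H ∧ wordSum x₀ x₁ g (n + 1) = x₁ * H := by
  obtain ⟨S, R, hS, hR, e1, -⟩ := exists_wordSum_form h₀ h₁ g mid h k₀ hg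
  obtain ⟨c1, c2⟩ := e1 hm
  have key : ∀ m, k₀ + 1 + m ≤ n + 1 →
      (∃ R, s R = R ∧ wordSum₀ x₀ x₁ g (k₀ + 1 + m) = 0 ∧
        wordSum₁ x₀ x₁ g (k₀ + 1 + m) = x₁ ^ 2 * R) ∨
      (∃ R, s R = R ∧ wordSum₀ x₀ x₁ g (k₀ + 1 + m) = x₁ * R ∧
        wordSum₁ x₀ x₁ g (k₀ + 1 + m) = 0) := by
    intro m
    induction m with
    | zero =>
      intro _
      left
      refine ⟨R, hR, ?_, ?_⟩
      · rw [add_zero, wordSum₀_succ]; simp [ht, Gap.rel]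
      · rw [add_zero, wordSum₁_succ]; simp [ht, Gap.rel, c2]; ring
    | succ m ih =>
      intro hm'
      rw [← add_assoc, wordSum₀_succ, wordSum₁_succ]
      rcases hn (k₀ + 1 + m) (by omega) (by omega) with b | b <;>
        rcases ih (by omega) with ⟨R, hR, d1, d2⟩ | ⟨R, hR, d1, d2⟩
      · right
        refine ⟨x₀ * x₁ * R, by simp [hR, h₀, h₁, mul_comm], ?_, ?_⟩
        · simp [b, Gap.rel, d2]; ring
        · simp [b, Gap.rel, d1]
      · left
        refine ⟨R, hR, ?_, ?_⟩
        · simp [b, Gap.rel, d2]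
        · simp [b, Gap.rel, d1]; ring
      · right
        refine ⟨x₀ * x₁ * R, by simp [hR, h₀, h₁, mul_comm], ?_, ?_⟩
        · simp [b, Gap.rel, d2]; ring
        · simp [b, Gap.rel]
      · right
        refine ⟨0, map_zero s, ?_, ?_⟩
        · simp [b, Gap.rel, d2]
        · simp [b, Gap.rel]
  obtain ⟨m, rfl⟩ : ∃ m, n = k₀ + 1 + m := ⟨n - (k₀ + 1), by omega⟩
  rw [wordSum_eq, wordSum₀_succ, wordSum₁_succ]
  rcases key m (by omega) with ⟨R, hR, d1, d2⟩ | ⟨R, hR, d1, d2⟩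
  · refine ⟨x₀ * x₁ * R, by simp [hR, h₀, h₁, mul_comm], ?_⟩
    simp [hl, Gap.rel, d2]; ring
  · refine ⟨0, map_zero s, ?_⟩
    simp [hl, Gap.rel, d2]

end Words

end AlmostSym

namespace AlmostSym

/-! ### Fillings of augmented diagrams

A box is a pair `(c, j)` of a column and a row; it lies in the augmented diagram with column heights
`h` if `j ≤ h c`. -/

section Boxes

variable {C Λ : Type*} [LinearOrder C] [LinearOrder Λ]

/-- The reading order. -/
def Before (u v : C × ℕ) : Prop := v.2 < u.2 ∨ (u.2 = v.2 ∧ v.1 < u.1)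

/-- The boxes `u`, `v` of the augmented diagram attack each other, `u` being read first. -/
structure Att (h : C → ℕ) (u v : C × ℕ) : Prop where
  left : u.2 ≤ h u.1
  right : v.2 ≤ h v.1
  rel : (u.2 = v.2 ∧ v.1 < u.1) ∨ (u.2 = v.2 + 1 ∧ u.1 < v.1)

/-- The box `u` of the augmented diagram lies directly above `w`. -/
def Over (h : C → ℕ) (u w : C × ℕ) : Prop := u.2 ≤ h u.1 ∧ u.1 = w.1 ∧ u.2 = w.2 + 1

/-- The boxes `u`, `v`, `w` form a triple: `u` lies above `w`, and `v` lies in the arm of `u`. -/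
def Tri (h : C → ℕ) (u v w : C × ℕ) : Prop :=
  Over h u w ∧ v.2 ≤ h v.1 ∧ ((v.2 = u.2 ∧ v.1 < u.1 ∧ h v.1 ≤ h u.1) ∨
    (v.2 = w.2 ∧ u.1 < v.1 ∧ h v.1 < h u.1))

/-- The labelling `τ` is non-attacking, has no descents, and no triple is a coinversion triple. -/
structure Good (h : C → ℕ) (τ : C × ℕ → Λ) : Prop where
  att : ∀ u v, Att h u v → τ u ≠ τ v
  le : ∀ u w, Over h u w → τ u ≤ τ w
  tri : ∀ u v w, Tri h u v w → ¬ (τ u < τ v ∧ τ v < τ w)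

variable {h : C → ℕ} {u v w x y : C × ℕ}

theorem Before.asymm (h1 : Before u v) : ¬ Before v u := by
  unfold Before at *
  have := @lt_asymm C _ u.1 v.1
  grind

theorem Before.ne (h1 : Before u v) : u ≠ v := by
  rintro rfl
  exact h1.asymm h1

theorem Att.before (h1 : Att h u v) : Before u v := by
  have := h1.rel
  unfold Before
  grind

theorem Over.before (h1 : Over h u v) : Before u v := by
  unfold Before Over at *
  grind

omit [LinearOrder C] in
theorem Over.right (h1 : Over h u v) : v.2 ≤ h v.1 := by
  obtain ⟨h1, h2, h3⟩ := h1
  rw [← h2]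
  omega

/-- The boxes attacked by u are those read after u and before the place directly below it, so they
form an interval of the reading order. -/
theorem Att.between (h1 : Att h u v) (hx : x.2 ≤ h x.1) (h2 : Before u x) (h3 : Before x v) :
    Att h u x ∧ Att h x v := by
  obtain ⟨a, b, c⟩ := h1
  unfold Before at *
  refine ⟨⟨a, hx, ?_⟩, ⟨hx, b, ?_⟩⟩ <;> grind

theorem Over.between (h1 : Over h u w) (hx : x.2 ≤ h x.1) (h2 : Before u x) (h3 : Before x w) :
    Att h u x ∧ Att h x w := by
  have hw := h1.right
  obtain ⟨a, b, c⟩ := h1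
  unfold Before at *
  refine ⟨⟨a, hx, ?_⟩, ⟨hx, hw, ?_⟩⟩ <;> grind

theorem Over.between₂ (h1 : Over h u w) (hx : x.2 ≤ h x.1) (hy : y.2 ≤ h y.1) (h2 : Before u x)
    (h3 : Before x y) (h4 : Before y w) : Att h x y := by
  obtain ⟨a, b, c⟩ := h1
  unfold Before at *
  refine ⟨hx, hy, ?_⟩
  grind

theorem Tri.att (h1 : Tri h u v w) : Att h u v ∧ Att h v w := by
  have hw := h1.1.right
  obtain ⟨⟨a, b, c⟩, hv, h2⟩ := h1
  refine ⟨⟨a, hv, ?_⟩, ⟨hv, hw, ?_⟩⟩ <;> grind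

/-- The third box lies below u or above v, according to which of the two columns counts as the
taller one. Only in the basement can the required box below u be missing. -/
theorem Att.tri (h1 : Att h u v) : (∃ w, Tri h u v w) ∨ (∃ w, Tri h w u v) ∨
    (u.2 = 0 ∧ v.2 = 0 ∧ h v.1 ≤ h u.1) := by
  obtain ⟨a, b, ⟨h2, h3⟩ | ⟨h2, h3⟩⟩ := h1
  · rcases le_or_gt (h v.1) (h u.1) with h4 | h4
    · rcases Nat.eq_zero_or_pos u.2 with h5 | h5
      · exact Or.inr (Or.inr ⟨h5, h2 ▸ h5, h4⟩)
      · exact Or.inl ⟨(u.1, u.2 - 1), ⟨a, rfl, (Nat.succ_pred_eq_of_pos h5).symm⟩, b,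
          Or.inl ⟨h2.symm, h3, h4⟩⟩
    · exact Or.inr (Or.inl ⟨(v.1, v.2 + 1), ⟨by simp; omega, rfl, rfl⟩, a, Or.inr ⟨h2, h3, h4⟩⟩)
  · rcases lt_or_ge (h v.1) (h u.1) with h4 | h4
    · exact Or.inl ⟨(u.1, v.2), ⟨a, rfl, h2⟩, b, Or.inr ⟨rfl, h3, h4⟩⟩
    · exact Or.inr (Or.inl ⟨(v.1, v.2 + 1), ⟨by simp; omega, rfl, rfl⟩, a, Or.inl ⟨h2, h3, h4⟩⟩)

/-- The two triples would make opposite demands on the heights of the two columns involved. So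
triples do not overlap in two boxes, which is why alternations come in pairs. -/
theorem Tri.not_tri (h1 : Tri h u v w) : ¬ Tri h v w x := by
  unfold Tri Over at *
  rintro h2
  have := @lt_asymm C _ u.1 v.1
  grind

theorem Tri.right_unique (h1 : Tri h u v w) (h2 : Tri h u v x) : w = x := by
  unfold Tri Over at *
  apply Prod.ext <;> grind

variable {τ τ₀ : C × ℕ → Λ} {p q : Λ}

/-- The labels `p < q` are consecutive. -/
def Consec (p q : Λ) : Prop := p < q ∧ ∀ x, x ≠ p → x ≠ q → (x < p ∧ x < q) ∨ (p < x ∧ q < x)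

/-- The conditions on the labels of two boxes with labels in `{p, q}`. -/
def PairOK (h : C → ℕ) (p q : Λ) (B : Finset (C × ℕ)) (τ : C × ℕ → Λ) (u v : C × ℕ) : Prop :=
  (Att h u v → τ u ≠ τ v) ∧
  (Att h u v → ¬ ((∃ w ∈ B, Tri h u v w) ∨ ∃ w ∈ B, Tri h w u v) → τ u = q ∧ τ v = p) ∧
  (Over h u v → τ u ≤ τ v)

/-- The labellings `τ` and `τ₀` differ only in boxes labelled by `p` or `q`, which form the set
`B`. -/
structure SameClass (h : C → ℕ) (p q : Λ) (B : Finset (C × ℕ)) (τ₀ τ : C × ℕ → Λ) : Prop where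
  mem : ∀ u, u ∈ B ↔ u.2 ≤ h u.1 ∧ (τ₀ u = p ∨ τ₀ u = q)
  eq_of_notMem : ∀ u, u ∉ B → τ u = τ₀ u
  eq_of_mem : ∀ u ∈ B, τ u = p ∨ τ u = q

theorem SameClass.lt_iff {B : Finset (C × ℕ)} (hc : SameClass h p q B τ₀ τ) (hpq : Consec p q)
    (hu : u.2 ≤ h u.1) (hv : v.2 ≤ h v.1) (huv : ¬ (u ∈ B ∧ v ∈ B)) :
    (τ u < τ v ↔ τ₀ u < τ₀ v) ∧ (τ u = τ v ↔ τ₀ u = τ₀ v) := by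
  have m1 := hc.mem u
  have m2 := hc.mem v
  have e1 := hc.eq_of_notMem u
  have e2 := hc.eq_of_notMem v
  have d1 := hc.eq_of_mem u
  have d2 := hc.eq_of_mem v
  have c1 := hpq.2 (τ₀ u)
  have c2 := hpq.2 (τ₀ v)
  by_cases hu' : u ∈ B <;> by_cases hv' : v ∈ B <;> grind

/-- If the third box of a triple has a label other than p and q, that label compares in the same way
with both. The absence of descents decides whether it is above or below them, and then the triple
condition fixes the order of the other two labels: q first, p second. -/
theorem Good.pairOK {B : Finset (C × ℕ)} (hg : Good h τ) (hc : SameClass h p q B τ₀ τ)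
    (hpq : Consec p q)
    (hb : ∀ u ∈ B, ∀ v ∈ B, Att h u v → u.2 = 0 → v.2 = 0 → τ u = q ∧ τ v = p)
    (hu : u ∈ B) (hv : v ∈ B) : PairOK h p q B τ u v := by
  refine ⟨hg.att u v, fun ha hn => ?_, hg.le u v⟩
  have d1 := hc.eq_of_mem u hu
  have d2 := hc.eq_of_mem v hv
  have hne := hg.att u v ha
  rcases ha.tri with ⟨w, hw⟩ | ⟨w, hw⟩ | ⟨h1, h2, -⟩
  · have hwB : w ∉ B := fun h' => hn (Or.inl ⟨w, h', hw⟩)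
    have hw0 := hw.1.right
    have m := hc.mem w
    have e := hc.eq_of_notMem w hwB
    have c := hpq.2 (τ w)
    have t := hg.tri u v w hw
    have o := hg.le u w hw.1
    have := hpq.1
    grind
  · have hwB : w ∉ B := fun h' => hn (Or.inr ⟨w, h', hw⟩)
    have hw0 := hw.1.1
    have m := hc.mem w
    have e := hc.eq_of_notMem w hwB
    have c := hpq.2 (τ w)
    have t := hg.tri w u v hw
    have o := hg.le w v hw.1
    have := hpq.1
    grind
  · exact hb u hu v hv ha h1 h2

/-- Comparisons involving a box outside B do not change inside a class, because p and q are
consecutive. A triple inside B reads p, q, p or q, p, q, which is no strict chain; a triple with two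
attacking boxes u, v or v, w in B has them in the order q, p. -/
theorem SameClass.good {B : Finset (C × ℕ)} (hc : SameClass h p q B τ₀ τ) (hg : Good h τ₀)
    (hpq : Consec p q) (hp : ∀ u ∈ B, ∀ v ∈ B, PairOK h p q B τ u v) : Good h τ := by
  have hlt := hpq.1
  refine ⟨fun u v ha => ?_, fun u v ha => ?_, fun u v w ha => ?_⟩
  · by_cases huv : u ∈ B ∧ v ∈ B
    · exact (hp u huv.1 v huv.2).1 ha
    · rw [Ne, (hc.lt_iff hpq ha.left ha.right huv).2]
      exact hg.att u v ha
  · by_cases huv : u ∈ B ∧ v ∈ B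
    · exact (hp u huv.1 v huv.2).2.2 ha
    · rw [le_iff_lt_or_eq, (hc.lt_iff hpq ha.1 ha.right huv).2, (hc.lt_iff hpq ha.1 ha.right huv).1,
        ← le_iff_lt_or_eq]
      exact hg.le u v ha
  · obtain ⟨a1, a2⟩ := ha.att
    have t := hg.tri u v w ha
    have l1 := hc.lt_iff hpq a1.left a1.right
    have l2 := hc.lt_iff hpq a2.left a2.right
    by_cases hu : u ∈ B <;> by_cases hv : v ∈ B <;> by_cases hw : w ∈ B
    · have d1 := hc.eq_of_mem u hu
      have d2 := hc.eq_of_mem v hv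
      have d3 := hc.eq_of_mem w hw
      have := (hp u hu v hv).1 a1
      have := (hp v hv w hw).1 a2
      grind
    · have := (hp u hu v hv).2.1 a1 (by
        rintro (⟨x, hx, h1⟩ | ⟨x, hx, h1⟩)
        · exact hw (ha.right_unique h1 ▸ hx)
        · exact h1.not_tri ha)
      grind
    · grind
    · grind
    · have := (hp v hv w hw).2.1 a2 (by
        rintro (⟨x, hx, h1⟩ | ⟨x, hx, h1⟩)
        · exact ha.not_tri h1
        · have : x = u := Prod.ext (h1.1.2.1.trans ha.1.2.1.symm) (h1.1.2.2.trans ha.1.2.2.symm)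
          exact hu (this ▸ hx))
      grind
    · grind
    · grind
    · grind

end Boxes

end AlmostSym

namespace AlmostSym

/-! ### Classes of labellings as binary words in reading order -/

section Enumeration

variable {C Λ : Type*} [LinearOrder C] [LinearOrder Λ]

/-- A nonempty finite set of boxes, listed in reading order. -/
structure Reading (B : Finset (C × ℕ)) (n : ℕ) (e : ℕ → C × ℕ) : Prop where
  mem_iff : ∀ u, u ∈ B ↔ ∃ k ≤ n, e k = u
  before : ∀ k l, k < l → l ≤ n → Before (e k) (e l)

theorem exists_reading (B : Finset (C × ℕ)) (hB : B.Nonempty) : ∃ n e, Reading B n e := by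
  classical
  -- The reading order is the lexicographic order on (row, column), both reversed.
  let f : C × ℕ → ℕᵒᵈ ×ₗ Cᵒᵈ := fun u => toLex (OrderDual.toDual u.2, OrderDual.toDual u.1)
  let g : ℕᵒᵈ ×ₗ Cᵒᵈ → C × ℕ := fun u => (OrderDual.ofDual (ofLex u).2, OrderDual.ofDual (ofLex u).1)
  have hgf : ∀ u, g (f u) = u := fun _ => rfl
  have hfg : ∀ u, f (g u) = u := fun _ => rfl
  have hlt : ∀ a b, a < b → Before (g a) (g b) := by
    intro a b hab
    rw [Prod.Lex.lt_iff] at hab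
    rcases hab with h | ⟨h1, h2⟩
    · exact Or.inl h
    · exact Or.inr ⟨congrArg OrderDual.ofDual h1, h2⟩
  obtain ⟨n, hn⟩ : ∃ n, (B.image f).card = n + 1 :=
    ⟨(B.image f).card - 1, (Nat.succ_pred_eq_of_pos (Finset.card_pos.2 (hB.image f))).symm⟩
  let o := (B.image f).orderEmbOfFin hn
  refine ⟨n, fun k => g (o (Fin.ofNat (n + 1) k)), fun u => ⟨fun hu => ?_, ?_⟩, fun k l hkl hl => ?_⟩
  · have : f u ∈ Set.range o := by
      rw [Finset.range_orderEmbOfFin]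
      exact Finset.mem_coe.2 (Finset.mem_image_of_mem f hu)
    obtain ⟨k, hk⟩ := this
    refine ⟨k, Nat.lt_succ_iff.1 k.2, ?_⟩
    simp [hk, hgf]
  · rintro ⟨k, -, rfl⟩
    have := (B.image f).orderEmbOfFin_mem hn (Fin.ofNat (n + 1) k)
    obtain ⟨v, hv, e⟩ := Finset.mem_image.1 this
    have : g (o (Fin.ofNat (n + 1) k)) = v := by
      rw [← hgf v, e]
    rw [this]
    exact hv
  · refine hlt _ _ (o.strictMono ?_)
    rw [Fin.lt_def]
    simp only [Fin.ofNat]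
    rw [Nat.mod_eq_of_lt (by omega), Nat.mod_eq_of_lt (by omega)]
    exact hkl

variable {h : C → ℕ} {τ τ₀ : C × ℕ → Λ} {p q : Λ} {B : Finset (C × ℕ)} {n : ℕ} {e : ℕ → C × ℕ}

theorem Reading.mem (he : Reading B n e) {k : ℕ} (hk : k ≤ n) : e k ∈ B :=
  (he.mem_iff _).2 ⟨k, hk, rfl⟩

theorem Reading.lt (he : Reading B n e) {k l : ℕ} (hk : k ≤ n) (hb : Before (e k) (e l)) :
    k < l := by
  rcases lt_trichotomy k l with h1 | h1 | h1
  · exact h1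
  · subst h1
    exact absurd rfl hb.ne
  · exact absurd hb (he.before l k h1 hk).asymm

theorem Reading.inj (he : Reading B n e) {k l : ℕ} (hk : k ≤ n) (hl : l ≤ n) (hkl : e k = e l) :
    k = l := by
  rcases lt_trichotomy k l with h1 | h1 | h1
  · exact absurd hkl (he.before k l h1 hl).ne
  · exact h1
  · exact absurd hkl.symm (he.before l k h1 hk).ne

/-- The boxes number `k`, `k + 1`, `k + 2` form a triple. -/
def TriAt (h : C → ℕ) (n : ℕ) (e : ℕ → C × ℕ) (k : ℕ) : Prop :=
  k + 2 ≤ n ∧ Tri h (e k) (e (k + 1)) (e (k + 2))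

/-- The box number `k` is in the middle of such a triple. -/
def MidAt (h : C → ℕ) (n : ℕ) (e : ℕ → C × ℕ) (k : ℕ) : Prop := ∃ l, k = l + 1 ∧ TriAt h n e l

open Classical in
/-- The constraint on the labels of the boxes number `k` and `k + 1`. -/
def gapAt (h : C → ℕ) (n : ℕ) (e : ℕ → C × ℕ) (k : ℕ) : Gap :=
  if Att h (e k) (e (k + 1)) then
    if TriAt h n e k ∨ MidAt h n e k then .alt else .forced
  else if Over h (e k) (e (k + 1)) then .le else .free

theorem midAt_succ {k : ℕ} : MidAt h n e (k + 1) ↔ TriAt h n e k :=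
  ⟨fun ⟨_, h1, h2⟩ => Nat.succ_injective h1 ▸ h2, fun h1 => ⟨k, rfl, h1⟩⟩

theorem not_midAt_zero : ¬ MidAt h n e 0 := fun ⟨_, h1, _⟩ => by omega

theorem not_midAt_last : ¬ MidAt h n e n := fun ⟨_, h1, h2, _⟩ => by omega

theorem MidAt.att {k : ℕ} (hk : MidAt h n e k) : Att h (e k) (e (k + 1)) := by
  obtain ⟨l, rfl, h2⟩ := hk
  exact h2.2.att.2

/-- A triple of consecutive boxes produces two `alt` constraints, and by `Tri.not_tri` the second of
them does not start another triple. -/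
theorem pairedAt_gapAt (k : ℕ) : PairedAt (gapAt h n e) (MidAt h n e) k := by
  have h1 : TriAt h n e k → Att h (e k) (e (k + 1)) := fun h1 => h1.2.att.1
  have h2 : MidAt h n e k → ¬ TriAt h n e k := by
    rintro ⟨l, rfl, h2⟩ h3
    exact h2.2.not_tri h3.2
  have h3 := MidAt.att (h := h) (n := n) (e := e) (k := k)
  unfold PairedAt gapAt
  rw [midAt_succ]
  by_cases hm : MidAt h n e k
  · simp [hm, h2 hm, h3 hm]
  · by_cases ht : TriAt h n e k
    · simp [hm, ht, h1 ht]
    · by_cases ha : Att h (e k) (e (k + 1)) <;> by_cases ho : Over h (e k) (e (k + 1)) <;>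
        simp [hm, ht, ha, ho]

theorem Good.not_triangle (hg : Good h τ) {u v w : C × ℕ} (hu : τ u = p ∨ τ u = q)
    (hv : τ v = p ∨ τ v = q) (hw : τ w = p ∨ τ w = q) (h1 : Att h u v) (h2 : Att h v w)
    (h3 : Att h u w) : False := by
  have := hg.att _ _ h1
  have := hg.att _ _ h2
  have := hg.att _ _ h3
  grind

/-- A box read between two attacking boxes attacks both, and three pairwise attacking boxes cannot
get distinct labels from {p, q}. -/
theorem Reading.att_succ (he : Reading B n e) (hg : Good h τ₀)
    (hB : ∀ u ∈ B, u.2 ≤ h u.1 ∧ (τ₀ u = p ∨ τ₀ u = q)) {k l : ℕ} (hk : k ≤ n) (hl : l ≤ n)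
    (ha : Att h (e k) (e l)) : l = k + 1 := by
  by_contra hne
  have hkl := he.lt hk ha.before
  have hm := hB _ (he.mem (k := k + 1) (by omega))
  obtain ⟨a1, a2⟩ := ha.between hm.1 (he.before k (k + 1) (by omega) (by omega))
    (he.before (k + 1) l (by omega) hl)
  exact hg.not_triangle (hB _ (he.mem hk)).2 hm.2 (hB _ (he.mem hl)).2 a1 a2 ha

/-- Boxes read between u and the box below it attack both of these and each other, so at most one of
them can have a label in {p, q}. -/
theorem Reading.over_succ (he : Reading B n e) (hg : Good h τ₀)
    (hB : ∀ u ∈ B, u.2 ≤ h u.1 ∧ (τ₀ u = p ∨ τ₀ u = q)) {k l : ℕ} (hk : k ≤ n) (hl : l ≤ n)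
    (ha : Over h (e k) (e l)) :
    l = k + 1 ∨ (l = k + 2 ∧ Att h (e k) (e (k + 1)) ∧ Att h (e (k + 1)) (e l)) := by
  by_contra! hne
  have hkl := he.lt hk ha.before
  have hm := hB _ (he.mem (k := k + 1) (by omega))
  have hm' := hB _ (he.mem (k := k + 2) (by omega))
  have hne1 := hne.1
  obtain ⟨a1, a2⟩ := ha.between hm.1 (he.before k (k + 1) (by omega) (by omega))
    (he.before (k + 1) l (by omega) hl)
  by_cases h2 : l = k + 2
  · exact hne.2 h2 a1 a2
  · obtain ⟨b1, b2⟩ := ha.between hm'.1 (he.before k (k + 2) (by omega) (by omega))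
      (he.before (k + 2) l (by omega) hl)
    exact hg.not_triangle (hB _ (he.mem hk)).2 hm.2 hm'.2 a1
      (ha.between₂ hm.1 hm'.1 (he.before k (k + 1) (by omega) (by omega))
        (he.before (k + 1) (k + 2) (by omega) (by omega))
        (he.before (k + 2) l (by omega) hl)) b1

/-- All conditions become conditions on neighbouring letters: attacking boxes are neighbours, and a
box two places before the one below it gets the same label after two alternations. The letter 1
stands for the label q. -/
theorem Reading.pairOK_iff (he : Reading B n e) (hg : Good h τ₀)
    (hB : ∀ u ∈ B, u.2 ≤ h u.1 ∧ (τ₀ u = p ∨ τ₀ u = q)) (hpq : p < q)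
    (hτ : ∀ u ∈ B, τ u = p ∨ τ u = q) (E : Finset ℕ) (hE : ∀ k ≤ n, k ∈ E ↔ τ (e k) = q) :
    (∀ u ∈ B, ∀ v ∈ B, PairOK h p q B τ u v) ↔ WordOK (gapAt h n e) (n + 1) E := by
  have hfull : ∀ k, k + 1 ≤ n → (((∃ w ∈ B, Tri h (e k) (e (k + 1)) w) ∨
      ∃ w ∈ B, Tri h w (e k) (e (k + 1))) ↔ TriAt h n e k ∨ MidAt h n e k) := by
    intro k hk
    refine or_congr ⟨?_, fun h1 => ⟨_, he.mem h1.1, h1.2⟩⟩ ⟨?_, ?_⟩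
    · rintro ⟨w, hw, ht⟩
      obtain ⟨m, hm, rfl⟩ := (he.mem_iff w).1 hw
      obtain rfl := he.att_succ hg hB hk hm ht.att.2
      exact ⟨hm, ht⟩
    · rintro ⟨w, hw, ht⟩
      obtain ⟨m, hm, rfl⟩ := (he.mem_iff w).1 hw
      obtain rfl := he.att_succ hg hB hm (by omega) ht.att.1
      exact ⟨m, rfl, hk, ht⟩
    · rintro ⟨m, rfl, h1⟩
      exact ⟨_, he.mem (by omega), h1.2⟩
  constructor
  · intro hp k hk
    have hk1 : k ≤ n := by omega
    have hk2 : k + 1 ≤ n := by omega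
    obtain ⟨c1, c2, c3⟩ := hp _ (he.mem hk1) _ (he.mem hk2)
    rw [hfull k hk2] at c2
    rw [hE k hk1, hE (k + 1) hk2]
    have d1 := hτ _ (he.mem hk1)
    have d2 := hτ _ (he.mem hk2)
    unfold gapAt
    split_ifs with h1 h2 h3
    · have := c1 h1
      simp only [Gap.rel]
      grind
    · have := c2 h1 h2
      simp only [Gap.rel]
      grind
    · have := c3 h3
      simp only [Gap.rel]
      grind
    · trivial
  · intro hw u hu v hv
    obtain ⟨k, hk, rfl⟩ := (he.mem_iff u).1 hu
    obtain ⟨l, hl, rfl⟩ := (he.mem_iff v).1 hv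
    have hrel : ∀ k, k + 1 ≤ n → Att h (e k) (e (k + 1)) → τ (e k) ≠ τ (e (k + 1)) ∧
        (¬ (TriAt h n e k ∨ MidAt h n e k) → τ (e k) = q ∧ τ (e (k + 1)) = p) := by
      intro k hk ha
      have := hw k (by omega)
      rw [hE k (by omega), hE (k + 1) hk] at this
      have d1 := hτ _ (he.mem (k := k) (by omega))
      have d2 := hτ _ (he.mem hk)
      simp only [gapAt, if_pos ha] at this
      split_ifs at this with h1 <;> simp only [Gap.rel] at this <;> grind
    refine ⟨fun ha => ?_, fun ha hn => ?_, fun ho => ?_⟩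
    · obtain rfl := he.att_succ hg hB hk hl ha
      exact (hrel k hl ha).1
    · obtain rfl := he.att_succ hg hB hk hl ha
      rw [hfull k hl] at hn
      exact (hrel k hl ha).2 hn
    · rcases he.over_succ hg hB hk hl ho with rfl | ⟨rfl, a1, a2⟩
      · have hna : ¬ Att h (e k) (e (k + 1)) := by
          rintro ⟨-, -, h1⟩
          obtain ⟨-, h2, h3⟩ := ho
          rcases h1 with h1 | h1
          · omega
          · exact h1.2.ne h2
        have := hw k (by omega)
        rw [hE k (by omega), hE (k + 1) hl] at this
        have d1 := hτ _ (he.mem hk)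
        have d2 := hτ _ (he.mem hl)
        simp only [gapAt, if_neg hna, if_pos ho, Gap.rel] at this
        grind
      · have h1 := (hrel k (by omega) a1).1
        have h2 := (hrel (k + 1) hl a2).1
        have d1 := hτ _ (he.mem hk)
        have d2 := hτ _ (he.mem (k := k + 1) (by omega))
        have d3 := hτ _ (he.mem hl)
        grind

open Classical in
/-- The sum over the labellings in a class satisfying constraints on the labels `p`, `q`. -/
theorem Reading.sum_class {A : Type*} [CommRing A] (X : Λ → A) (he : Reading B n e)
    (hB : ∀ u, u ∈ B ↔ u.2 ≤ h u.1 ∧ (τ₀ u = p ∨ τ₀ u = q)) (hpq : p < q)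
    (D : Finset (C × ℕ)) (hD : B ⊆ D) (g : ℕ → Gap) (T : Finset (C × ℕ → Λ))
    (hT : ∀ τ, τ ∈ T ↔ SameClass h p q B τ₀ τ ∧
      WordOK g (n + 1) {k ∈ Finset.range (n + 1) | τ (e k) = q}) :
    ∑ τ ∈ T, ∏ u ∈ D, X (τ u) =
      (∏ u ∈ D \ B, X (τ₀ u)) * wordSum (X p) (X q) g n := by
  rw [wordSum, Finset.mul_sum]
  have hext : ∀ E ∈ (Finset.range (n + 1)).powerset, ∀ k ≤ n,
      ((∃ l ∈ E, e l = e k) ↔ k ∈ E) := by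
    intro E hE k hk
    constructor
    · rintro ⟨l, hl, h1⟩
      have := Finset.mem_range.1 (Finset.mem_powerset.1 hE hl)
      rwa [← he.inj (by omega) hk h1]
    · exact fun hk => ⟨k, hk, rfl⟩
  have hback : ∀ E ∈ (Finset.range (n + 1)).powerset,
      {k ∈ Finset.range (n + 1) | (if e k ∈ B then if ∃ l ∈ E, e l = e k then q else p
        else τ₀ (e k)) = q} = E := by
    intro E hE
    ext k
    rw [Finset.mem_filter, Finset.mem_range]
    constructor
    · rintro ⟨h1, h2⟩
      rw [if_pos (he.mem (by omega))] at h2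
      by_contra hk
      rw [if_neg (fun h' => hk ((hext E hE k (by omega)).1 h'))] at h2
      exact hpq.ne h2
    · intro hk
      have := Finset.mem_range.1 (Finset.mem_powerset.1 hE hk)
      refine ⟨this, ?_⟩
      rw [if_pos (he.mem (by omega)), if_pos ((hext E hE k (by omega)).2 hk)]
  refine Finset.sum_bij' (fun τ _ => {k ∈ Finset.range (n + 1) | τ (e k) = q})
    (fun E _ u => if u ∈ B then if ∃ l ∈ E, e l = u then q else p else τ₀ u) ?_ ?_ ?_ ?_ ?_
  · intro τ hτ
    rw [Finset.mem_filter, Finset.mem_powerset]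
    exact ⟨Finset.filter_subset _ _, ((hT τ).1 hτ).2⟩
  · intro E hE
    rw [Finset.mem_filter] at hE
    rw [hT, hback E hE.1]
    refine ⟨⟨hB, fun u hu => if_neg hu, fun u hu => ?_⟩, hE.2⟩
    rw [if_pos hu]
    split_ifs <;> simp
  · intro τ hτ
    funext u
    have hc := ((hT τ).1 hτ).1
    by_cases hu : u ∈ B
    · obtain ⟨k, hk, rfl⟩ := (he.mem_iff u).1 hu
      have h1 := hext {k ∈ Finset.range (n + 1) | τ (e k) = q} (by simp) k hk
      have h2 := hc.eq_of_mem _ hu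
      simp only [Finset.mem_filter, Finset.mem_range, Nat.lt_succ_iff.2 hk, true_and] at h1 ⊢
      rw [if_pos hu]
      split_ifs <;> grind
    · rw [if_neg hu, hc.eq_of_notMem u hu]
  · intro E hE
    exact hback E (Finset.mem_filter.1 hE).1
  · intro τ hτ
    have hc := ((hT τ).1 hτ).1
    rw [← Finset.prod_sdiff hD]
    congr 1
    · refine Finset.prod_congr rfl fun u hu => ?_
      rw [hc.eq_of_notMem u (Finset.mem_sdiff.1 hu).2]
    · rw [wordWeight]
      symm
      refine Finset.prod_bij (fun k _ => e k) ?_ ?_ ?_ ?_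
      · intro k hk
        exact he.mem (Nat.lt_succ_iff.1 (Finset.mem_range.1 hk))
      · intro k hk l hl h1
        exact he.inj (Nat.lt_succ_iff.1 (Finset.mem_range.1 hk))
          (Nat.lt_succ_iff.1 (Finset.mem_range.1 hl)) h1
      · intro u hu
        obtain ⟨k, hk, rfl⟩ := (he.mem_iff u).1 hu
        exact ⟨k, Finset.mem_range.2 (by omega), rfl⟩
      · intro k hk
        have := hc.eq_of_mem _ (he.mem (Nat.lt_succ_iff.1 (Finset.mem_range.1 hk)))
        simp only [Finset.mem_filter, hk, true_and]
        split_ifs <;> grind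

end Enumeration

end AlmostSym

namespace AlmostSym

open MvPolynomial (X rename)

/-! ### Fillings with basement 1, …, n and their symmetry in two adjacent variables -/

section Fillings

variable {n : ℕ} {h : Fin n → ℕ} {τ τ₀ : Fin n × ℕ → Fin n} {p q : Fin n}

/-- Good labellings of the augmented diagram with basement `1, …, n`, extended to all boxes by the
column number. -/
structure IsFilling (h : Fin n → ℕ) (τ : Fin n × ℕ → Fin n) : Prop where
  base : ∀ c, τ (c, 0) = c
  outside : ∀ u, h u.1 < u.2 → τ u = u.1
  good : Good h τ

/-- Labels outside the diagram are pinned to the column number, so a filling is determined by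
finitely many boxes. -/
theorem finite_isFilling (h : Fin n → ℕ) : {τ | IsFilling h τ}.Finite := by
  let M := ∑ c, h c
  let f : (Fin n × ℕ → Fin n) → (Fin n × Fin (M + 1) → Fin n) := fun τ u => τ (u.1, u.2.val)
  refine Set.Finite.of_injOn (f := f) (Set.mapsTo_univ _ _) ?_ Set.finite_univ
  intro τ hτ σ hσ hf
  funext u
  rcases Nat.lt_or_ge M u.2 with hu | hu
  · have : h u.1 ≤ M := Finset.single_le_sum (f := h) (fun _ _ => Nat.zero_le _) (Finset.mem_univ _)
    rw [hτ.outside u (by omega), hσ.outside u (by omega)]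
  · exact congrFun hf (u.1, ⟨u.2, by omega⟩)

/-- The finite set of fillings. -/
def fillings (h : Fin n → ℕ) : Finset (Fin n × ℕ → Fin n) := (finite_isFilling h).toFinset

theorem mem_fillings : τ ∈ fillings h ↔ IsFilling h τ := by simp [fillings]

/-- The boxes of the augmented diagram. -/
def augBoxes (h : Fin n → ℕ) : Finset (Fin n × ℕ) :=
  Finset.univ.biUnion fun c => (Finset.range (h c + 1)).image (Prod.mk c)

theorem mem_augBoxes {u : Fin n × ℕ} : u ∈ augBoxes h ↔ u.2 ≤ h u.1 := by
  obtain ⟨c, j⟩ := u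
  simp [augBoxes]

theorem Good.anti {C Λ : Type*} [LinearOrder C] [LinearOrder Λ] {h : C → ℕ} {τ : C × ℕ → Λ}
    (hg : Good h τ) (c : C) {j k : ℕ} (hjk : j ≤ k) (hk : k ≤ h c) : τ (c, k) ≤ τ (c, j) := by
  induction k, hjk using Nat.le_induction with
  | base => exact le_rfl
  | succ k hjk ih => exact (hg.le (c, k + 1) (c, k) ⟨hk, rfl, rfl⟩).trans (ih (by omega))

theorem IsFilling.le (hτ : IsFilling h τ) (c : Fin n) {j : ℕ} (hj : j ≤ h c) : τ (c, j) ≤ c :=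
  (hτ.good.anti c (Nat.zero_le j) hj).trans_eq (hτ.base c)

theorem consec_of_succ (hpq : q.val = p.val + 1) : Consec p q := by
  refine ⟨by rw [Fin.lt_def]; omega, fun x h1 h2 => ?_⟩
  rw [Ne, Fin.ext_iff] at h1 h2
  simp only [Fin.lt_def]
  omega

/-- Identify the labels `p` and `q`. -/
def merge (p q : Fin n) (τ : Fin n × ℕ → Fin n) (u : Fin n × ℕ) : Fin n :=
  if τ u = q then p else τ u

/-- The boxes with labels `p`, `q`. -/
def pqBoxes (h : Fin n → ℕ) (p q : Fin n) (τ : Fin n × ℕ → Fin n) : Finset (Fin n × ℕ) :=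
  {u ∈ augBoxes h | τ u = p ∨ τ u = q}

theorem mem_pqBoxes {u : Fin n × ℕ} :
    u ∈ pqBoxes h p q τ ↔ u.2 ≤ h u.1 ∧ (τ u = p ∨ τ u = q) := by
  simp [pqBoxes, mem_augBoxes]

theorem IsFilling.merge_eq_iff (h₀ : IsFilling h τ₀) (hτ : ∀ u, h u.1 < u.2 → τ u = u.1) :
    merge p q τ = merge p q τ₀ ↔ SameClass h p q (pqBoxes h p q τ₀) τ₀ τ := by
  constructor
  · intro hm
    have hm' : ∀ u, merge p q τ u = merge p q τ₀ u := congrFun hm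
    simp only [merge] at hm'
    refine ⟨fun u => mem_pqBoxes, fun u hu => ?_, fun u hu => ?_⟩
    · rw [mem_pqBoxes] at hu
      have h1 := h₀.outside u
      have h2 := hτ u
      have h3 := hm' u
      grind
    · rw [mem_pqBoxes] at hu
      have h3 := hm' u
      grind
  · intro hc
    funext u
    have h1 := hc.eq_of_notMem u
    have h2 := hc.eq_of_mem u
    have h3 := hc.mem u
    unfold merge
    grind

theorem IsFilling.pqBoxes_nonempty (h₀ : IsFilling h τ₀) : (pqBoxes h p q τ₀).Nonempty :=
  ⟨(p, 0), mem_pqBoxes.2 ⟨Nat.zero_le _, Or.inl (h₀.base p)⟩⟩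

/-- The positions of the label `q`. -/
def qPositions (q : Fin n) (e : ℕ → Fin n × ℕ) (N : ℕ) (τ : Fin n × ℕ → Fin n) : Finset ℕ :=
  {k ∈ Finset.range (N + 1) | τ (e k) = q}

theorem mem_qPositions {e : ℕ → Fin n × ℕ} {N k : ℕ} (hk : k ≤ N) :
    k ∈ qPositions q e N τ ↔ τ (e k) = q := by
  simp [qPositions, hk]

/-- The words know about the basement because h p ≤ h q: then (q, 0) and (p, 0) are an attacking
pair in no triple, hence forced to carry q and p. -/
theorem IsFilling.isFilling_iff (h₀ : IsFilling h τ₀) (hpq : q.val = p.val + 1) (hh : h p ≤ h q)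
    {N : ℕ} {e : ℕ → Fin n × ℕ} (he : Reading (pqBoxes h p q τ₀) N e)
    (hc : SameClass h p q (pqBoxes h p q τ₀) τ₀ τ) :
    IsFilling h τ ↔ WordOK (gapAt h N e) (N + 1) (qPositions q e N τ) := by
  have hcons := consec_of_succ hpq
  rw [← he.pairOK_iff h₀.good (fun u => (hc.mem u).1) hcons.1 hc.eq_of_mem _
    (fun k hk => mem_qPositions hk)]
  constructor
  · intro hτ u hu v hv
    refine hτ.good.pairOK hc hcons (fun u hu v hv ha h1 h2 => ?_) hu hv
    obtain ⟨c, j⟩ := u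
    obtain ⟨d, k⟩ := v
    obtain rfl : j = 0 := h1
    obtain rfl : k = 0 := h2
    have h1 := (hc.mem _).1 hu
    have h2 := (hc.mem _).1 hv
    rw [h₀.base] at h1 h2
    rw [hτ.base, hτ.base]
    have := ha.rel
    have := hcons.1
    have := @lt_asymm _ _ p q
    grind
  · intro hp
    refine ⟨fun c => ?_, fun u hu => ?_, hc.good h₀.good hcons hp⟩
    · by_cases hc' : (c, 0) ∈ pqBoxes h p q τ₀
      · have hq : (q, 0) ∈ pqBoxes h p q τ₀ := (hc.mem _).2 ⟨Nat.zero_le _, Or.inr (h₀.base q)⟩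
        have hp' : (p, 0) ∈ pqBoxes h p q τ₀ := (hc.mem _).2 ⟨Nat.zero_le _, Or.inl (h₀.base p)⟩
        have h1 := (hp _ hq _ hp').2.1 ⟨Nat.zero_le _, Nat.zero_le _, Or.inl ⟨rfl, hcons.1⟩⟩ (by
          rintro (⟨w, -, hw⟩ | ⟨w, -, ⟨⟨a1, a2, a3⟩, -, ⟨a4, -, -⟩ | ⟨-, -, a4⟩⟩⟩)
          · have := hw.1.2.2
            simp at this
          · simp at a3 a4
            omega
          · simp only at a2 a4
            rw [a2] at a4
            omega)
        have h2 := ((hc.mem _).1 hc').2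
        rw [h₀.base] at h2
        grind
      · rw [hc.eq_of_notMem _ hc', h₀.base]
    · have : u ∉ pqBoxes h p q τ₀ := fun h' => by
        have := ((hc.mem u).1 h').1
        omega
      rw [hc.eq_of_notMem u this, h₀.outside u hu]

-- Reduces an additive property of a sum over fillings to the classes of fillings that agree after
-- replacing `q` by `p`.
open Classical in
theorem sum_merge_induction {A : Type*} [AddCommMonoid A] (S : Finset (Fin n × ℕ → Fin n))
    (w : (Fin n × ℕ → Fin n) → A) (P : A → Prop) (h0 : P 0) (hadd : ∀ a b, P a → P b → P (a + b))
    (hP : ∀ τ₀ ∈ S, P (∑ τ ∈ S with merge p q τ = merge p q τ₀, w τ)) : P (∑ τ ∈ S, w τ) := by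
  rw [← Finset.sum_fiberwise_of_maps_to (s := S) (t := S.image (merge p q)) (g := merge p q)
    (fun τ hτ => Finset.mem_image_of_mem _ hτ)]
  refine Finset.sum_induction _ P hadd h0 fun κ hκ => ?_
  obtain ⟨τ₀, h1, rfl⟩ := Finset.mem_image.1 hκ
  exact hP τ₀ h1

variable (𝕜 : Type*) [Field 𝕜]

/-- The weight of a filling, basement included. -/
def augWeight (h : Fin n → ℕ) (τ : Fin n × ℕ → Fin n) : MvPolynomial (Fin n) 𝕜 :=
  ∏ u ∈ augBoxes h, X (τ u)

/-- The generating function of the fillings, basement included. -/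
def augSum (h : Fin n → ℕ) : MvPolynomial (Fin n) 𝕜 := ∑ τ ∈ fillings h, augWeight 𝕜 h τ

theorem rename_prod_sdiff_pqBoxes :
    rename (Equiv.swap p q) (∏ u ∈ augBoxes h \ pqBoxes h p q τ₀, X (τ₀ u) :
      MvPolynomial (Fin n) 𝕜) = ∏ u ∈ augBoxes h \ pqBoxes h p q τ₀, X (τ₀ u) := by
  rw [map_prod]
  refine Finset.prod_congr rfl fun u hu => ?_
  rw [Finset.mem_sdiff, mem_pqBoxes, mem_augBoxes] at hu
  rw [MvPolynomial.rename_X, Equiv.swap_apply_of_ne_of_ne]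
  · exact fun h' => hu.2 ⟨hu.1, Or.inl h'⟩
  · exact fun h' => hu.2 ⟨hu.1, Or.inr h'⟩

theorem pqBoxes_subset : pqBoxes h p q τ₀ ⊆ augBoxes h := Finset.filter_subset _ _

/-- Each class contributes a factor free of x_p and x_q times a word sum. The first and the last
letter are never in the middle of a triple, so `map_wordSum` applies. -/
theorem rename_augSum (hpq : q.val = p.val + 1) (hh : h p ≤ h q) :
    rename (Equiv.swap p q) (augSum 𝕜 h) = augSum 𝕜 h := by
  classical
  refine sum_merge_induction (p := p) (q := q) (fillings h) (augWeight 𝕜 h)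
    (fun f => rename (Equiv.swap p q) f = f) (map_zero _) (fun a b ha hb => by rw [map_add, ha, hb])
    fun τ₀ h₀ => ?_
  rw [mem_fillings] at h₀
  obtain ⟨N, e, he⟩ := exists_reading _ (h₀.pqBoxes_nonempty (p := p) (q := q))
  simp only [augWeight]
  rw [he.sum_class X (fun u => mem_pqBoxes) (consec_of_succ hpq).1 _ pqBoxes_subset (gapAt h N e),
    map_mul, rename_prod_sdiff_pqBoxes]
  · congr 1
    exact map_wordSum (A := MvPolynomial (Fin n) 𝕜) (x₀ := X p) (x₁ := X q)
      (s := (rename (Equiv.swap p q)).toRingHom) (by simp) (by simp) _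
      (MidAt h N e) N not_midAt_zero not_midAt_last fun k _ => pairedAt_gapAt k
  · intro τ
    rw [Finset.mem_filter, mem_fillings]
    constructor
    · rintro ⟨h1, h2⟩
      have hc := (h₀.merge_eq_iff h1.outside).1 h2
      exact ⟨hc, (h₀.isFilling_iff hpq hh he hc).1 h1⟩
    · rintro ⟨hc, hw⟩
      have h1 := (h₀.isFilling_iff hpq hh he hc).2 hw
      exact ⟨h1, (h₀.merge_eq_iff h1.outside).2 hc⟩

/-- No label in column `p` lies weakly to the right of the label above it in column `q`. -/
def Uncrossed (h : Fin n → ℕ) (p q : Fin n) (τ : Fin n × ℕ → Fin n) : Prop :=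
  ∀ j ≤ h p, τ (p, j) < τ (q, j + 1)

/-- This expresses being uncrossed by a local change: one `le` becomes `top`. -/
theorem wordOK_update_top (g : ℕ → Gap) (k₀ N : ℕ) (hk : k₀ + 1 < N) (hg : g k₀ = .le)
    (E : Finset ℕ) : WordOK (Function.update g k₀ .top) N E ↔
      WordOK g N E ∧ k₀ ∈ E ∧ k₀ + 1 ∈ E := by
  constructor
  · intro hw
    have h1 := hw k₀ hk
    rw [Function.update_self] at h1
    refine ⟨fun k hk' => ?_, h1⟩
    by_cases hkk : k = k₀
    · subst hkk
      rw [hg]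
      exact fun _ => h1.2
    · have := hw k hk'
      rwa [Function.update_of_ne hkk] at this
  · rintro ⟨hw, h1⟩ k hk'
    by_cases hkk : k = k₀
    · subst hkk
      rw [Function.update_self]
      exact h1
    · rw [Function.update_of_ne hkk]
      exact hw k hk'

/-- The shape of the end of the reading word of an uncrossed filling: the box `(q, t + 1)` is
followed by `(q, t), (p, t), …, (q, 0), (p, 0)`. -/
theorem IsFilling.exists_tail (h₀ : IsFilling h τ₀) (hu : Uncrossed h p q τ₀)
    (hpq : q.val = p.val + 1) (hh : h p < h q) {N : ℕ} {e : ℕ → Fin n × ℕ}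
    (he : Reading (pqBoxes h p q τ₀) N e) :
    ∃ t k₀, t ≤ h p ∧ k₀ + 1 < N ∧ e k₀ = (q, t + 1) ∧ e (k₀ + 1) = (q, t) ∧
      (∀ j ≤ t, (p, j) ∈ pqBoxes h p q τ₀) ∧
      (∀ j, t < j → j ≤ h p → (p, j) ∉ pqBoxes h p q τ₀) ∧
      e N = (p, 0) ∧ ∀ k, k₀ < k → k < N → Att h (e k) (e (k + 1)) := by
  classical
  have hcons := consec_of_succ hpq
  have hlt := hcons.1
  have hB : ∀ u ∈ pqBoxes h p q τ₀, u.2 ≤ h u.1 ∧ (τ₀ u = p ∨ τ₀ u = q) :=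
    fun u => mem_pqBoxes.1
  have hple : ∀ j ≤ h p, τ₀ (p, j) ≤ p := fun j hj => h₀.le p hj
  have hqle : ∀ j ≤ h q, τ₀ (q, j) ≤ q := fun j hj => h₀.le q hj
  -- Up to row t the column p carries its own label p. As the filling is uncrossed and labels in
  -- column q are at most q, column q carries q up to row t + 1.
  let t := Nat.findGreatest (fun j => τ₀ (p, j) = p) (h p)
  have ht : t ≤ h p := Nat.findGreatest_le _
  have htp : τ₀ (p, t) = p := Nat.findGreatest_spec (P := fun j => τ₀ (p, j) = p)
    (Nat.zero_le _) (h₀.base p)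
  have htop : ∀ j, t < j → j ≤ h p → τ₀ (p, j) ≠ p := fun j h1 h2 =>
    Nat.findGreatest_is_greatest h1 h2
  have hpt : ∀ j ≤ t, τ₀ (p, j) = p := fun j hj =>
    le_antisymm (hple j (hj.trans ht)) (htp.symm.trans_le (h₀.good.anti p hj ht))
  have hqt : ∀ j ≤ t + 1, τ₀ (q, j) = q := by
    intro j hj
    have h1 := hqle j (by omega)
    rcases Nat.eq_zero_or_pos j with rfl | hj0
    · exact h₀.base q
    · obtain ⟨i, rfl⟩ := Nat.exists_eq_succ_of_ne_zero hj0.ne'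
      have := hu i (by omega)
      rw [hpt i (by omega), Fin.lt_def] at this
      rw [Fin.le_def] at h1
      simp only [Nat.succ_eq_add_one] at this h1 ⊢
      apply Fin.ext
      omega
  have mp : ∀ j ≤ t, (p, j) ∈ pqBoxes h p q τ₀ := fun j hj =>
    mem_pqBoxes.2 ⟨hj.trans ht, Or.inl (hpt j hj)⟩
  have mq : ∀ j ≤ t + 1, (q, j) ∈ pqBoxes h p q τ₀ := fun j hj =>
    mem_pqBoxes.2 ⟨by simp only; omega, Or.inr (hqt j hj)⟩
  have hnp : ∀ c j, c < p → j ≤ h c → ¬ (τ₀ (c, j) = p ∨ τ₀ (c, j) = q) := by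
    intro c j hc hj
    have := (h₀.le c hj).trans_lt hc
    rintro (h1 | h1)
    · exact this.ne h1
    · exact (this.trans hlt).ne h1
  have apq : ∀ j ≤ t, Att h (q, j) (p, j) := fun j hj =>
    ⟨by simp only; omega, by simp only; omega, Or.inl ⟨rfl, hlt⟩⟩
  have aqp : ∀ j, j + 1 ≤ t → Att h (p, j + 1) (q, j) := fun j hj =>
    ⟨by simp only; omega, by simp only; omega, Or.inr ⟨rfl, hlt⟩⟩
  obtain ⟨k₀, hk₀, e₀⟩ := (he.mem_iff _).1 (mq (t + 1) le_rfl)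
  obtain ⟨k₁, hk₁, e₁⟩ := (he.mem_iff _).1 (mq t (by omega))
  have hover : Over h (e k₀) (e k₁) := by
    rw [e₀, e₁]
    exact ⟨by simp only; omega, rfl, rfl⟩
  have hk01 := he.lt hk₀ hover.before
  -- No box of the class is read between (q, t + 1) and (q, t). In row t + 1, columns left of p have
  -- labels below p, and (p, t + 1) is excluded by the choice of t; a box in row t to the right of q
  -- would form an attacking triangle with (q, t) and (p, t).
  obtain rfl : k₁ = k₀ + 1 := by
    by_contra hne
    have hx := hB _ (he.mem (k := k₀ + 1) (by omega))
    have b1 := he.before k₀ (k₀ + 1) (by omega) (by omega)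
    have b2 := he.before (k₀ + 1) k₁ (by omega) hk₁
    obtain ⟨a1, a2⟩ := hover.between hx.1 b1 b2
    generalize e (k₀ + 1) = x at *
    rw [e₁] at a2 b2
    rw [e₀] at b1
    obtain ⟨c, j⟩ := x
    rcases b1 with b1 | ⟨b1, b1'⟩
    · rcases b2 with b2 | ⟨b2, b2'⟩
      · simp only at b1 b2
        omega
      · simp only at b2 b2'
        subst b2
        refine h₀.good.not_triangle (p := p) (q := q) hx.2 (Or.inr (hqt _ (by omega)))
          (Or.inl (hpt _ le_rfl)) a2 (apq _ le_rfl) ⟨hx.1, ht, Or.inl ⟨rfl, hlt.trans b2'⟩⟩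
    · simp only at b1 b1'
      subst b1
      have hcp : c ≤ p := by
        rw [Fin.le_def]
        rw [Fin.lt_def] at b1'
        omega
      rcases hcp.lt_or_eq with h1 | rfl
      · exact hnp c _ h1 hx.1 hx.2
      · have := htop _ (Nat.lt_succ_self t) hx.1
        have h2 := hple _ hx.1
        rcases hx.2 with h3 | h3
        · exact this h3
        · rw [h3] at h2
          exact absurd h2 (not_le.2 hlt)
  have hN : e N = (p, 0) := by
    obtain ⟨m, hm, em⟩ := (he.mem_iff _).1 (mp 0 (Nat.zero_le _))
    rcases hm.lt_or_eq with h1 | rfl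
    · have hx := hB _ (he.mem (k := N) le_rfl)
      have b := he.before m N h1 le_rfl
      rw [em] at b
      generalize e N = x at *
      obtain ⟨c, j⟩ := x
      rcases b with b | ⟨b, b'⟩
      · simp at b
      · exact absurd hx.2 (hnp c _ b' hx.1)
    · exact em
  have step : ∀ k < N, ∀ j ≤ t, e k = (q, j) ∨ e k = (p, j) → Att h (e k) (e (k + 1)) ∧
      ∃ i ≤ t, e (k + 1) = (q, i) ∨ e (k + 1) = (p, i) := by
    intro k hk j hj h1
    have hnext : ∀ v ∈ pqBoxes h p q τ₀, Att h (e k) v → Att h (e k) (e (k + 1)) ∧ e (k + 1) = v := by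
      intro v hv ha
      obtain ⟨m, hm, rfl⟩ := (he.mem_iff v).1 hv
      obtain rfl := he.att_succ h₀.good hB hk.le hm ha
      exact ⟨ha, rfl⟩
    rcases h1 with h1 | h1
    · obtain ⟨a, b⟩ := hnext (p, j) (mp j hj) (h1 ▸ apq j hj)
      exact ⟨a, j, hj, Or.inr b⟩
    · rcases Nat.eq_zero_or_pos j with rfl | hj0
      · exact absurd (he.inj hk.le le_rfl (h1.trans hN.symm)) hk.ne
      · obtain ⟨i, rfl⟩ := Nat.exists_eq_succ_of_ne_zero hj0.ne'
        obtain ⟨a, b⟩ := hnext (q, i) (mq i (by omega)) (h1 ▸ aqp i hj)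
        exact ⟨a, i, by omega, Or.inl b⟩
  have all : ∀ m, k₀ + 1 + m ≤ N → ∃ j ≤ t, e (k₀ + 1 + m) = (q, j) ∨ e (k₀ + 1 + m) = (p, j) := by
    intro m
    induction m with
    | zero => exact fun _ => ⟨t, le_rfl, Or.inl e₁⟩
    | succ m ih =>
      intro hm
      obtain ⟨j, hj, h1⟩ := ih (by omega)
      exact (step _ (by omega) j hj h1).2
  refine ⟨t, k₀, ht, ?_, e₀, e₁, mp, fun j h1 h2 h3 => ?_, hN, fun k h1 h2 => ?_⟩
  · rcases hk₁.lt_or_eq with h1 | h1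
    · exact h1
    · rw [h1, hN] at e₁
      exact absurd (congrArg Prod.fst e₁) hlt.ne
  · have h4 := htop j h1 h2
    have h5 := hple j h2
    rcases (hB _ h3).2 with h6 | h6
    · exact h4 h6
    · rw [h6] at h5
      exact absurd h5 (not_le.2 hlt)
  · obtain ⟨m, rfl⟩ : ∃ m, k = k₀ + 1 + m := ⟨k - (k₀ + 1), by omega⟩
    obtain ⟨j, hj, h3⟩ := all m (by omega)
    exact (step _ h2 j hj h3).1

-- Within a class, a filling is uncrossed exactly when (q, t + 1) and (q, t) both carry q, t being
-- the last row in which column p meets the class. By `IsFilling.exists_tail` the remaining boxes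
-- attack consecutively down to (p, 0), which is the situation of `exists_wordSum_eq_mul`.
open Classical in
theorem exists_sum_uncrossed (hpq : q.val = p.val + 1) (hh : h p < h q) :
    ∃ H : MvPolynomial (Fin n) 𝕜, rename (Equiv.swap p q) H = H ∧
      ∑ τ ∈ fillings h with Uncrossed h p q τ, augWeight 𝕜 h τ = X q * H := by
  refine sum_merge_induction (p := p) (q := q) _ (augWeight 𝕜 h)
    (fun f => ∃ H : MvPolynomial (Fin n) 𝕜, rename (Equiv.swap p q) H = H ∧ f = X q * H)
    ⟨0, map_zero _, (mul_zero _).symm⟩ ?_ fun τ₀ h₀ => ?_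
  · rintro a b ⟨H, h1, rfl⟩ ⟨K, h2, rfl⟩
    exact ⟨H + K, by rw [map_add, h1, h2], (mul_add _ _ _).symm⟩
  obtain ⟨h₀, hu₀⟩ := Finset.mem_filter.1 h₀
  rw [mem_fillings] at h₀
  have hcons := consec_of_succ hpq
  have hlt := hcons.1
  obtain ⟨N, e, he⟩ := exists_reading _ (h₀.pqBoxes_nonempty (p := p) (q := q))
  obtain ⟨t, k₀, ht, hk₀, e₀, e₁, mp, np, hN, hatt⟩ := h₀.exists_tail hu₀ hpq hh he
  have hover : Over h (e k₀) (e (k₀ + 1)) := by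
    rw [e₀, e₁]
    exact ⟨by simp only; omega, rfl, rfl⟩
  have hna : ¬ Att h (e k₀) (e (k₀ + 1)) := by
    rw [e₀, e₁]
    rintro ⟨-, -, h1⟩
    simp at h1
  have hgap : gapAt h N e k₀ = .le := by rw [gapAt, if_neg hna, if_pos hover]
  simp only [augWeight]
  rw [he.sum_class X (fun u => mem_pqBoxes) hlt _ pqBoxes_subset
    (Function.update (gapAt h N e) k₀ .top)]
  · obtain ⟨M, rfl⟩ : ∃ M, N = M + 1 := ⟨N - 1, by omega⟩
    have hgk : ∀ k, k ≠ k₀ → Function.update (gapAt h (M + 1) e) k₀ .top k = gapAt h (M + 1) e k :=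
      fun k hk => Function.update_of_ne hk _ _
    obtain ⟨H, hH, hs⟩ := exists_wordSum_eq_mul (s := (rename (Equiv.swap p q)).toRingHom)
      (x₀ := (X p : MvPolynomial (Fin n) 𝕜)) (x₁ := X q)
      (by simp) (by simp) (Function.update (gapAt h (M + 1) e) k₀ .top) (MidAt h (M + 1) e) M k₀
      not_midAt_zero (by omega) (fun hm => hna hm.att)
      (fun k hk => by
        have := pairedAt_gapAt (h := h) (n := M + 1) (e := e) k
        unfold PairedAt at this ⊢
        rwa [hgk k (by omega)])
      (Function.update_self _ _ _)
      (fun k h1 h2 => by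
        rw [hgk k (by omega), gapAt, if_pos (hatt k h1 (by omega))]
        split_ifs <;> simp)
      (by
        -- The last pair lies in no triple of the class. In a triple ending at (p, 0) the middle box
        -- is either in row 1 left of p, where labels are smaller than p, or a basement box, hence
        -- (q, 0), which would need h q < h p.
        rw [hgk M (by omega), gapAt, if_pos (hatt M (by omega) (by omega)), if_neg]
        rintro (⟨h1, -⟩ | ⟨l, rfl, -, h1⟩)
        · omega
        · rw [hN] at h1
          obtain ⟨⟨-, a1, a2⟩, -, ⟨a3, a4, a5⟩ | ⟨a3, a4, a5⟩⟩ := h1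
          · have hx := mem_pqBoxes.1 (he.mem (k := l + 1) (by omega))
            generalize e (l + 1) = x at *
            obtain ⟨c, j⟩ := x
            simp only at a1 a2 a3 a4 hx
            rw [a1] at a4
            have := (h₀.le c hx.1).trans_lt a4
            rcases hx.2 with h1 | h1
            · exact this.ne h1
            · exact (this.trans hlt).ne h1
          · have hx := mem_pqBoxes.1 (he.mem (k := l + 1) (by omega))
            generalize e (l + 1) = x at *
            obtain ⟨c, j⟩ := x
            simp only at a1 a2 a3 a4 a5 hx
            subst a3
            rw [h₀.base, a1.symm] at hx
            rcases hx.2 with h1 | h1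
            · exact absurd h1 a4.ne'
            · rw [h1, a1] at a5
              omega)
    refine ⟨(∏ u ∈ augBoxes h \ pqBoxes h p q τ₀, X (τ₀ u)) * H, ?_, ?_⟩
    · rw [map_mul, rename_prod_sdiff_pqBoxes]
      congr 1
    · rw [hs]
      ring
  · intro τ
    rw [Finset.mem_filter, Finset.mem_filter, mem_fillings,
      wordOK_update_top _ _ _ (by omega) hgap]
    have hpos : ∀ k ≤ N, k ∈ {k ∈ Finset.range (N + 1) | τ (e k) = q} ↔ τ (e k) = q :=
      fun k hk => mem_qPositions hk
    rw [hpos k₀ (by omega), hpos (k₀ + 1) (by omega), e₀, e₁]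
    constructor
    · rintro ⟨⟨h1, h2⟩, h3⟩
      have hc := (h₀.merge_eq_iff h1.outside).1 h3
      refine ⟨hc, (h₀.isFilling_iff hpq hh.le he hc).1 h1, ?_⟩
      -- The box (p, t) belongs to the class and its label is at most p.
      have hpt : τ (p, t) = p := by
        have h4 := h1.le p ht
        rcases hc.eq_of_mem _ (mp t le_rfl) with h5 | h5
        · exact h5
        · rw [h5] at h4
          exact absurd h4 (not_le.2 hlt)
      have h4 := h2 t ht
      have h5 := h1.le q (j := t + 1) (by omega)
      have h6 := h1.le q (j := t) (by omega)
      have h7 := h1.good.anti q (Nat.le_succ t) (by omega)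
      rw [hpt] at h4
      simp only [Fin.lt_def, Fin.le_def, Fin.ext_iff, Nat.succ_eq_add_one] at h4 h5 h6 h7 ⊢
      omega
    · rintro ⟨hc, hw, h1, -⟩
      have h2 := (h₀.isFilling_iff hpq hh.le he hc).2 hw
      refine ⟨⟨h2, fun j hj => ?_⟩, (h₀.merge_eq_iff h2.outside).2 hc⟩
      -- Above row t, boxes of column p are outside the class, so the comparison is the one for
      -- `τ₀`. Up to row t, the label in column p is at most p and the one in column q is q.
      rcases Nat.lt_or_ge t j with h3 | h3
      · refine ((hc.lt_iff hcons (u := (p, j)) (v := (q, j + 1)) hj (by simp only; omega) ?_).1).2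
          (hu₀ j hj)
        exact fun h' => np j h3 hj h'.1
      · calc τ (p, j) ≤ p := h2.le p hj
          _ < q := hlt
          _ = τ (q, t + 1) := h1.symm
          _ ≤ τ (q, j + 1) := h2.good.anti q (by omega) (by omega)

end Fillings

end AlmostSym

namespace AlmostSym

open MvPolynomial (X rename)

/-! ### Conditions on pairs of columns, and counting inversions -/

section ColumnPairs

variable {C Λ : Type*} [LinearOrder C] [LinearOrder Λ] {h : C → ℕ} {τ : C × ℕ → Λ} {c d : C}

/-- The labelling is non-attacking on the columns `c < d`. -/
structure PairNonAttacking (h : C → ℕ) (τ : C × ℕ → Λ) (c d : C) : Prop where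
  row : ∀ j, j ≤ h c → j ≤ h d → τ (c, j) ≠ τ (d, j)
  diag : ∀ j, j + 1 ≤ h c → j ≤ h d → τ (c, j + 1) ≠ τ (d, j)

/-- The triples in the columns `c < d` are not coinversion triples. -/
structure PairTri (h : C → ℕ) (τ : C × ℕ → Λ) (c d : C) : Prop where
  left : h c ≤ h d → ∀ j, j + 1 ≤ h c → ¬ (τ (d, j + 1) < τ (c, j + 1) ∧ τ (c, j + 1) < τ (d, j))
  right : h d < h c → ∀ j, j ≤ h d → ¬ (τ (c, j + 1) < τ (d, j) ∧ τ (d, j) < τ (c, j))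

/-- Attacks and triples each involve just two columns, so everything except the absence of descents
can be checked on pairs. -/
theorem good_iff : Good h τ ↔ (∀ c j, j + 1 ≤ h c → τ (c, j + 1) ≤ τ (c, j)) ∧
    ∀ c d, c < d → PairNonAttacking h τ c d ∧ PairTri h τ c d := by
  constructor
  · intro hg
    refine ⟨fun c j hj => hg.le (c, j + 1) (c, j) ⟨hj, rfl, rfl⟩, fun c d hcd => ⟨⟨?_, ?_⟩, ?_, ?_⟩⟩
    · exact fun j h1 h2 => (hg.att (d, j) (c, j) ⟨h2, h1, Or.inl ⟨rfl, hcd⟩⟩).symm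
    · exact fun j h1 h2 => hg.att (c, j + 1) (d, j) ⟨h1, h2, Or.inr ⟨rfl, hcd⟩⟩
    · exact fun hh j h1 => hg.tri (d, j + 1) (c, j + 1) (d, j)
        ⟨⟨h1.trans hh, rfl, rfl⟩, h1, Or.inl ⟨rfl, hcd, hh⟩⟩
    · exact fun hh j h1 => hg.tri (c, j + 1) (d, j) (c, j)
        ⟨⟨by simp only; omega, rfl, rfl⟩, h1, Or.inr ⟨rfl, hcd, hh⟩⟩
  · rintro ⟨h1, h2⟩
    refine ⟨?_, ?_, ?_⟩
    · rintro ⟨c, j⟩ ⟨d, k⟩ ⟨a, b, ⟨e1, e2⟩ | ⟨e1, e2⟩⟩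
      · simp only at a b e1 e2
        subst e1
        exact ((h2 d c e2).1.row j b a).symm
      · simp only at a b e1 e2
        subst e1
        exact (h2 c d e2).1.diag k a b
    · rintro ⟨c, j⟩ ⟨d, k⟩ ⟨a, e1, e2⟩
      simp only at a e1 e2
      subst e1 e2
      exact h1 c k a
    · rintro ⟨c, j⟩ ⟨d, k⟩ ⟨c', i⟩ ⟨⟨a, e1, e2⟩, b, ⟨e3, e4, e5⟩ | ⟨e3, e4, e5⟩⟩
      · simp only at a b e1 e2 e3 e4 e5
        subst e1 e2 e3
        exact (h2 d c e4).2.left e5 i b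
      · simp only at a b e1 e2 e3 e4 e5
        subst e1 e2 e3
        exact (h2 c d e4).2.right e5 k b

/-- The number of inversions between the columns `c < d` (in rows below `M`). -/
def pairInv (M : ℕ) (h : C → ℕ) (τ : C × ℕ → Λ) (c d : C) : ℕ :=
  (∑ j ∈ Finset.range M, if j ≤ h c ∧ j ≤ h d ∧ τ (c, j) < τ (d, j) then 1 else 0) +
  ∑ j ∈ Finset.range M, if j + 1 ≤ h c ∧ j ≤ h d ∧ τ (d, j) < τ (c, j + 1) then 1 else 0

theorem sum_range_ite_lt (M a : ℕ) (ha : a ≤ M) (P : ℕ → Prop) [DecidablePred P] (Q : ℕ → Prop)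
    [DecidablePred Q] (hPQ : ∀ j, Q j ↔ j < a ∧ P j) :
    (∑ j ∈ Finset.range M, if Q j then 1 else 0) = ∑ j ∈ Finset.range a, if P j then 1 else 0 := by
  rw [← Finset.sum_subset (Finset.range_subset_range.2 ha)]
  · refine Finset.sum_congr rfl fun j hj => ?_
    simp only [hPQ, Finset.mem_range.1 hj, true_and]
  · intro j _ hj
    rw [if_neg]
    rw [hPQ]
    exact fun h' => hj (Finset.mem_range.2 h'.1)

theorem sum_eq_card_iff (a : ℕ) (f : ℕ → ℕ) (hf : ∀ j < a, f j ≤ 1) :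
    ∑ j ∈ Finset.range a, f j ≤ a ∧ (∑ j ∈ Finset.range a, f j = a ↔ ∀ j < a, f j = 1) := by
  have h1 : ∑ j ∈ Finset.range a, (1 : ℕ) = a := by simp
  have h2 : ∀ j ∈ Finset.range a, f j ≤ 1 := fun j hj => hf j (Finset.mem_range.1 hj)
  refine ⟨(Finset.sum_le_sum h2).trans_eq h1, ?_⟩
  have := Finset.sum_eq_sum_iff_of_le h2
  rw [h1] at this
  rw [this]
  simp

-- Each triple of the two columns contains two attacking pairs. Since labels weakly decrease
-- upwards, at most one of them is an inversion, and exactly one is unless the triple is a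
-- coinversion triple. If column c is not the taller one, the basement pair is left over and is
-- always an inversion. This trades the triple condition for the maximality of a number.
omit [LinearOrder C] in
theorem PairNonAttacking.pairInv_le (hna : PairNonAttacking h τ c d)
    (hc : ∀ j, j + 1 ≤ h c → τ (c, j + 1) ≤ τ (c, j))
    (hd : ∀ j, j + 1 ≤ h d → τ (d, j + 1) ≤ τ (d, j)) (h0 : τ (c, 0) < τ (d, 0))
    {M : ℕ} (hMc : h c < M) (hMd : h d < M) :
    pairInv M h τ c d ≤ min (h c) (h d) + 1 ∧
      (pairInv M h τ c d = min (h c) (h d) + 1 ↔ PairTri h τ c d) := by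
  rcases le_or_gt (h c) (h d) with hh | hh
  · rw [min_eq_left hh, pairInv, sum_range_ite_lt M (h c + 1) (by omega)
      (fun j => τ (c, j) < τ (d, j)) _ (fun j => by constructor <;> (intro h'; refine ⟨?_, ?_⟩ <;> grind)),
      sum_range_ite_lt M (h c) (by omega)
      (fun j => τ (d, j) < τ (c, j + 1)) _ (fun j => by constructor <;> (intro h'; refine ⟨?_, ?_⟩ <;> grind)),
      Finset.sum_range_succ', if_pos h0, add_right_comm, ← Finset.sum_add_distrib]
    have key := sum_eq_card_iff (h c) (fun j => (if τ (c, j + 1) < τ (d, j + 1) then 1 else 0) +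
      if τ (d, j) < τ (c, j + 1) then 1 else 0) (fun j hj => by
        have := hd j (by omega)
        have := @lt_trans Λ _
        have := @not_lt Λ _
        split_ifs with h1 h2 <;> grind)
    refine ⟨Nat.add_le_add_right key.1 1, ?_⟩
    rw [add_left_inj, key.2]
    constructor
    · intro h1
      refine ⟨fun _ j hj => ?_, fun h2 => absurd h2 (not_lt.2 hh)⟩
      have := h1 j (by omega)
      rintro ⟨h3, h4⟩
      rw [if_neg h3.asymm, if_neg h4.asymm] at this
      omega
    · intro h1 j hj
      have h2 := h1.left hh j (by omega)
      have h3 := hna.row (j + 1) (by omega) (by omega)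
      have h4 := hna.diag j (by omega) (by omega)
      have h5 := hd j (by omega)
      split_ifs <;> grind
  · rw [min_eq_right hh.le, pairInv, sum_range_ite_lt M (h d + 1) (by omega)
      (fun j => τ (c, j) < τ (d, j)) _ (fun j => by constructor <;> (intro h'; refine ⟨?_, ?_⟩ <;> grind)),
      sum_range_ite_lt M (h d + 1) (by omega)
      (fun j => τ (d, j) < τ (c, j + 1)) _ (fun j => by constructor <;> (intro h'; refine ⟨?_, ?_⟩ <;> grind)),
      ← Finset.sum_add_distrib]
    have key := sum_eq_card_iff (h d + 1) (fun j => (if τ (c, j) < τ (d, j) then 1 else 0) +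
      if τ (d, j) < τ (c, j + 1) then 1 else 0) (fun j hj => by
        have := hc j (by omega)
        split_ifs with h1 h2 <;> grind)
    refine ⟨key.1, ?_⟩
    rw [key.2]
    constructor
    · intro h1
      refine ⟨fun h2 => absurd h2 (not_le.2 hh), fun _ j hj => ?_⟩
      have := h1 j (by omega)
      rintro ⟨h3, h4⟩
      rw [if_neg h3.asymm, if_neg h4.asymm] at this
      omega
    · intro h1 j hj
      have h2 := h1.right hh j (by omega)
      have h3 := hna.row j (by omega) (by omega)
      have h4 := hna.diag j (by omega) (by omega)
      have h5 := hc j (by omega)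
      split_ifs <;> grind

end ColumnPairs

/-! ### Exchanging two adjacent columns above a row -/

section Cut

variable {n : ℕ} {h : Fin n → ℕ} {τ σ : Fin n × ℕ → Fin n} {p q : Fin n} {i : ℕ}

/-- Exchange the columns `p` and `q` from row `i` upwards. -/
def shift (p q : Fin n) (i : ℕ) (u : Fin n × ℕ) : Fin n × ℕ :=
  (if i ≤ u.2 then Equiv.swap p q u.1 else u.1, u.2)

/-- The labelling obtained by exchanging the columns `p` and `q` from row `i` upwards. -/
def cut (h : Fin n → ℕ) (p q : Fin n) (i : ℕ) (τ : Fin n × ℕ → Fin n) (u : Fin n × ℕ) : Fin n :=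
  if u.2 ≤ h (Equiv.swap p q u.1) then τ (shift p q i u) else u.1

theorem shift_shift (u : Fin n × ℕ) : shift p q i (shift p q i u) = u := by
  unfold shift
  apply Prod.ext
  · simp only
    split_ifs <;> simp
  · rfl

theorem shift_mem (hp : i ≤ h p + 1) (hq : i ≤ h q + 1) (u : Fin n × ℕ) :
    (shift p q i u).2 ≤ h (shift p q i u).1 ↔ u.2 ≤ h (Equiv.swap p q u.1) := by
  obtain ⟨c, j⟩ := u
  unfold shift
  simp only
  split_ifs with h1
  · rfl
  · rw [Equiv.swap_apply_def]
    split_ifs with h2 h3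
    · subst h2; omega
    · subst h3; omega
    · rfl

theorem comp_swap_comp_swap : (h ∘ Equiv.swap p q) ∘ Equiv.swap p q = h := by
  funext c
  simp

/-- Exchanging twice restores the filling; the bounds on i make sure that below row i both columns
are complete, so no box is lost. -/
theorem cut_cut (hp : i ≤ h p + 1) (hq : i ≤ h q + 1) (hτ : ∀ u, h u.1 < u.2 → τ u = u.1) :
    cut (h ∘ Equiv.swap p q) p q i (cut h p q i τ) = τ := by
  funext u
  unfold cut
  rw [shift_shift]
  simp only [Function.comp, Equiv.swap_apply_self]
  rcases Nat.lt_or_ge (h u.1) u.2 with h1 | h1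
  · rw [if_neg (by omega), hτ u h1]
  · rw [if_pos h1, if_pos]
    have := shift_mem hp hq (shift p q i u)
    rw [shift_shift] at this
    exact this.1 h1

theorem cut_of_le {c : Fin n} {j : ℕ} (hj : j ≤ h (Equiv.swap p q c)) (hi : i ≤ j) :
    cut h p q i τ (c, j) = τ (Equiv.swap p q c, j) := by
  simp [cut, shift, hj, hi]

theorem cut_of_lt {c : Fin n} {j : ℕ} (hj : j ≤ h (Equiv.swap p q c)) (hi : j < i) :
    cut h p q i τ (c, j) = τ (c, j) := by
  simp [cut, shift, hj, not_le.2 hi]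

theorem cut_of_ne {c : Fin n} (h1 : c ≠ p) (h2 : c ≠ q) {j : ℕ} (hj : j ≤ h c) :
    cut h p q i τ (c, j) = τ (c, j) := by
  simp [cut, shift, Equiv.swap_apply_of_ne_of_ne h1 h2, hj]

theorem augWeight_cut (𝕜 : Type*) [Field 𝕜] (hp : i ≤ h p + 1) (hq : i ≤ h q + 1) :
    augWeight 𝕜 (h ∘ Equiv.swap p q) (cut h p q i τ) = augWeight 𝕜 h τ := by
  unfold augWeight
  refine Finset.prod_nbij' (shift p q i) (shift p q i) ?_ ?_ (fun u _ => shift_shift u)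
    (fun u _ => shift_shift u) ?_
  · intro u hu
    rw [mem_augBoxes] at hu ⊢
    exact (shift_mem hp hq u).2 hu
  · intro u hu
    rw [mem_augBoxes] at hu ⊢
    have := (shift_mem hp hq (shift p q i u)).1
    rw [shift_shift] at this
    exact this hu
  · intro u hu
    rw [mem_augBoxes] at hu
    exact congrArg X (if_pos hu)

/-- Summing over the boxes of the columns `p`, `q` in one row. -/
theorem row_add_cut (hp : i ≤ h p + 1) (hq : i ≤ h q + 1) (j : ℕ) (f : Fin n → ℕ) :
    (if j ≤ h q then f (cut h p q i τ (p, j)) else 0) +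
      (if j ≤ h p then f (cut h p q i τ (q, j)) else 0) =
    (if j ≤ h p then f (τ (p, j)) else 0) + if j ≤ h q then f (τ (q, j)) else 0 := by
  rcases Nat.lt_or_ge j i with hj | hj
  · rw [if_pos (by omega), if_pos (by omega), if_pos (by omega), if_pos (by omega),
      cut_of_lt (by simp; omega) hj, cut_of_lt (by simp; omega) hj]
  · rw [add_comm]
    congr 1
    · split_ifs with h1
      · rw [cut_of_le (by simpa) hj, Equiv.swap_apply_right]
      · rfl
    · split_ifs with h1
      · rw [cut_of_le (by simpa) hj, Equiv.swap_apply_left]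
      · rfl

/-- The labels of the columns `p`, `q` in one row. -/
theorem forall_row_cut (hp : i ≤ h p + 1) (hq : i ≤ h q + 1) (j : ℕ) (P : Fin n → Prop) :
    ((j ≤ h q → P (cut h p q i τ (p, j))) ∧ (j ≤ h p → P (cut h p q i τ (q, j)))) ↔
    ((j ≤ h p → P (τ (p, j))) ∧ (j ≤ h q → P (τ (q, j)))) := by
  rcases Nat.lt_or_ge j i with hj | hj
  · rw [cut_of_lt (by simp; omega) hj, cut_of_lt (by simp; omega) hj]
    have h1 : j ≤ h p := by omega
    have h2 : j ≤ h q := by omega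
    simp [h1, h2]
  · rw [and_comm]
    refine and_congr (forall_congr' fun h1 => ?_) (forall_congr' fun h1 => ?_)
    · rw [cut_of_le (by simpa) hj, Equiv.swap_apply_right]
    · rw [cut_of_le (by simpa) hj, Equiv.swap_apply_left]

/-- Only the columns p and q need to be checked. In every row they carry the same labels as before,
so for a third column c the inversions with p and with q have the same total. The two upper bounds
from `PairNonAttacking.pairInv_le` also keep their total, because the heights are exchanged. The
total was maximal, hence both numbers are still maximal and no coinversion triple appears. -/
theorem IsFilling.cut (hτ : IsFilling h τ) (hpq : q.val = p.val + 1) (hi : 1 ≤ i)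
    (hp : i ≤ h p + 1) (hq : i ≤ h q + 1)
    (hlep : ∀ j, j + 1 ≤ h q → cut h p q i τ (p, j + 1) ≤ cut h p q i τ (p, j))
    (hleq : ∀ j, j + 1 ≤ h p → cut h p q i τ (q, j + 1) ≤ cut h p q i τ (q, j))
    (hna : PairNonAttacking (h ∘ Equiv.swap p q) (cut h p q i τ) p q)
    (htri : PairTri (h ∘ Equiv.swap p q) (cut h p q i τ) p q) :
    IsFilling (h ∘ Equiv.swap p q) (cut h p q i τ) := by
  have hlt := (consec_of_succ hpq).1
  have hsp : (h ∘ Equiv.swap p q) p = h q := by simp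
  have hsq : (h ∘ Equiv.swap p q) q = h p := by simp
  have hso : ∀ c, c ≠ p → c ≠ q → (h ∘ Equiv.swap p q) c = h c := fun c h1 h2 => by
    simp [Equiv.swap_apply_of_ne_of_ne h1 h2]
  obtain ⟨g1, g2⟩ := good_iff.1 hτ.good
  have hbase : ∀ c, AlmostSym.cut h p q i τ (c, 0) = c := fun c => by
    rw [cut_of_lt (Nat.zero_le _) (by omega), hτ.base]
  have hle : ∀ c j, j + 1 ≤ (h ∘ Equiv.swap p q) c →
      AlmostSym.cut h p q i τ (c, j + 1) ≤ AlmostSym.cut h p q i τ (c, j) := by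
    intro c j hj
    by_cases h1 : c = p
    · subst h1
      exact hlep j (by simpa using hj)
    by_cases h2 : c = q
    · subst h2
      exact hleq j (by simpa using hj)
    rw [hso c h1 h2] at hj
    rw [cut_of_ne h1 h2 hj, cut_of_ne h1 h2 (by omega)]
    exact g1 c j hj
  obtain ⟨M, hM⟩ : ∃ M, ∀ c, h c < M := ⟨∑ c, h c + 1, fun c => Nat.lt_succ_iff.2
    (Finset.single_le_sum (f := h) (fun _ _ => Nat.zero_le _) (Finset.mem_univ c))⟩
  have hM' : ∀ c, (h ∘ Equiv.swap p q) c < M := fun c => hM _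
  have hcount : ∀ c d, c < d → pairInv M h τ c d = min (h c) (h d) + 1 := fun c d hcd =>
    ((g2 c d hcd).1.pairInv_le (g1 c) (g1 d) (by rwa [hτ.base, hτ.base]) (hM c) (hM d)).2.2
      (g2 c d hcd).2
  refine ⟨hbase, fun u hu => ?_, good_iff.2 ⟨hle, ?_⟩⟩
  · exact if_neg (not_le.2 hu)
  have left : ∀ c, c < p →
      (PairNonAttacking (h ∘ Equiv.swap p q) (AlmostSym.cut h p q i τ) c p ∧
        PairTri (h ∘ Equiv.swap p q) (AlmostSym.cut h p q i τ) c p) ∧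
      (PairNonAttacking (h ∘ Equiv.swap p q) (AlmostSym.cut h p q i τ) c q ∧
        PairTri (h ∘ Equiv.swap p q) (AlmostSym.cut h p q i τ) c q) := by
    intro c hc
    have h1 : c ≠ p := hc.ne
    have h2 : c ≠ q := (hc.trans hlt).ne
    have a1 := (g2 c p hc).1
    have a2 := (g2 c q (hc.trans hlt)).1
    have r1 := fun j (hj : j ≤ h c) => (forall_row_cut (τ := τ) hp hq j (fun x => τ (c, j) ≠ x)).2
      ⟨a1.row j hj, a2.row j hj⟩
    have r2 := fun j (hj : j + 1 ≤ h c) =>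
      (forall_row_cut (τ := τ) hp hq j (fun x => τ (c, j + 1) ≠ x)).2 ⟨a1.diag j hj, a2.diag j hj⟩
    have na1 : PairNonAttacking (h ∘ Equiv.swap p q) (AlmostSym.cut h p q i τ) c p := by
      refine ⟨fun j => ?_, fun j => ?_⟩ <;> rw [hso c h1 h2, hsp] <;> intro hj hj'
      · rw [cut_of_ne h1 h2 hj]; exact (r1 j hj).1 hj'
      · rw [cut_of_ne h1 h2 hj]; exact (r2 j hj).1 hj'
    have na2 : PairNonAttacking (h ∘ Equiv.swap p q) (AlmostSym.cut h p q i τ) c q := by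
      refine ⟨fun j => ?_, fun j => ?_⟩ <;> rw [hso c h1 h2, hsq] <;> intro hj hj'
      · rw [cut_of_ne h1 h2 hj]; exact (r1 j hj).2 hj'
      · rw [cut_of_ne h1 h2 hj]; exact (r2 j hj).2 hj'
    have l1 := na1.pairInv_le (hle c) (hle p) (by rwa [hbase, hbase]) (hM' c) (hM' p)
    have l2 := na2.pairInv_le (hle c) (hle q) (by rw [hbase, hbase]; exact hc.trans hlt)
      (hM' c) (hM' q)
    have e1 := hcount c p hc
    have e2 := hcount c q (hc.trans hlt)
    have hsum : pairInv M (h ∘ Equiv.swap p q) (AlmostSym.cut h p q i τ) c p +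
        pairInv M (h ∘ Equiv.swap p q) (AlmostSym.cut h p q i τ) c q =
        pairInv M h τ c p + pairInv M h τ c q := by
      unfold pairInv
      simp only [← Finset.sum_add_distrib]
      refine Finset.sum_congr rfl fun j _ => ?_
      have := row_add_cut (τ := τ) hp hq j (fun x => (if j ≤ h c ∧ τ (c, j) < x then 1 else 0) +
        if j + 1 ≤ h c ∧ x < τ (c, j + 1) then 1 else 0)
      rw [hso c h1 h2, hsp, hsq]
      by_cases b1 : j ≤ h c
      · rw [cut_of_ne h1 h2 b1]
        by_cases b2 : j + 1 ≤ h c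
        · rw [cut_of_ne h1 h2 b2]
          by_cases b3 : j ≤ h p <;> by_cases b4 : j ≤ h q <;>
            simp only [b1, b2, b3, b4, true_and, false_and, if_true, if_false] at this ⊢ <;> omega
        · by_cases b3 : j ≤ h p <;> by_cases b4 : j ≤ h q <;>
            simp only [b1, b2, b3, b4, true_and, false_and, if_true, if_false] at this ⊢ <;> omega
      · have b2 : ¬ j + 1 ≤ h c := by omega
        simp [b1, b2]
    rw [hso c h1 h2, hsp] at l1
    rw [hso c h1 h2, hsq] at l2
    have := l1.1
    have := l2.1
    exact ⟨⟨na1, l1.2.1 (by omega)⟩, ⟨na2, l2.2.1 (by omega)⟩⟩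
  have right : ∀ c, q < c →
      (PairNonAttacking (h ∘ Equiv.swap p q) (AlmostSym.cut h p q i τ) p c ∧
        PairTri (h ∘ Equiv.swap p q) (AlmostSym.cut h p q i τ) p c) ∧
      (PairNonAttacking (h ∘ Equiv.swap p q) (AlmostSym.cut h p q i τ) q c ∧
        PairTri (h ∘ Equiv.swap p q) (AlmostSym.cut h p q i τ) q c) := by
    intro c hc
    have h1 : c ≠ p := (hlt.trans hc).ne'
    have h2 : c ≠ q := hc.ne'
    have a1 := (g2 p c (hlt.trans hc)).1
    have a2 := (g2 q c hc).1
    have r1 := fun j (hj : j ≤ h c) => (forall_row_cut (τ := τ) hp hq j (fun x => x ≠ τ (c, j))).2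
      ⟨fun hj' => a1.row j hj' hj, fun hj' => a2.row j hj' hj⟩
    have r2 := fun j (hj : j ≤ h c) =>
      (forall_row_cut (τ := τ) hp hq (j + 1) (fun x => x ≠ τ (c, j))).2
      ⟨fun hj' => a1.diag j hj' hj, fun hj' => a2.diag j hj' hj⟩
    have na1 : PairNonAttacking (h ∘ Equiv.swap p q) (AlmostSym.cut h p q i τ) p c := by
      refine ⟨fun j => ?_, fun j => ?_⟩ <;> rw [hso c h1 h2, hsp] <;> intro hj hj'
      · rw [cut_of_ne h1 h2 hj']; exact (r1 j hj').1 hj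
      · rw [cut_of_ne h1 h2 hj']; exact (r2 j hj').1 hj
    have na2 : PairNonAttacking (h ∘ Equiv.swap p q) (AlmostSym.cut h p q i τ) q c := by
      refine ⟨fun j => ?_, fun j => ?_⟩ <;> rw [hso c h1 h2, hsq] <;> intro hj hj'
      · rw [cut_of_ne h1 h2 hj']; exact (r1 j hj').2 hj
      · rw [cut_of_ne h1 h2 hj']; exact (r2 j hj').2 hj
    have l1 := na1.pairInv_le (hle p) (hle c) (by rw [hbase, hbase]; exact hlt.trans hc)
      (hM' p) (hM' c)
    have l2 := na2.pairInv_le (hle q) (hle c) (by rwa [hbase, hbase]) (hM' q) (hM' c)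
    have e1 := hcount p c (hlt.trans hc)
    have e2 := hcount q c hc
    have hsum : pairInv M (h ∘ Equiv.swap p q) (AlmostSym.cut h p q i τ) p c +
        pairInv M (h ∘ Equiv.swap p q) (AlmostSym.cut h p q i τ) q c =
        pairInv M h τ p c + pairInv M h τ q c := by
      unfold pairInv
      simp only [← Finset.sum_add_distrib]
      refine Finset.sum_congr rfl fun j _ => ?_
      have t1 := row_add_cut (τ := τ) hp hq j (fun x => if x < τ (c, j) then 1 else 0)
      have t2 := row_add_cut (τ := τ) hp hq (j + 1) (fun x => if τ (c, j) < x then 1 else 0)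
      rw [hso c h1 h2, hsp, hsq]
      by_cases b1 : j ≤ h c
      · rw [cut_of_ne h1 h2 b1]
        by_cases b3 : j ≤ h p <;> by_cases b4 : j ≤ h q <;> by_cases b5 : j + 1 ≤ h p <;>
          by_cases b6 : j + 1 ≤ h q <;>
            simp only [b1, b3, b4, b5, b6, true_and, false_and, if_true, if_false] at t1 t2 ⊢ <;>
            omega
      · simp [b1]
    rw [hso c h1 h2, hsp] at l1
    rw [hso c h1 h2, hsq] at l2
    have := l1.1
    have := l2.1
    exact ⟨⟨na1, l1.2.1 (by omega)⟩, ⟨na2, l2.2.1 (by omega)⟩⟩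
  intro c d hcd
  by_cases hcp : c = p
  · subst hcp
    by_cases hdq : d = q
    · subst hdq
      exact ⟨hna, htri⟩
    · refine (right d ?_).1
      rw [Fin.ext_iff] at hdq
      rw [Fin.lt_def] at hcd ⊢
      omega
  by_cases hcq : c = q
  · subst hcq
    exact (right d hcd).2
  by_cases hdp : d = p
  · subst hdp
    exact (left c hcd).1
  by_cases hdq : d = q
  · subst hdq
    refine (left c ?_).2
    rw [Fin.ext_iff] at hcp
    rw [Fin.lt_def] at hcd ⊢
    omega
  obtain ⟨a, b⟩ := g2 c d hcd
  have e1 : ∀ j, j ≤ h c → AlmostSym.cut h p q i τ (c, j) = τ (c, j) := fun j => cut_of_ne hcp hcq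
  have e2 : ∀ j, j ≤ h d → AlmostSym.cut h p q i τ (d, j) = τ (d, j) := fun j => cut_of_ne hdp hdq
  have e3 := hso c hcp hcq
  have e4 := hso d hdp hdq
  refine ⟨⟨fun j => ?_, fun j => ?_⟩, ⟨?_, ?_⟩⟩ <;> rw [e3, e4]
  · intro h1 h2
    rw [e1 j h1, e2 j h2]
    exact a.row j h1 h2
  · intro h1 h2
    rw [e1 _ h1, e2 j h2]
    exact a.diag j h1 h2
  · intro hh j hj
    rw [e1 _ hj, e2 _ (hj.trans hh), e2 j (by omega)]
    exact b.left hh j hj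
  · intro hh j hj
    rw [e1 (j + 1) (by omega), e2 _ hj, e1 j (by omega)]
    exact b.right hh j hj

end Cut

end AlmostSym

namespace AlmostSym

open MvPolynomial (X rename)

/-! ### The recursion for the generating function of fillings -/

section Crossing

variable {n : ℕ} {h : Fin n → ℕ} {τ σ : Fin n × ℕ → Fin n} {p q : Fin n} {i : ℕ}

/-- Row `i` is the first one in which the label in column `p` exceeds that in the shorter column
`q`. -/
structure CrossAt (h : Fin n → ℕ) (p q : Fin n) (i : ℕ) (τ : Fin n × ℕ → Fin n) : Prop where
  pos : 1 ≤ i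
  le : i ≤ h q + 1
  lt_of_lt : ∀ j < i, τ (p, j) < τ (q, j)
  gt_of_le : ∀ j, i ≤ j → j ≤ h q → τ (q, j) < τ (p, j)

/-- Row `i` is the last one in which the label in column `q` is weakly smaller than the label in
the previous row of the shorter column `p`. -/
structure LastAt (h : Fin n → ℕ) (p q : Fin n) (i : ℕ) (τ : Fin n × ℕ → Fin n) : Prop where
  pos : 1 ≤ i
  le : i ≤ h p + 1
  last : τ (q, i) ≤ τ (p, i - 1)
  lt_of_le : ∀ j, i ≤ j → j ≤ h p → τ (p, j) < τ (q, j + 1)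

theorem CrossAt.unique {i' : ℕ} (h1 : CrossAt h p q i τ) (h2 : CrossAt h p q i' τ) : i = i' := by
  have key : ∀ {i i'}, CrossAt h p q i τ → CrossAt h p q i' τ → ¬ i < i' := fun h1 h2 hlt =>
    (h2.lt_of_lt _ hlt).asymm (h1.gt_of_le _ le_rfl (by have := h2.le; omega))
  have := key h1 h2
  have := key h2 h1
  omega

theorem LastAt.unique {i' : ℕ} (h1 : LastAt h p q i τ) (h2 : LastAt h p q i' τ) : i = i' := by
  have key : ∀ {i i'}, LastAt h p q i τ → LastAt h p q i' τ → ¬ i < i' := fun {i i'} h1 h2 hlt => by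
    have a := h1.lt_of_le (i' - 1) (by omega) (by have := h2.le; omega)
    rw [show i' - 1 + 1 = i' by omega] at a
    exact absurd h2.last (not_le.2 a)
  have := key h1 h2
  have := key h2 h1
  omega

/-- In the basement column p has the smaller label. Once its label is the larger one, the triple
condition gives τ(p, j+1) > τ(q, j) ≥ τ(q, j+1), so it stays larger. The value h q + 1 stands for
columns that never cross. -/
theorem IsFilling.exists_crossAt (hτ : IsFilling h τ) (hpq : p < q) (hh : h q < h p) :
    ∃ i, CrossAt h p q i τ := by
  classical
  obtain ⟨-, g⟩ := good_iff.1 hτ.good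
  obtain ⟨a, b⟩ := g p q hpq
  have hex : ∃ j, j = h q + 1 ∨ τ (q, j) < τ (p, j) := ⟨h q + 1, Or.inl rfl⟩
  have hle : Nat.find hex ≤ h q + 1 := Nat.find_min' hex (Or.inl rfl)
  refine ⟨Nat.find hex, ?_, hle, fun j hj => ?_, ?_⟩
  · rw [Nat.one_le_iff_ne_zero]
    intro h0
    have := Nat.find_spec hex
    rw [h0, hτ.base, hτ.base] at this
    rcases this with h1 | h1
    · omega
    · exact h1.asymm hpq
  · have := Nat.find_min hex hj
    push Not at this
    exact lt_of_le_of_ne this.2 (a.row j (by omega) (by omega))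
  · intro j hj hj'
    induction j, hj using Nat.le_induction with
    | base =>
      rcases Nat.find_spec hex with h1 | h1
      · omega
      · exact h1
    | succ j hj ih =>
      have h1 := ih (by omega)
      have h2 := b.right hh j (by omega)
      have h3 := a.diag j (by omega) (by omega)
      have h4 := hτ.good.anti q (Nat.le_succ j) (by omega)
      have h5 : τ (q, j) < τ (p, j + 1) := by
        rcases lt_trichotomy (τ (p, j + 1)) (τ (q, j)) with h6 | h6 | h6
        · exact absurd ⟨h6, h1⟩ h2
        · exact absurd h6 h3
        · exact h6
      exact h4.trans_lt h5

/-- Starting from the increasing basement, a reversal of order in a row would create a coinversion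
triple with the box below it in column q. -/
theorem IsFilling.lt_of_le (hσ : IsFilling h σ) (hpq : p < q) (hh : h p ≤ h q) {j : ℕ}
    (hj : j ≤ h p) : σ (p, j) < σ (q, j) := by
  obtain ⟨-, g⟩ := good_iff.1 hσ.good
  obtain ⟨a, b⟩ := g p q hpq
  induction j with
  | zero => rwa [hσ.base, hσ.base]
  | succ j ih =>
    have h1 := ih (by omega)
    have h2 := b.left hh j hj
    have h3 := a.row (j + 1) hj (by omega)
    have h4 := hσ.good.anti p (Nat.le_succ j) hj
    rcases lt_trichotomy (σ (p, j + 1)) (σ (q, j + 1)) with h6 | h6 | h6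
    · exact h6
    · exact absurd h6 h3
    · exact absurd ⟨h6, h4.trans_lt h1⟩ h2

/-- The row is one above the last j that violates the defining inequality of `Uncrossed`. -/
theorem exists_lastAt (hu : ¬ Uncrossed h p q σ) : ∃ i, LastAt h p q i σ := by
  classical
  have hex : ∃ j ≤ h p, σ (q, j + 1) ≤ σ (p, j) := by
    unfold Uncrossed at hu
    push Not at hu
    exact hu
  obtain ⟨j, hj, hj'⟩ := hex
  let m := Nat.findGreatest (fun j => σ (q, j + 1) ≤ σ (p, j)) (h p)
  have hm : σ (q, m + 1) ≤ σ (p, m) := Nat.findGreatest_spec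
    (P := fun j => σ (q, j + 1) ≤ σ (p, j)) hj hj'
  have hm' : m ≤ h p := Nat.findGreatest_le _
  refine ⟨m + 1, by omega, by omega, by simpa using hm, fun j h1 h2 => ?_⟩
  exact not_le.1 (Nat.findGreatest_is_greatest (P := fun j => σ (q, j + 1) ≤ σ (p, j)) h1 h2)

/-- After the exchange column p is below column q in every common row, which settles the pair p, q.
The cutting row remains visible as the last failure of being uncrossed, so the exchange can be
undone. -/
theorem IsFilling.cut_of_crossAt (hτ : IsFilling h τ) (hpq : q.val = p.val + 1) (hh : h q < h p)
    (hc : CrossAt h p q i τ) : IsFilling (h ∘ Equiv.swap p q) (AlmostSym.cut h p q i τ) ∧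
      LastAt (h ∘ Equiv.swap p q) p q i (AlmostSym.cut h p q i τ) := by
  have hlt := (consec_of_succ hpq).1
  obtain ⟨c1, c2, c3, c4⟩ := hc
  obtain ⟨-, g⟩ := good_iff.1 hτ.good
  obtain ⟨a, b⟩ := g p q hlt
  have hsp : (h ∘ Equiv.swap p q) p = h q := by simp
  have hsq : (h ∘ Equiv.swap p q) q = h p := by simp
  have p1 : ∀ j, j < i → AlmostSym.cut h p q i τ (p, j) = τ (p, j) := fun j hj =>
    cut_of_lt (by simp; omega) hj
  have q1 : ∀ j, j < i → AlmostSym.cut h p q i τ (q, j) = τ (q, j) := fun j hj =>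
    cut_of_lt (by simp; omega) hj
  have p2 : ∀ j, i ≤ j → j ≤ h q → AlmostSym.cut h p q i τ (p, j) = τ (q, j) := fun j hj hj' => by
    rw [cut_of_le (by simpa) hj, Equiv.swap_apply_left]
  have q2 : ∀ j, i ≤ j → j ≤ h p → AlmostSym.cut h p q i τ (q, j) = τ (p, j) := fun j hj hj' => by
    rw [cut_of_le (by simpa) hj, Equiv.swap_apply_right]
  have hp := fun {j k : ℕ} => hτ.good.anti p (j := j) (k := k)
  have hq := fun {j k : ℕ} => hτ.good.anti q (j := j) (k := k)
  have hlep : ∀ j, j + 1 ≤ h q →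
      AlmostSym.cut h p q i τ (p, j + 1) ≤ AlmostSym.cut h p q i τ (p, j) := by
    intro j hj
    rcases lt_trichotomy (j + 1) i with h1 | h1 | h1
    · rw [p1 _ h1, p1 j (by omega)]; exact hp (Nat.le_succ j) (by omega)
    · rw [p2 _ h1.ge hj, p1 j (by omega)]
      exact (c4 _ h1.ge hj).le.trans (hp (Nat.le_succ j) (by omega))
    · rw [p2 _ h1.le hj, p2 j (by omega) (by omega)]; exact hq (Nat.le_succ j) hj
  have hleq : ∀ j, j + 1 ≤ h p →
      AlmostSym.cut h p q i τ (q, j + 1) ≤ AlmostSym.cut h p q i τ (q, j) := by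
    intro j hj
    rcases lt_trichotomy (j + 1) i with h1 | h1 | h1
    · rw [q1 _ h1, q1 j (by omega)]; exact hq (Nat.le_succ j) (by omega)
    · rw [q2 _ h1.ge hj, q1 j (by omega)]
      exact (hp (Nat.le_succ j) hj).trans (c3 j (by omega)).le
    · rw [q2 _ h1.le hj, q2 j (by omega) (by omega)]; exact hp (Nat.le_succ j) hj
  have hrow : ∀ j ≤ h q, AlmostSym.cut h p q i τ (p, j) < AlmostSym.cut h p q i τ (q, j) := by
    intro j hj
    rcases Nat.lt_or_ge j i with h1 | h1
    · rw [p1 j h1, q1 j h1]; exact c3 j h1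
    · rw [p2 j h1 hj, q2 j h1 (by omega)]; exact c4 j h1 hj
  refine ⟨hτ.cut hpq c1 (by omega) c2 hlep hleq ⟨?_, ?_⟩ ⟨?_, ?_⟩, c1, by rw [hsp]; exact c2, ?_, ?_⟩
  · intro j h1 _
    rw [hsp] at h1
    exact (hrow j h1).ne
  · intro j h1 _
    rw [hsp] at h1
    exact ((hrow _ h1).trans_le (hleq j (by omega))).ne
  · rintro _ j h1 ⟨h2, -⟩
    rw [hsp] at h1
    exact h2.asymm (hrow _ h1)
  · intro h1
    rw [hsp, hsq] at h1
    omega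
  · rw [q2 i le_rfl (by omega), p1 _ (by omega)]
    exact hp (Nat.sub_le _ _) (by omega)
  · intro j h1 h2
    rw [hsp] at h2
    rw [p2 j h1 h2, q2 _ (by omega) (by omega)]
    rcases lt_trichotomy (τ (p, j + 1)) (τ (q, j)) with h6 | h6 | h6
    · exact absurd ⟨h6, c4 j h1 h2⟩ (b.right hh j h2)
    · exact absurd h6 (a.diag j (by omega) h2)
    · exact h6

/-- The inverse direction: the failure in row i keeps column p weakly decreasing after the exchange,
and the inequalities above it become the triple condition for the taller column p. -/
theorem IsFilling.cut_of_lastAt (hσ : IsFilling h σ) (hpq : q.val = p.val + 1) (hh : h p < h q)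
    (hc : LastAt h p q i σ) : IsFilling (h ∘ Equiv.swap p q) (AlmostSym.cut h p q i σ) ∧
      CrossAt (h ∘ Equiv.swap p q) p q i (AlmostSym.cut h p q i σ) := by
  have hlt := (consec_of_succ hpq).1
  obtain ⟨c1, c2, c3, c4⟩ := hc
  have hsp : (h ∘ Equiv.swap p q) p = h q := by simp
  have hsq : (h ∘ Equiv.swap p q) q = h p := by simp
  have p1 : ∀ j, j < i → AlmostSym.cut h p q i σ (p, j) = σ (p, j) := fun j hj =>
    cut_of_lt (by simp; omega) hj
  have q1 : ∀ j, j < i → AlmostSym.cut h p q i σ (q, j) = σ (q, j) := fun j hj =>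
    cut_of_lt (by simp; omega) hj
  have p2 : ∀ j, i ≤ j → j ≤ h q → AlmostSym.cut h p q i σ (p, j) = σ (q, j) := fun j hj hj' => by
    rw [cut_of_le (by simpa) hj, Equiv.swap_apply_left]
  have q2 : ∀ j, i ≤ j → j ≤ h p → AlmostSym.cut h p q i σ (q, j) = σ (p, j) := fun j hj hj' => by
    rw [cut_of_le (by simpa) hj, Equiv.swap_apply_right]
  have hp := fun {j k : ℕ} => hσ.good.anti p (j := j) (k := k)
  have hq := fun {j k : ℕ} => hσ.good.anti q (j := j) (k := k)
  have hrow := fun {j : ℕ} => hσ.lt_of_le hlt hh.le (j := j)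
  have hlep : ∀ j, j + 1 ≤ h q →
      AlmostSym.cut h p q i σ (p, j + 1) ≤ AlmostSym.cut h p q i σ (p, j) := by
    intro j hj
    rcases lt_trichotomy (j + 1) i with h1 | h1 | h1
    · rw [p1 _ h1, p1 j (by omega)]; exact hp (Nat.le_succ j) (by omega)
    · rw [p2 _ h1.ge hj, p1 j (by omega)]
      subst h1
      exact c3
    · rw [p2 _ h1.le hj, p2 j (by omega) (by omega)]; exact hq (Nat.le_succ j) hj
  have hleq : ∀ j, j + 1 ≤ h p →
      AlmostSym.cut h p q i σ (q, j + 1) ≤ AlmostSym.cut h p q i σ (q, j) := by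
    intro j hj
    rcases lt_trichotomy (j + 1) i with h1 | h1 | h1
    · rw [q1 _ h1, q1 j (by omega)]; exact hq (Nat.le_succ j) (by omega)
    · rw [q2 _ h1.ge hj, q1 j (by omega)]
      exact (hrow hj).le.trans (hq (Nat.le_succ j) (by omega))
    · rw [q2 _ h1.le hj, q2 j (by omega) (by omega)]; exact hp (Nat.le_succ j) hj
  have hrow1 : ∀ j < i, AlmostSym.cut h p q i σ (p, j) < AlmostSym.cut h p q i σ (q, j) := by
    intro j h1
    rw [p1 j h1, q1 j h1]
    exact hrow (by omega)
  have hrow2 : ∀ j, i ≤ j → j ≤ h p →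
      AlmostSym.cut h p q i σ (q, j) < AlmostSym.cut h p q i σ (p, j) := by
    intro j h1 h2
    rw [p2 j h1 (by omega), q2 j h1 h2]
    exact hrow h2
  have hdiag : ∀ j, i ≤ j → j ≤ h p →
      AlmostSym.cut h p q i σ (q, j) < AlmostSym.cut h p q i σ (p, j + 1) := by
    intro j h1 h2
    rw [p2 _ (by omega) (by omega), q2 j h1 h2]
    exact c4 j h1 h2
  refine ⟨hσ.cut hpq c1 c2 (by omega) hlep hleq ⟨?_, ?_⟩ ⟨?_, ?_⟩, c1, by rw [hsq]; exact c2,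
    hrow1, ?_⟩
  · intro j _ h2
    rw [hsq] at h2
    rcases Nat.lt_or_ge j i with h3 | h3
    · exact (hrow1 j h3).ne
    · exact (hrow2 j h3 h2).ne'
  · intro j h1 h2
    rw [hsp] at h1
    rw [hsq] at h2
    rcases Nat.lt_or_ge j i with h3 | h3
    · exact ((hlep j h1).trans_lt (hrow1 j h3)).ne
    · exact (hdiag j h3 h2).ne'
  · intro h1
    rw [hsp, hsq] at h1
    omega
  · rintro _ j h2 ⟨h4, h5⟩
    rw [hsq] at h2
    rcases Nat.lt_or_ge j i with h3 | h3
    · exact h5.asymm (hrow1 j h3)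
    · exact h4.asymm (hdiag j h3 h2)
  · intro j h1 h2
    rw [hsq] at h2
    exact hrow2 j h1 h2

-- The cutting row is determined by the filling on either side, so `cut` is a weight-preserving
-- bijection by `cut_cut`.
open Classical in
theorem sum_crossed (𝕜 : Type*) [Field 𝕜] (hpq : q.val = p.val + 1) (hh : h q < h p) :
    augSum 𝕜 h = ∑ τ ∈ fillings (h ∘ Equiv.swap p q) with
      ¬ Uncrossed (h ∘ Equiv.swap p q) p q τ, augWeight 𝕜 (h ∘ Equiv.swap p q) τ := by
  have hlt := (consec_of_succ hpq).1
  have hsp : (h ∘ Equiv.swap p q) p = h q := by simp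
  have hsq : (h ∘ Equiv.swap p q) q = h p := by simp
  have hex : ∀ τ ∈ fillings h, ∃ i, CrossAt h p q i τ := fun τ hτ =>
    (mem_fillings.1 hτ).exists_crossAt hlt hh
  refine Finset.sum_bij (fun τ hτ => cut h p q (hex τ hτ).choose τ) ?_ ?_ ?_ ?_
  · intro τ hτ
    have hc := (hex τ hτ).choose_spec
    generalize (hex τ hτ).choose = i at hc
    obtain ⟨h1, h2⟩ := (mem_fillings.1 hτ).cut_of_crossAt hpq hh hc
    rw [Finset.mem_filter, mem_fillings]
    refine ⟨h1, fun hu => ?_⟩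
    have h3 := hu (i - 1) (by have := h2.le; omega)
    rw [Nat.sub_add_cancel h2.pos] at h3
    exact absurd h2.last (not_le.2 h3)
  · intro τ hτ σ hσ he
    have hc := (hex τ hτ).choose_spec
    have hd := (hex σ hσ).choose_spec
    generalize (hex τ hτ).choose = i at hc he
    generalize (hex σ hσ).choose = k at hd he
    obtain ⟨-, h2⟩ := (mem_fillings.1 hτ).cut_of_crossAt hpq hh hc
    obtain ⟨-, h4⟩ := (mem_fillings.1 hσ).cut_of_crossAt hpq hh hd
    rw [← he] at h4
    obtain rfl := h2.unique h4
    have h5 := hc.le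
    rw [← cut_cut (p := p) (q := q) (i := i) (by omega) h5 (mem_fillings.1 hτ).outside, he,
      cut_cut (by omega) h5 (mem_fillings.1 hσ).outside]
  · intro σ hσ
    rw [Finset.mem_filter, mem_fillings] at hσ
    obtain ⟨i, hi⟩ := exists_lastAt hσ.2
    obtain ⟨h1, h2⟩ := hσ.1.cut_of_lastAt hpq (by rw [hsp, hsq]; exact hh) hi
    have h3 : (h ∘ Equiv.swap p q) ∘ Equiv.swap p q = h := comp_swap_comp_swap
    have h4 := hi.le
    have h5 := cut_cut (q := q) (i := i) h4 (by rw [hsq]; rw [hsp] at h4; omega) hσ.1.outside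
    rw [h3] at h1 h2 h5
    refine ⟨_, mem_fillings.2 h1, ?_⟩
    have hc := (hex _ (mem_fillings.2 h1)).choose_spec
    rw [hc.unique h2, h5]
  · intro τ hτ
    have hc := (hex τ hτ).choose_spec
    have := hc.le
    exact (augWeight_cut 𝕜 (by omega) this).symm

-- With F and H symmetric in x_p and x_q, the divided difference of F − x_q H has numerator x_p(F −
-- x_q H) − x_q(F − x_p H) = (x_p − x_q)F.
open Classical in
theorem augSum_swap (𝕜 : Type*) [Field 𝕜] (hpq : q.val = p.val + 1) (hh : h q < h p) :
    augSum 𝕜 (h ∘ Equiv.swap p q) = isobaric p q (augSum 𝕜 h) := by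
  have hlt := (consec_of_succ hpq).1
  have hsp : (h ∘ Equiv.swap p q) p = h q := by simp
  have hsq : (h ∘ Equiv.swap p q) q = h p := by simp
  obtain ⟨H, hH, hs⟩ := exists_sum_uncrossed (h := h ∘ Equiv.swap p q) 𝕜 hpq
    (by rw [hsp, hsq]; exact hh)
  have hsym := rename_augSum (h := h ∘ Equiv.swap p q) 𝕜 hpq (by rw [hsp, hsq]; exact hh.le)
  have hsum : augSum 𝕜 h = augSum 𝕜 (h ∘ Equiv.swap p q) - X q * H := by
    rw [sum_crossed 𝕜 hpq hh, augSum, ← hs, eq_sub_iff_add_eq, add_comm,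
      Finset.sum_filter_add_sum_filter_not]
  apply mul_left_cancel₀ (X_sub_ne p q hlt.ne)
  rw [sub_mul_isobaric p q hlt.ne, hsum, map_sub, map_mul, hsym, hH, MvPolynomial.rename_X,
    Equiv.swap_apply_right]
  ring

end Crossing

end AlmostSym

namespace AlmostSym

open MvPolynomial (X rename)

/-! ### Key polynomials as generating functions of fillings -/

section KeyFormula

variable {n : ℕ} {h : Fin n → ℕ} {τ σ : Fin n × ℕ → Fin n} {p q : Fin n}
  (𝕜 : Type*) [Field 𝕜]

/-- The boxes of the diagram, without the basement. -/
def bodyBoxes (h : Fin n → ℕ) : Finset (Fin n × ℕ) := {u ∈ augBoxes h | u.2 ≠ 0}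

theorem mem_bodyBoxes {u : Fin n × ℕ} : u ∈ bodyBoxes h ↔ u.2 ≤ h u.1 ∧ u.2 ≠ 0 := by
  rw [bodyBoxes, Finset.mem_filter, mem_augBoxes]

/-- The weight of a filling. -/
def bodyWeight (h : Fin n → ℕ) (τ : Fin n × ℕ → Fin n) : MvPolynomial (Fin n) 𝕜 :=
  ∏ u ∈ bodyBoxes h, X (τ u)

/-- The generating function of the fillings. -/
def bodySum (h : Fin n → ℕ) : MvPolynomial (Fin n) 𝕜 := ∑ τ ∈ fillings h, bodyWeight 𝕜 h τ

theorem IsFilling.augWeight_eq (hτ : IsFilling h τ) :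
    augWeight 𝕜 h τ = (∏ c, X c) * bodyWeight 𝕜 h τ := by
  rw [augWeight, bodyWeight, bodyBoxes, ← Finset.prod_filter_not_mul_prod_filter (augBoxes h)
    (fun u => u.2 ≠ 0)]
  congr 1
  refine Finset.prod_bij (fun u _ => u.1) ?_ ?_ ?_ ?_
  · intros; exact Finset.mem_univ _
  · rintro ⟨c, j⟩ h1 ⟨d, k⟩ h2 h3
    simp only [ne_eq, not_not, Finset.mem_filter] at h1 h2 h3
    rw [h3, h1.2, h2.2]
  · intro c _
    exact ⟨(c, 0), by simp [mem_augBoxes], rfl⟩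
  · rintro ⟨c, j⟩ h1
    simp only [ne_eq, not_not, Finset.mem_filter] at h1
    rw [h1.2, hτ.base]

/-- The basement contributes the symmetric factor x_1 ⋯ x_n, which commutes with divided
differences. It was kept so far because the word argument and `cut` treat basement boxes like all
others. -/
theorem augSum_eq : augSum 𝕜 h = (∏ c, X c) * bodySum 𝕜 h := by
  rw [augSum, bodySum, Finset.mul_sum]
  exact Finset.sum_congr rfl fun τ hτ => (mem_fillings.1 hτ).augWeight_eq 𝕜

variable {𝕜} in
theorem isobaric_mul (hpq : p ≠ q) (f g : MvPolynomial (Fin n) 𝕜)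
    (hg : rename (Equiv.swap p q) g = g) : isobaric p q (g * f) = g * isobaric p q f := by
  apply mul_left_cancel₀ (X_sub_ne p q hpq)
  have h1 := sub_mul_isobaric p q hpq (g * f)
  have h2 := sub_mul_isobaric p q hpq f
  rw [map_mul, hg] at h1
  linear_combination h1 - g * h2

variable {𝕜} in
theorem rename_prod_X (w : Equiv.Perm (Fin n)) :
    rename w (∏ c, X c : MvPolynomial (Fin n) 𝕜) = ∏ c, X c := by
  rw [map_prod]
  simp only [MvPolynomial.rename_X]
  exact Equiv.prod_comp w (fun c => (X c : MvPolynomial (Fin n) 𝕜))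

variable {𝕜} in
theorem prod_X_ne_zero : (∏ c, X c : MvPolynomial (Fin n) 𝕜) ≠ 0 :=
  Finset.prod_ne_zero_iff.2 fun c _ => MvPolynomial.X_ne_zero c

theorem rename_bodySum (hpq : q.val = p.val + 1) (hh : h p ≤ h q) :
    rename (Equiv.swap p q) (bodySum 𝕜 h) = bodySum 𝕜 h := by
  have := rename_augSum 𝕜 hpq hh
  rw [augSum_eq, map_mul, rename_prod_X] at this
  exact mul_left_cancel₀ prod_X_ne_zero this

theorem bodySum_swap (hpq : q.val = p.val + 1) (hh : h q < h p) :
    bodySum 𝕜 (h ∘ Equiv.swap p q) = isobaric p q (bodySum 𝕜 h) := by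
  have := augSum_swap 𝕜 hpq hh
  rw [augSum_eq, augSum_eq, isobaric_mul (consec_of_succ hpq).1.ne _ _ (rename_prod_X _)] at this
  exact mul_left_cancel₀ prod_X_ne_zero this

/-- Labels in column c are at most c. By induction from the left, a smaller label already stands in
its own column of the same row, which is at least as tall, so it would be attacked. -/
theorem isFilling_iff_of_antitone (hh : Antitone h) : IsFilling h τ ↔ τ = Prod.fst := by
  constructor
  · intro hτ
    have key : ∀ c j, j ≤ h c → τ (c, j) = c := by
      intro c
      induction c using WellFoundedLT.induction with
      | ind c ih =>
        intro j hj
        rcases (hτ.le c hj).lt_or_eq with h1 | h1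
        · have h2 : j ≤ h (τ (c, j)) := hj.trans (hh h1.le)
          have h3 := ih _ h1 j h2
          exact absurd h3.symm (hτ.good.att _ _ ⟨hj, h2, Or.inl ⟨rfl, h1⟩⟩)
        · exact h1
    funext u
    rcases Nat.lt_or_ge (h u.1) u.2 with h1 | h1
    · exact hτ.outside u h1
    · exact key u.1 u.2 h1
  · rintro rfl
    refine ⟨fun _ => rfl, fun _ _ => rfl, ⟨?_, ?_, ?_⟩⟩
    · rintro u v ⟨-, -, ⟨-, h1⟩ | ⟨-, h1⟩⟩
      · exact h1.ne'
      · exact h1.ne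
    · rintro u w ⟨-, h1, -⟩
      exact h1.le
    · rintro u v w ⟨⟨-, h1, -⟩, -⟩ ⟨h2, h3⟩
      rw [h1] at h2
      exact h2.asymm h3

theorem bodySum_of_antitone (hh : Antitone h) : bodySum 𝕜 h = ∏ c, X c ^ h c := by
  have : fillings h = {Prod.fst} := by
    ext τ
    rw [mem_fillings, isFilling_iff_of_antitone hh, Finset.mem_singleton]
  rw [bodySum, this, Finset.sum_singleton, bodyWeight]
  rw [← Finset.prod_fiberwise_of_maps_to (s := bodyBoxes h) (t := Finset.univ) (g := Prod.fst)
    (fun _ _ => Finset.mem_univ _)]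
  refine Finset.prod_congr rfl fun c _ => ?_
  rw [Finset.prod_congr rfl (g := fun _ => X c) (fun u hu => by rw [(Finset.mem_filter.1 hu).2]),
    Finset.prod_const]
  congr 1
  rw [← Nat.card_Icc 1 (h c) |>.trans (Nat.add_sub_cancel _ _)]
  refine Finset.card_nbij' Prod.snd (Prod.mk c) ?_ ?_ ?_ ?_
  · rintro ⟨d, j⟩ h1
    simp only [Finset.coe_filter, Set.mem_ofPred_eq, mem_bodyBoxes, Finset.coe_Icc, Set.mem_Icc] at h1 ⊢
    obtain ⟨⟨h1, h2⟩, rfl⟩ := h1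
    omega
  · intro j h1
    simp only [Finset.coe_filter, Set.mem_ofPred_eq, mem_bodyBoxes, Finset.coe_Icc, Set.mem_Icc] at h1 ⊢
    exact ⟨⟨h1.2, by omega⟩, trivial⟩
  · rintro ⟨d, j⟩ h1
    simp only [Finset.coe_filter, Set.mem_ofPred_eq] at h1
    rw [h1.2]
  · intro j _
    rfl

/-- Key polynomials are generating functions of fillings. -/
theorem keyPoly_eq_bodySum (h : Fin n → ℕ) : keyPoly h = bodySum 𝕜 h := by
  have : IsKeyFamily (fun h : Fin n → ℕ => bodySum 𝕜 h) :=
    ⟨fun a ha => bodySum_of_antitone 𝕜 ha, fun a i j hij ha => bodySum_swap 𝕜 hij ha⟩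
  exact (congrFun this.eq_keyPoly h).symm

end KeyFormula

end AlmostSym

namespace AlmostSym

open MvPolynomial (X rename)

/-! ### The Weyl symmetrizer fixes symmetric polynomials -/

section Weyl

variable {n : ℕ} {p q : Fin n} {k : ℕ} {𝕜 : Type*} [Field 𝕜]

/-- The permutation fixes the first `k` elements. -/
def IsTail (k : ℕ) (w : Equiv.Perm (Fin n)) : Prop := ∀ i : Fin n, i.val < k → w i = i

theorem isTail_swap (hp : k ≤ p.val) (hq : k ≤ q.val) : IsTail k (Equiv.swap p q) := by
  intro i hi
  rw [Equiv.swap_apply_of_ne_of_ne]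
  · rintro rfl; omega
  · rintro rfl; omega

theorem IsTail.mul {w v : Equiv.Perm (Fin n)} (hw : IsTail k w) (hv : IsTail k v) :
    IsTail k (w * v) := fun i hi => by
  rw [Equiv.Perm.mul_apply, hv i hi, hw i hi]

/-- The adjacent transpositions generate. -/
theorem IsTail.induction {P : Equiv.Perm (Fin n) → Prop} (h1 : P 1)
    (hmul : ∀ v w, P v → P w → P (v * w))
    (hswap : ∀ p q : Fin n, q.val = p.val + 1 → k ≤ p.val → P (Equiv.swap p q))
    {w : Equiv.Perm (Fin n)} (hw : IsTail k w) : P w := by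
  have hsw : ∀ d : ℕ, ∀ p q : Fin n, q.val = p.val + 1 + d → k ≤ p.val → P (Equiv.swap p q) := by
    intro d
    induction d with
    | zero => exact fun p q h2 h3 => hswap p q h2 h3
    | succ d ih =>
      intro p q h2 h3
      let r : Fin n := ⟨p.val + 1, by omega⟩
      -- A longer transposition is a conjugate of a shorter one by an adjacent transposition.
      have e : Equiv.swap p q = Equiv.swap p r * (Equiv.swap r q * Equiv.swap p r) := by
        have n1 : p ≠ r := by rw [Ne, Fin.ext_iff]; simp [r]
        have n2 : q ≠ r := by rw [Ne, Fin.ext_iff]; simp only [r]; omega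
        have n3 : p ≠ q := by rw [Ne, Fin.ext_iff]; omega
        ext m
        simp only [Equiv.Perm.mul_apply, Equiv.swap_apply_def]
        grind
      rw [e]
      have a := hswap p r rfl h3
      exact hmul _ _ a (hmul _ _ (ih r q (by simp only [r]; omega) (by simp only [r]; omega)) a)
  have hs : ∀ p q : Fin n, k ≤ p.val → k ≤ q.val → P (Equiv.swap p q) := by
    intro p q hp hq
    rcases lt_trichotomy p q with h2 | h2 | h2
    · rw [Fin.lt_def] at h2
      exact hsw (q.val - p.val - 1) p q (by omega) hp
    · rw [h2, Equiv.swap_self]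
      exact h1
    · rw [Fin.lt_def] at h2
      rw [Equiv.swap_comm]
      exact hsw (p.val - q.val - 1) q p (by omega) hq
  classical
  have key : ∀ v : Equiv.Perm {i : Fin n // k ≤ i.val}, P (Equiv.Perm.ofSubtype v) := by
    intro v
    induction v using Equiv.Perm.swap_induction_on with
    | one => rw [map_one]; exact h1
    | swap_mul f x y _ ih =>
      rw [map_mul, Equiv.Perm.ofSubtype_swap_eq]
      exact hmul _ _ (hs _ _ x.2 y.2) ih
  have hw1 : ∀ x, k ≤ x.val ↔ k ≤ (w x).val := by
    intro x
    by_cases hx : x.val < k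
    · rw [hw x hx]
    · refine iff_of_true (by omega) ?_
      by_contra hx'
      have := w.injective (hw (w x) (by omega))
      rw [this] at hx'
      omega
  have := key (w.subtypePerm (fun x => (hw1 x).symm))
  rwa [Equiv.Perm.ofSubtype_subtypePerm _ (fun x hx => by
    by_contra hx'
    exact hx (hw x (by omega)))] at this

theorem rename_of_isTail {g : MvPolynomial (Fin n) 𝕜}
    (hg : ∀ p q : Fin n, q.val = p.val + 1 → k ≤ p.val → rename (Equiv.swap p q) g = g)
    {w : Equiv.Perm (Fin n)} (hw : IsTail k w) : rename w g = g := by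
  refine hw.induction (P := fun w => rename w g = g) (MvPolynomial.rename_id_apply g) ?_ hg
  intro v w hv hw
  rw [← rename_rename_swap, hw, hv]

/-- In terms of u = 1/v each factor is u_{σj}/(u_{σj} − u_{σi}). The denominators multiply to
sign(σ) times the Vandermonde determinant, the numerators to ∏ u_{σj}^j, so the sum is the Leibniz
expansion of the determinant divided by itself. -/
theorem sum_prod_vandermonde {K : Type*} [Field K] (m : ℕ) (v : Fin m → K)
    (hv : Function.Injective v) (h0 : ∀ i, v i ≠ 0) :
    ∑ σ : Equiv.Perm (Fin m), ∏ p ∈ Finset.univ.filter (fun p : Fin m × Fin m => p.1 < p.2),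
      1 / (1 - v (σ p.2) / v (σ p.1)) = 1 := by
  let u : Fin m → K := fun i => (v i)⁻¹
  have hu : Function.Injective u := inv_injective.comp hv
  have hdet : (Matrix.vandermonde u).det ≠ 0 := Matrix.det_vandermonde_ne_zero_iff.2 hu
  have hpairs : ∀ f : Fin m → Fin m → K,
      ∏ p ∈ Finset.univ.filter (fun p : Fin m × Fin m => p.1 < p.2), f p.1 p.2 =
        ∏ i, ∏ j ∈ Finset.Ioi i, f i j := by
    intro f
    rw [Finset.prod_filter, Fintype.prod_prod_type]
    refine Finset.prod_congr rfl fun i _ => ?_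
    rw [← Finset.prod_filter]
    refine Finset.prod_congr ?_ fun _ _ => rfl
    ext j
    simp
  have hσ : ∀ σ : Equiv.Perm (Fin m),
      ∏ p ∈ Finset.univ.filter (fun p : Fin m × Fin m => p.1 < p.2),
        1 / (1 - v (σ p.2) / v (σ p.1)) =
      (((Equiv.Perm.sign σ : ℤ) : K) * ∏ j, u (σ j) ^ (j : ℕ)) / (Matrix.vandermonde u).det := by
    intro σ
    have h1 : ∏ p ∈ Finset.univ.filter (fun p : Fin m × Fin m => p.1 < p.2),
        (u (σ p.2) - u (σ p.1)) = ((Equiv.Perm.sign σ : ℤ) : K) * (Matrix.vandermonde u).det := by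
      rw [hpairs (fun i j => u (σ j) - u (σ i)), ← Matrix.det_permute]
      exact (Matrix.det_vandermonde (u ∘ σ)).symm
    have h2 : ∏ p ∈ Finset.univ.filter (fun p : Fin m × Fin m => p.1 < p.2), u (σ p.2) =
        ∏ j, u (σ j) ^ (j : ℕ) := by
      rw [Finset.prod_filter, Fintype.prod_prod_type_right]
      refine Finset.prod_congr rfl fun j _ => ?_
      rw [← Finset.prod_filter]
      refine (Finset.prod_const (u (σ j))).trans ?_
      congr 1
      rw [show Finset.univ.filter (fun x : Fin m => x < j) = Finset.Iio j by ext; simp, Fin.card_Iio]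
    have h3 : ∀ p ∈ Finset.univ.filter (fun p : Fin m × Fin m => p.1 < p.2),
        1 / (1 - v (σ p.2) / v (σ p.1)) = u (σ p.2) / (u (σ p.2) - u (σ p.1)) := by
      intro p hp
      have hne : σ p.2 ≠ σ p.1 := fun h' => (Finset.mem_filter.1 hp).2.ne' (σ.injective h')
      have a := h0 (σ p.2)
      have b := h0 (σ p.1)
      have c : v (σ p.1) - v (σ p.2) ≠ 0 := sub_ne_zero.2 fun h' => hne (hv h').symm
      have d : 1 - v (σ p.2) / v (σ p.1) ≠ 0 := by
        rw [one_sub_div b]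
        exact div_ne_zero c b
      have e : (v (σ p.2))⁻¹ - (v (σ p.1))⁻¹ ≠ 0 := by
        rw [inv_sub_inv a b]
        exact div_ne_zero c (mul_ne_zero a b)
      simp only [u]
      rw [div_eq_div_iff d e]
      field_simp
    rw [Finset.prod_congr rfl h3, Finset.prod_div_distrib, h1, h2]
    have hs : ((Equiv.Perm.sign σ : ℤ) : K) * ((Equiv.Perm.sign σ : ℤ) : K) = 1 := by
      rw [← Int.cast_mul, ← Units.val_mul, Int.units_mul_self]
      simp
    have hs0 : ((Equiv.Perm.sign σ : ℤ) : K) ≠ 0 := left_ne_zero_of_mul_eq_one hs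
    rw [div_eq_div_iff (mul_ne_zero hs0 hdet) hdet]
    linear_combination (-(∏ j, u (σ j) ^ (j : ℕ)) * (Matrix.vandermonde u).det) * hs
  rw [Finset.sum_congr rfl fun σ _ => hσ σ, ← Finset.sum_div, div_eq_one_iff_eq hdet,
    Matrix.det_apply']
  rfl

/-- The partial Weyl symmetrizer with values in rational functions. -/
def weylRat (k n : ℕ) (f : MvPolynomial (Fin n) 𝕜) : RatFun 𝕜 n :=
  ∑ w ∈ Finset.univ.filter
      (fun w : Equiv.Perm (Fin n) => ∀ i : Fin n, i.val < k → w i = i),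
    toRat (rename w f) *
      ∏ p ∈ Finset.univ.filter (fun p : Fin n × Fin n => k ≤ p.1.val ∧ p.1 < p.2),
        1 / (1 - toRat (X (w p.2)) / toRat (X (w p.1)))

theorem weylSymm_eq (f : MvPolynomial (Fin n) 𝕜) : weylSymm k n f = ofRat (weylRat k n f) := rfl

theorem toRat_X_ne_zero (i : Fin n) : toRat (X i : MvPolynomial (Fin n) 𝕜) ≠ 0 := fun h' =>
  MvPolynomial.X_ne_zero i (toRat_injective (h'.trans (map_zero (algebraMap _ _)).symm))

theorem toRat_X_injective :
    Function.Injective (fun i : Fin n => toRat (X i : MvPolynomial (Fin n) 𝕜)) :=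
  toRat_injective.comp MvPolynomial.X_injective

/-- Permutations fixing the first k places are permutations of the remaining n − k, so this is
`sum_prod_vandermonde` in the last variables. -/
theorem sum_weyl_one (k n : ℕ) : ∑ w ∈ Finset.univ.filter
      (fun w : Equiv.Perm (Fin n) => ∀ i : Fin n, i.val < k → w i = i),
      ∏ p ∈ Finset.univ.filter (fun p : Fin n × Fin n => k ≤ p.1.val ∧ p.1 < p.2),
        1 / (1 - toRat (X (w p.2) : MvPolynomial (Fin n) 𝕜) / toRat (X (w p.1))) = 1 := by
  classical
  let e : Fin (n - k) ≃ {i : Fin n // k ≤ i.val} :=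
    { toFun := fun i => ⟨⟨k + i.val, by omega⟩, Nat.le_add_right _ _⟩
      invFun := fun i => ⟨i.1.val - k, by have := i.1.2; have := i.2; omega⟩
      left_inv := fun i => by simp
      right_inv := fun i => by
        apply Subtype.ext
        apply Fin.ext
        have := i.2
        simp only
        omega }
  refine Eq.trans ?_ (sum_prod_vandermonde (n - k)
    (fun i => toRat (X (e i).1 : MvPolynomial (Fin n) 𝕜))
    (toRat_X_injective.comp (Subtype.val_injective.comp e.injective))
    (fun i => toRat_X_ne_zero _))
  symm
  refine Finset.sum_bij (fun σ _ => σ.extendDomain e) ?_ ?_ ?_ ?_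
  · intro σ _
    rw [Finset.mem_filter]
    refine ⟨Finset.mem_univ _, fun i hi => ?_⟩
    exact Equiv.Perm.extendDomain_apply_not_subtype _ _ (by omega)
  · intro σ _ σ' _ h1
    exact Equiv.Perm.extendDomainHom_injective e h1
  · intro w hw
    have hw : IsTail k w := (Finset.mem_filter.1 hw).2
    have hw1 : ∀ x, k ≤ x.val ↔ k ≤ (w x).val := by
      intro x
      by_cases hx : x.val < k
      · rw [hw x hx]
      · refine iff_of_true (by omega) ?_
        by_contra hx'
        have := w.injective (hw (w x) (by omega))
        rw [this] at hx'
        omega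
    refine ⟨e.symm.permCongr (w.subtypePerm (fun x => (hw1 x).symm)), Finset.mem_univ _, ?_⟩
    refine Equiv.ext fun i => ?_
    by_cases hi : k ≤ i.val
    · rw [Equiv.Perm.extendDomain_apply_subtype _ e hi]
      simp [Equiv.permCongr_apply]
    · rw [Equiv.Perm.extendDomain_apply_not_subtype _ e hi, hw i (by omega)]
  · intro σ _
    refine Finset.prod_bij (fun p _ => ((e p.1).1, (e p.2).1)) ?_ ?_ ?_ ?_
    · intro p hp
      rw [Finset.mem_filter] at hp ⊢
      refine ⟨Finset.mem_univ _, (e p.1).2, ?_⟩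
      have := hp.2
      simp only [e, Fin.lt_def, Equiv.coe_fn_mk] at this ⊢
      omega
    · intro p _ p' _ h1
      rw [Prod.ext_iff] at h1 ⊢
      exact ⟨e.injective (Subtype.ext h1.1), e.injective (Subtype.ext h1.2)⟩
    · rintro ⟨i, j⟩ hp
      rw [Finset.mem_filter] at hp
      obtain ⟨-, h1, h2⟩ := hp
      simp only [Fin.lt_def] at h1 h2
      refine ⟨(e.symm ⟨i, h1⟩, e.symm ⟨j, by omega⟩), ?_, by simp⟩
      rw [Finset.mem_filter]
      refine ⟨Finset.mem_univ _, ?_⟩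
      simp only [e, Equiv.coe_fn_symm_mk, Fin.lt_def]
      omega
    · intro p _
      simp only [Equiv.Perm.extendDomain_apply_image]

theorem weylRat_of_symm {g : MvPolynomial (Fin n) 𝕜}
    (hg : ∀ p q : Fin n, q.val = p.val + 1 → k ≤ p.val → rename (Equiv.swap p q) g = g) :
    weylRat k n g = toRat g := by
  have h1 := sum_weyl_one (𝕜 := 𝕜) k n
  rw [← mul_one (toRat g), ← h1, Finset.mul_sum]
  refine Finset.sum_congr rfl fun w hw => ?_
  rw [rename_of_isTail hg (Finset.mem_filter.1 hw).2]

theorem weylSymm_of_weylRat_eq {f g : MvPolynomial (Fin n) 𝕜} (h : weylRat k n f = toRat g) :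
    weylSymm k n f = g := by rw [weylSymm_eq, h, ofRat_toRat]

end Weyl

end AlmostSym

namespace AlmostSym

open MvPolynomial (X rename)

/-! ### The Weyl symmetrizer absorbs divided differences and commutes with restriction -/

section WeylIsobaric

variable {n : ℕ} {p q : Fin n} {k : ℕ} {𝕜 : Type*} [Field 𝕜]

theorem isobaric_of_symm (hpq : p ≠ q) {g : MvPolynomial (Fin n) 𝕜}
    (hg : rename (Equiv.swap p q) g = g) : isobaric p q g = g := by
  apply mul_left_cancel₀ (X_sub_ne p q hpq)
  rw [sub_mul_isobaric p q hpq, hg]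
  ring

theorem symm_iff_isobaric (hpq : p ≠ q) (g : MvPolynomial (Fin n) 𝕜) :
    rename (Equiv.swap p q) g = g ↔ isobaric p q g = g :=
  ⟨isobaric_of_symm hpq, fun h => by rw [← h, rename_isobaric p q hpq]⟩

/-- Add the terms of w and w s, where s swaps p and q. The factors other than the one for (p, q) are
permuted by s, and the two remaining factors x_p/(x_p − x_q) and −x_q/(x_p − x_q) combine f and s f
into the isobaric divided difference of f. -/
theorem two_mul_weylRat (hpq : q.val = p.val + 1) (hk : k ≤ p.val) (f : MvPolynomial (Fin n) 𝕜) :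
    2 * weylRat k n f = ∑ w ∈ Finset.univ.filter
      (fun w : Equiv.Perm (Fin n) => ∀ i : Fin n, i.val < k → w i = i),
    toRat (rename w (isobaric p q f)) *
      ∏ u ∈ (Finset.univ.filter (fun u : Fin n × Fin n => k ≤ u.1.val ∧ u.1 < u.2)).erase (p, q),
        1 / (1 - toRat (X (w u.2)) / toRat (X (w u.1))) := by
  have hlt : p < q := (consec_of_succ hpq).1
  have hs : IsTail k (Equiv.swap p q) := isTail_swap hk (by omega)
  have hmem : (p, q) ∈ Finset.univ.filter (fun u : Fin n × Fin n => k ≤ u.1.val ∧ u.1 < u.2) := by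
    simp [hk, hlt]
  have hre : weylRat k n f = ∑ w ∈ Finset.univ.filter
      (fun w : Equiv.Perm (Fin n) => ∀ i : Fin n, i.val < k → w i = i),
      toRat (rename (w * Equiv.swap p q) f) *
      ∏ u ∈ Finset.univ.filter (fun u : Fin n × Fin n => k ≤ u.1.val ∧ u.1 < u.2),
        1 / (1 - toRat (X ((w * Equiv.swap p q) u.2)) / toRat (X ((w * Equiv.swap p q) u.1))) := by
    rw [weylRat]
    refine Finset.sum_nbij' (fun w => w * Equiv.swap p q) (fun w => w * Equiv.swap p q) ?_ ?_ ?_ ?_ ?_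
    · intro w hw
      rw [Finset.mem_filter] at hw ⊢
      exact ⟨Finset.mem_univ _, IsTail.mul hw.2 hs⟩
    · intro w hw
      rw [Finset.mem_filter] at hw ⊢
      exact ⟨Finset.mem_univ _, IsTail.mul hw.2 hs⟩
    · intro w _
      rw [mul_assoc, Equiv.swap_mul_self, mul_one]
    · intro w _
      rw [mul_assoc, Equiv.swap_mul_self, mul_one]
    · intro w _
      rw [mul_assoc, Equiv.swap_mul_self, mul_one]
  rw [two_mul]
  nth_rewrite 2 [hre]
  rw [weylRat, ← Finset.sum_add_distrib]
  refine Finset.sum_congr rfl fun w _ => ?_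
  rw [← Finset.mul_prod_erase _ _ hmem, ← Finset.mul_prod_erase _ _ hmem]
  have hQ : ∏ u ∈ (Finset.univ.filter
        (fun u : Fin n × Fin n => k ≤ u.1.val ∧ u.1 < u.2)).erase (p, q),
        1 / (1 - toRat (X ((w * Equiv.swap p q) u.2) : MvPolynomial (Fin n) 𝕜) /
          toRat (X ((w * Equiv.swap p q) u.1))) =
      ∏ u ∈ (Finset.univ.filter
        (fun u : Fin n × Fin n => k ≤ u.1.val ∧ u.1 < u.2)).erase (p, q),
        1 / (1 - toRat (X (w u.2) : MvPolynomial (Fin n) 𝕜) / toRat (X (w u.1))) := by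
    have hm : ∀ u ∈ (Finset.univ.filter
        (fun u : Fin n × Fin n => k ≤ u.1.val ∧ u.1 < u.2)).erase (p, q),
        (Equiv.swap p q u.1, Equiv.swap p q u.2) ∈ (Finset.univ.filter
        (fun u : Fin n × Fin n => k ≤ u.1.val ∧ u.1 < u.2)).erase (p, q) := by
      rintro ⟨i, j⟩ hu
      simp only [Finset.mem_erase, Finset.mem_filter, Finset.mem_univ, true_and, ne_eq,
        Prod.mk.injEq, Equiv.swap_apply_def, Fin.lt_def, Fin.ext_iff] at hu ⊢
      grind
    refine Finset.prod_nbij' (fun u => (Equiv.swap p q u.1, Equiv.swap p q u.2))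
      (fun u => (Equiv.swap p q u.1, Equiv.swap p q u.2)) hm hm ?_ ?_ ?_
    · intro u _
      simp
    · intro u _
      simp
    · intro u _
      simp
  rw [hQ]
  simp only [Equiv.Perm.mul_apply, Equiv.swap_apply_left, Equiv.swap_apply_right]
  have hiso := congrArg (fun g => toRat (rename w g)) (sub_mul_isobaric p q hlt.ne f)
  simp only [map_mul, map_sub, MvPolynomial.rename_X, rename_rename_swap, toRat] at hiso
  have ha : toRat (X (w p) : MvPolynomial (Fin n) 𝕜) ≠ 0 := toRat_X_ne_zero _
  have hb : toRat (X (w q) : MvPolynomial (Fin n) 𝕜) ≠ 0 := toRat_X_ne_zero _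
  have hab : toRat (X (w p) : MvPolynomial (Fin n) 𝕜) - toRat (X (w q)) ≠ 0 :=
    sub_ne_zero.2 fun h' => hlt.ne (w.injective (toRat_X_injective h'))
  have e1 : 1 / (1 - toRat (X (w q) : MvPolynomial (Fin n) 𝕜) / toRat (X (w p))) =
      toRat (X (w p)) / (toRat (X (w p)) - toRat (X (w q))) := by
    rw [one_sub_div ha, one_div_div]
  have e2 : 1 / (1 - toRat (X (w p) : MvPolynomial (Fin n) 𝕜) / toRat (X (w q))) =
      -(toRat (X (w q)) / (toRat (X (w p)) - toRat (X (w q)))) := by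
    rw [one_sub_div hb, one_div_div, ← neg_sub, div_neg]
  rw [e1, e2]
  rw [← mul_assoc, ← mul_assoc, ← add_mul]
  congr 1
  unfold toRat at *
  rw [mul_div_assoc', mul_neg, mul_div_assoc', ← sub_eq_add_neg, ← sub_div, div_eq_iff hab]
  linear_combination -hiso

/-- By `two_mul_weylRat` twice the symmetrizer depends only on the divided difference of f, which is
unchanged when applied again. Characteristic zero is needed to cancel the 2. -/
theorem weylRat_isobaric [CharZero 𝕜] (hpq : q.val = p.val + 1) (hk : k ≤ p.val)
    (f : MvPolynomial (Fin n) 𝕜) : weylRat k n (isobaric p q f) = weylRat k n f := by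
  have hne : p ≠ q := (consec_of_succ hpq).1.ne
  have h1 := two_mul_weylRat hpq hk f
  have h2 := two_mul_weylRat hpq hk (isobaric p q f)
  rw [isobaric_of_symm hne (rename_isobaric p q hne f), ← h1] at h2
  have : CharZero (RatFun 𝕜 n) := charZero_of_injective_algebraMap
    (IsFractionRing.injective (MvPolynomial (Fin n) 𝕜) (RatFun 𝕜 n))
  exact mul_left_cancel₀ two_ne_zero h2

/-- `g` is obtained from `f` by isobaric divided differences in the variables after the `k`-th. -/
def Reach (k : ℕ) : MvPolynomial (Fin n) 𝕜 → MvPolynomial (Fin n) 𝕜 → Prop :=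
  Relation.ReflTransGen fun f g => ∃ p q : Fin n, q.val = p.val + 1 ∧ k ≤ p.val ∧ g = isobaric p q f

/-- `g` is symmetric in the variables after the `k`-th. -/
def TailSymm (k : ℕ) (g : MvPolynomial (Fin n) 𝕜) : Prop :=
  ∀ p q : Fin n, q.val = p.val + 1 → k ≤ p.val → rename (Equiv.swap p q) g = g

theorem Reach.weylRat_eq [CharZero 𝕜] {f g : MvPolynomial (Fin n) 𝕜} (h : Reach k f g) :
    weylRat k n f = weylRat k n g := by
  induction h with
  | refl => rfl
  | tail _ h2 ih =>
    obtain ⟨p, q, h3, h4, rfl⟩ := h2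
    rw [weylRat_isobaric h3 h4, ih]

theorem Reach.weylSymm_eq [CharZero 𝕜] {f g : MvPolynomial (Fin n) 𝕜} (h : Reach k f g)
    (hg : TailSymm k g) : weylSymm k n f = g :=
  weylSymm_of_weylRat_eq (h.weylRat_eq.trans (weylRat_of_symm hg))

theorem isobaric_symm_of_comm {r s : Fin n} (hpq : q.val = p.val + 1) (hrs : s.val = r.val + 1)
    (hd : q < r ∨ s < p) {g : MvPolynomial (Fin n) 𝕜} (hg : rename (Equiv.swap p q) g = g) :
    rename (Equiv.swap p q) (isobaric r s g) = isobaric r s g := by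
  have n1 : p ≠ q := (consec_of_succ hpq).1.ne
  have n2 : r ≠ s := (consec_of_succ hrs).1.ne
  simp only [Fin.lt_def] at hd
  rw [symm_iff_isobaric n1] at hg ⊢
  rw [isobaric_comm p q r s n1 n2 (by rw [Ne, Fin.ext_iff]; omega) (by rw [Ne, Fin.ext_iff]; omega)
    (by rw [Ne, Fin.ext_iff]; omega) (by rw [Ne, Fin.ext_iff]; omega), hg]

/-- To extend symmetry by one variable, apply the divided differences at (t, t+1), (t−1, t), …, (k,
k+1) in this order. -/
theorem exists_reach_step (t : ℕ) (ht : t + 1 < n) (hkt : k ≤ t) (f : MvPolynomial (Fin n) 𝕜)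
    (hf : ∀ p q : Fin n, q.val = p.val + 1 → k ≤ p.val → q.val ≤ t →
      rename (Equiv.swap p q) f = f) :
    ∃ g, Reach k f g ∧ ∀ p q : Fin n, q.val = p.val + 1 → k ≤ p.val → q.val ≤ t + 1 →
      rename (Equiv.swap p q) g = g := by
  -- After d of them the polynomial is symmetric from position t + 1 − d to t + 1 and still
  -- symmetric in the positions k, …, t − d. The previous polynomial f' is remembered for the braid
  -- relation.
  have key : ∀ d, d ≤ t + 1 - k → ∃ g, Reach k f g ∧
      (∀ p q : Fin n, q.val = p.val + 1 → t + 1 - d ≤ p.val → q.val ≤ t + 1 →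
        rename (Equiv.swap p q) g = g) ∧
      (∀ p q : Fin n, q.val = p.val + 1 → k ≤ p.val → q.val < t + 1 - d →
        rename (Equiv.swap p q) g = g) ∧
      (1 ≤ d → ∃ f', (∀ p q : Fin n, q.val = p.val + 1 → t + 1 - d = p.val → g = isobaric p q f') ∧
        ∀ p q : Fin n, q.val = p.val + 1 → k ≤ p.val → q.val = t + 1 - d →
          rename (Equiv.swap p q) f' = f') := by
    intro d
    induction d with
    | zero =>
      intro _
      refine ⟨f, .refl, fun p q h1 h2 h3 => by omega, fun p q h1 h2 h3 => hf p q h1 h2 (by omega),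
        fun h => absurd h (by omega)⟩
    | succ d ih =>
      intro hd
      obtain ⟨g, h1, h2, h3, h4⟩ := ih (by omega)
      let r : Fin n := ⟨t - d, by omega⟩
      let s : Fin n := ⟨t - d + 1, by omega⟩
      have hrs : s.val = r.val + 1 := rfl
      have hr : r.val = t - d := rfl
      have hne : r ≠ s := (consec_of_succ hrs).1.ne
      refine ⟨isobaric r s g, h1.tail ⟨r, s, hrs, by omega, rfl⟩, ?_, ?_, fun _ => ⟨g, ?_, ?_⟩⟩
      · intro p q e1 e2 e3
        rcases Nat.lt_or_ge (t - d + 1) p.val with e4 | e4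
        · exact isobaric_symm_of_comm e1 hrs (Or.inr (by rw [Fin.lt_def]; omega))
            (h2 p q e1 (by omega) e3)
        rcases Nat.lt_or_ge (t - d) p.val with e5 | e5
        · obtain rfl : p = s := Fin.ext (by omega)
          obtain ⟨f', a, b⟩ := h4 (by omega)
          have n1 : s ≠ q := (consec_of_succ e1).1.ne
          have n2 : r ≠ q := by rw [Ne, Fin.ext_iff]; omega
          rw [a s q e1 (by omega)]
          -- As f' is fixed by the divided difference at (r, s), it may be inserted; the braid
          -- relation then puts the one at (s, q) outermost, which makes the result symmetric in s
          -- and q.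
          have hsym := isobaric_of_symm hne (b r s hrs (by omega) (by omega))
          nth_rewrite 1 [← hsym]
          rw [isobaric_braid r s q hne n1 n2, rename_isobaric s q n1, ← isobaric_braid r s q hne n1 n2,
            hsym]
        · obtain rfl : p = r := Fin.ext (by omega)
          obtain rfl : q = s := Fin.ext (by omega)
          exact rename_isobaric _ _ hne g
      · intro p q e1 e2 e3
        exact isobaric_symm_of_comm e1 hrs (Or.inl (by rw [Fin.lt_def]; omega))
          (h3 p q e1 e2 (by omega))
      · intro p q e1 e2
        obtain rfl : p = r := Fin.ext (by omega)
        obtain rfl : q = s := Fin.ext (by omega)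
        rfl
      · intro p q e1 e2 e3
        exact h3 p q e1 e2 (by omega)
  obtain ⟨g, h1, h2, -, -⟩ := key (t + 1 - k) le_rfl
  exact ⟨g, h1, fun p q e1 e2 e3 => h2 p q e1 (by omega) e3⟩

/-- With `Reach.weylSymm_eq` this computes the symmetrizer as a composite of divided differences; in
particular its values are polynomials. -/
theorem exists_reach (k : ℕ) (f : MvPolynomial (Fin n) 𝕜) : ∃ g, Reach k f g ∧ TailSymm k g := by
  have key : ∀ m, k + m < n → ∃ g, Reach k f g ∧ ∀ p q : Fin n, q.val = p.val + 1 → k ≤ p.val →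
      q.val ≤ k + m → rename (Equiv.swap p q) g = g := by
    intro m
    induction m with
    | zero => exact fun _ => ⟨f, .refl, fun p q h1 h2 h3 => by omega⟩
    | succ m ih =>
      intro hm
      obtain ⟨g, h1, h2⟩ := ih (by omega)
      obtain ⟨g', h3, h4⟩ := exists_reach_step (k + m) (by omega) (by omega) g h2
      exact ⟨g', h1.trans h3, h4⟩
  rcases Nat.lt_or_ge k n with hk | hk
  · obtain ⟨g, h1, h2⟩ := key (n - 1 - k) (by omega)
    exact ⟨g, h1, fun p q e1 e2 => h2 p q e1 e2 (by omega)⟩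
  · exact ⟨f, .refl, fun p q e1 e2 => by omega⟩

/-- Setting the last variable to zero. -/
def res (n : ℕ) : MvPolynomial (Fin (n + 1)) 𝕜 →ₐ[𝕜] MvPolynomial (Fin n) 𝕜 :=
  MvPolynomial.aeval fun i => if h : i.val < n then X ⟨i.val, h⟩ else 0

theorem res_X_of_lt {i : Fin (n + 1)} (h : i.val < n) :
    res n (X i : MvPolynomial (Fin (n + 1)) 𝕜) = X ⟨i.val, h⟩ := by simp [res, h]

theorem res_X_of_not_lt {i : Fin (n + 1)} (h : ¬ i.val < n) :
    res n (X i : MvPolynomial (Fin (n + 1)) 𝕜) = 0 := by simp [res, h]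

theorem res_rename_swap {p q : Fin (n + 1)} (hp : p.val < n) (hq : q.val < n)
    (f : MvPolynomial (Fin (n + 1)) 𝕜) : res n (rename (Equiv.swap p q) f) =
      rename (Equiv.swap (⟨p.val, hp⟩ : Fin n) ⟨q.val, hq⟩) (res n f) := by
  have : (res n).comp (rename (Equiv.swap p q)) =
      (rename (Equiv.swap (⟨p.val, hp⟩ : Fin n) ⟨q.val, hq⟩)).comp (res (𝕜 := 𝕜) n) := by
    refine MvPolynomial.algHom_ext fun i => ?_
    simp only [AlgHom.comp_apply, MvPolynomial.rename_X]
    by_cases h1 : i = p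
    · subst h1
      rw [Equiv.swap_apply_left, res_X_of_lt hq, res_X_of_lt hp, MvPolynomial.rename_X,
        Equiv.swap_apply_left]
    by_cases h2 : i = q
    · subst h2
      rw [Equiv.swap_apply_right, res_X_of_lt hq, res_X_of_lt hp, MvPolynomial.rename_X,
        Equiv.swap_apply_right]
    rw [Equiv.swap_apply_of_ne_of_ne h1 h2]
    by_cases h3 : i.val < n
    · rw [res_X_of_lt h3, MvPolynomial.rename_X, Equiv.swap_apply_of_ne_of_ne]
      · exact fun h4 => h1 (Fin.ext (Fin.mk.inj h4))
      · exact fun h4 => h2 (Fin.ext (Fin.mk.inj h4))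
    · rw [res_X_of_not_lt h3, map_zero]
  exact DFunLike.congr_fun this f

/-- Divided differences not involving the last variable commute with setting it to zero. The one
involving it becomes the identity, since (x_p f − 0)/(x_p − 0) = f. -/
theorem Reach.res {f g : MvPolynomial (Fin (n + 1)) 𝕜} (h : Reach k f g) :
    Reach k (res n f) (res n g) := by
  induction h with
  | refl => exact .refl
  | @tail b c _ h2 ih =>
    obtain ⟨p, q, h3, h4, rfl⟩ := h2
    have hne : p ≠ q := (consec_of_succ h3).1.ne
    have e := congrArg (AlmostSym.res n) (sub_mul_isobaric p q hne b)
    have hp : p.val < n := by have := q.2; omega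
    simp only [map_mul, map_sub] at e
    by_cases hq : q.val < n
    · refine ih.tail ⟨⟨p.val, hp⟩, ⟨q.val, hq⟩, h3, h4, ?_⟩
      have hne' : (⟨p.val, hp⟩ : Fin n) ≠ ⟨q.val, hq⟩ := by
        rw [Ne, Fin.ext_iff]; simp only; omega
      apply mul_left_cancel₀ (X_sub_ne (𝕜 := 𝕜) _ _ hne')
      rw [sub_mul_isobaric _ _ hne', ← res_rename_swap hp hq, ← res_X_of_lt hp, ← res_X_of_lt hq, e]
    · rw [res_X_of_not_lt hq, sub_zero, zero_mul, sub_zero, res_X_of_lt hp] at e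
      rw [mul_left_cancel₀ (MvPolynomial.X_ne_zero _) e]
      exact ih

theorem TailSymm.res {g : MvPolynomial (Fin (n + 1)) 𝕜} (h : TailSymm k g) :
    TailSymm k (res n g) := by
  intro p q h1 h2
  have := h ⟨p.val, by omega⟩ ⟨q.val, by omega⟩ h1 h2
  have h3 := res_rename_swap (n := n) (p := ⟨p.val, by omega⟩) (q := ⟨q.val, by omega⟩) p.2 q.2 g
  rw [this] at h3
  exact h3.symm

/-- A chain of divided differences leading to a symmetric polynomial restricts to such a chain. -/
theorem res_weylSymm [CharZero 𝕜] (k n : ℕ) (f : MvPolynomial (Fin (n + 1)) 𝕜) :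
    res n (weylSymm k (n + 1) f) = weylSymm k n (res n f) := by
  obtain ⟨g, h1, h2⟩ := exists_reach k f
  rw [h1.weylSymm_eq h2, h1.res.weylSymm_eq h2.res]

end WeylIsobaric

end AlmostSym

namespace AlmostSym
open MvPolynomial (X rename)

/-! ### Key polynomials under symmetrization, and almost symmetric Schur functions -/

section SchurKey

variable {n : ℕ} {p q : Fin n} {k : ℕ} {𝕜 : Type*} [Field 𝕜]

theorem weylRat_keyPoly_swap_of_lt [CharZero 𝕜] (hpq : q.val = p.val + 1) (hk : k ≤ p.val)
    {a : Fin n → ℕ} (h : a q < a p) :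
    weylRat k n (keyPoly (𝕜 := 𝕜) (a ∘ Equiv.swap p q)) = weylRat k n (keyPoly a) := by
  rw [isKeyFamily_keyPoly.2 a p q hpq h, weylRat_isobaric hpq hk]

theorem weylRat_keyPoly_swap [CharZero 𝕜] (hpq : q.val = p.val + 1) (hk : k ≤ p.val)
    (a : Fin n → ℕ) :
    weylRat k n (keyPoly (𝕜 := 𝕜) (a ∘ Equiv.swap p q)) = weylRat k n (keyPoly a) := by
  rcases lt_trichotomy (a q) (a p) with h | h | h
  · exact weylRat_keyPoly_swap_of_lt hpq hk h
  · congr 2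
    funext i
    simp only [Function.comp, Equiv.swap_apply_def]
    grind
  · have := weylRat_keyPoly_swap_of_lt (𝕜 := 𝕜) hpq hk (a := a ∘ Equiv.swap p q) (by simpa using h)
    rw [← this]
    congr 2
    funext i
    simp

/-- Swapping unequal adjacent entries after the k-th applies or undoes a divided difference, which
the symmetrizer absorbs; these swaps generate. -/
theorem weylRat_keyPoly_comp [CharZero 𝕜] {w : Equiv.Perm (Fin n)} (hw : IsTail k w)
    (a : Fin n → ℕ) : weylRat k n (keyPoly (𝕜 := 𝕜) (a ∘ w)) = weylRat k n (keyPoly a) := by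
  refine hw.induction (P := fun w => ∀ a : Fin n → ℕ,
    weylRat k n (keyPoly (𝕜 := 𝕜) (a ∘ w)) = weylRat k n (keyPoly a)) (fun a => rfl) ?_
    (fun p q h1 h2 a => weylRat_keyPoly_swap h1 h2 a) a
  intro v w hv hw a
  have e : a ∘ (v * w : Equiv.Perm (Fin n)) = (a ∘ v) ∘ w := rfl
  rw [e, hw, hv]

theorem tailSymm_keyPoly {a : Fin n → ℕ}
    (h : ∀ p q : Fin n, q.val = p.val + 1 → k ≤ p.val → a p ≤ a q) :
    TailSymm k (keyPoly (𝕜 := 𝕜) a) := fun p q h1 h2 => by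
  rw [keyPoly_eq_bodySum, rename_bodySum 𝕜 h1 (h p q h1 h2)]

/-- The rearrangement with increasing tail has the same symmetrization, and its key polynomial is
already symmetric there by `rename_bodySum`. -/
theorem weylSymm_keyPoly [CharZero 𝕜] {w : Equiv.Perm (Fin n)} (hw : IsTail k w)
    {a : Fin n → ℕ} (h : ∀ p q : Fin n, q.val = p.val + 1 → k ≤ p.val → a (w p) ≤ a (w q)) :
    weylSymm k n (keyPoly (𝕜 := 𝕜) a) = keyPoly (a ∘ w) :=
  weylSymm_of_weylRat_eq ((weylRat_keyPoly_comp hw a).symm.trans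
    (weylRat_of_symm (tailSymm_keyPoly h)))

theorem rename_castLE_isobaric {m : ℕ} (hmn : m ≤ n) {p q : Fin m} (hpq : p ≠ q)
    (f : MvPolynomial (Fin m) 𝕜) : rename (Fin.castLE hmn) (isobaric p q f) =
      isobaric (Fin.castLE hmn p) (Fin.castLE hmn q) (rename (Fin.castLE hmn) f) := by
  have hne : Fin.castLE hmn p ≠ Fin.castLE hmn q := fun h => hpq (Fin.castLE_injective hmn h)
  have e := congrArg (rename (Fin.castLE hmn)) (sub_mul_isobaric p q hpq f)
  simp only [map_mul, map_sub, MvPolynomial.rename_X] at e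
  apply mul_left_cancel₀ (X_sub_ne (𝕜 := 𝕜) _ _ hne)
  rw [e, sub_mul_isobaric _ _ hne, MvPolynomial.rename_rename, MvPolynomial.rename_rename]
  congr 4
  funext i
  exact (Fin.castLE_injective hmn).map_swap p q i

/-- Key polynomials are stable under padding by zeros. -/
theorem rename_castLE_keyPoly {m : ℕ} (hmn : m ≤ n) (f : ℕ → ℕ) (hf : ∀ i, m ≤ i → f i = 0) :
    rename (Fin.castLE hmn) (keyPoly (𝕜 := 𝕜) fun i : Fin m => f i.val) =
      keyPoly fun i : Fin n => f i.val := by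
  induction hw : ∑ i : Fin m, i.val * f i.val using Nat.strong_induction_on generalizing f with
  | _ w ih =>
  subst hw
  by_cases hex : ∃ p q : Fin m, q.val = p.val + 1 ∧ f p < f q
  · obtain ⟨p, q, hpq, h⟩ := hex
    have e1 : ∀ {l : ℕ} (p' q' : Fin l), p'.val = p.val → q'.val = q.val →
        (fun i : Fin l => f i.val) ∘ Equiv.swap p' q' =
          fun i : Fin l => (f ∘ Equiv.swap p.val q.val) i.val := by
      intro l p' q' h1 h2
      funext i
      simp only [Function.comp]
      rw [← h1, ← h2, ← Fin.val_injective.map_swap]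
    have hlt := weight_swap_lt (fun i : Fin m => f i.val) p q hpq h
    rw [e1 p q rfl rfl] at hlt
    have hne : p ≠ q := (consec_of_succ hpq).1.ne
    have hf' : ∀ i, m ≤ i → (f ∘ Equiv.swap p.val q.val) i = 0 := by
      intro i hi
      rw [Function.comp, Equiv.swap_apply_of_ne_of_ne (by omega) (by omega), hf i hi]
    rw [keyPoly_swap (fun i : Fin m => f i.val) p q hpq h, rename_castLE_isobaric hmn hne,
      e1 p q rfl rfl, ih _ hlt _ hf' rfl,
      keyPoly_swap (fun i : Fin n => f i.val) (Fin.castLE hmn p) (Fin.castLE hmn q) hpq h,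
      e1 (Fin.castLE hmn p) (Fin.castLE hmn q) rfl rfl]
  · push Not at hex
    have hs : ∀ i, f (i + 1) ≤ f i := by
      intro i
      by_cases hi : i + 1 < m
      · exact hex ⟨i, by omega⟩ ⟨i + 1, hi⟩ rfl
      · rw [hf (i + 1) (by omega)]
        exact Nat.zero_le _
    have ha : Antitone f := antitone_nat_of_succ_le hs
    rw [isKeyFamily_keyPoly.1 _ (fun i j h => ha h), isKeyFamily_keyPoly.1 _ (fun i j h => ha h),
      map_prod]
    simp only [map_pow, MvPolynomial.rename_X]
    rw [← Finset.prod_subset (Finset.subset_univ (Finset.univ.map (Fin.castLEEmb hmn)))]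
    · rw [Finset.prod_map]
      rfl
    · intro i _ hi
      rw [hf, pow_zero]
      by_contra h
      exact hi (Finset.mem_map.2 ⟨⟨i.val, by omega⟩, Finset.mem_univ _, Fin.ext rfl⟩)

theorem extend_of_le {m : ℕ} (hmn : m ≤ n) (f : MvPolynomial (Fin m) 𝕜) :
    extend f n = rename (Fin.castLE hmn) f := by
  rw [extend, MvPolynomial.rename_eq_aeval]
  congr 2
  funext i
  rw [dif_pos (by omega)]
  rfl

theorem res_extend {m : ℕ} (f : MvPolynomial (Fin m) 𝕜) (n : ℕ) :
    res n (extend f (n + 1)) = extend f n := by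
  unfold extend
  rw [← AlgHom.comp_apply]
  congr 1
  refine MvPolynomial.algHom_ext fun i => ?_
  rw [AlgHom.comp_apply, MvPolynomial.aeval_X, MvPolynomial.aeval_X]
  by_cases h1 : i.val < n
  · rw [dif_pos h1, dif_pos (by omega), res_X_of_lt h1]
  · rw [dif_neg h1]
    by_cases h2 : i.val < n + 1
    · rw [dif_pos h2, res_X_of_not_lt h1]
    · rw [dif_neg h2, map_zero]

theorem res_schurRec [CharZero 𝕜] (n : ℕ) (μ l : List ℕ) :
    res n (schurRec 𝕜 μ l (n + 1)) = schurRec 𝕜 μ l n := by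
  induction l generalizing μ with
  | nil => exact res_extend _ n
  | cons a l ih =>
    rw [schurRec, weylLim, weylLim, res_weylSymm, ih]

/-- The composition of length `n` obtained by inserting zeros between `μ` and `rev(l)`. -/
def padded (n : ℕ) (μ l : List ℕ) (i : ℕ) : ℕ :=
  (μ ++ List.replicate (n - μ.length - l.length) 0 ++ l.reverse).getD i 0

/-- The cyclic shift of the elements after the `k`-th. -/
theorem exists_rotation (hk : k < n) : ∃ w : Equiv.Perm (Fin n), IsTail k w ∧
    (∀ i : Fin n, k ≤ i.val → i.val + 1 < n → (w i).val = i.val + 1) ∧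
    ∀ i : Fin n, i.val + 1 = n → (w i).val = k := by
  let f : Fin n → Fin n := fun i =>
    if i.val < k then i else if h : i.val + 1 < n then ⟨i.val + 1, h⟩ else ⟨k, hk⟩
  have hf : Function.Injective f := by
    intro i j hij
    simp only [f] at hij
    ext
    split_ifs at hij <;> simp only [Fin.ext_iff] at hij <;> omega
  refine ⟨Equiv.ofBijective f (Finite.injective_iff_bijective.1 hf), ?_, ?_, ?_⟩
  · intro i hi
    simp [f, hi]
  · intro i h1 h2
    simp [f, show ¬ i.val < k by omega, h2]
  · intro i h1
    simp [f, show ¬ i.val < k by omega, h1]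

theorem schurRec_eq_keyPoly [CharZero 𝕜] (μ l : List ℕ) (hl : l.SortedGE)
    (hn : μ.length + l.length ≤ n) :
    schurRec 𝕜 μ l n = keyPoly fun i : Fin n => padded n μ l i.val := by
  induction l generalizing μ with
  | nil =>
    rw [schurRec, extend_of_le (by simpa using hn)]
    have e : ∀ i, padded n μ [] i = μ.getD i 0 := by
      intro i
      simp only [padded, List.reverse_nil, List.append_nil]
      rcases Nat.lt_or_ge i μ.length with h | h
      · rw [List.getD_append _ _ _ _ h]
      · rw [List.getD_append_right _ _ _ _ h, List.getD_eq_default μ _ h]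
        simp
    have := rename_castLE_keyPoly (𝕜 := 𝕜) (n := n) (by simpa using hn)
      (fun i => μ.getD i 0) (fun i hi => List.getD_eq_default μ _ hi)
    simp only [e]
    rw [← this]
    congr 2
    funext i
    simp
  | cons a l ih =>
    simp only [List.length_cons] at hn
    have hl' : l.SortedGE := (List.pairwise_cons.1 hl.pairwise).2.sortedGE
    have ha : ∀ b ∈ l, b ≤ a := (List.pairwise_cons.1 hl.pairwise).1
    obtain ⟨w, hw, h1, h2⟩ := exists_rotation (n := n) (k := μ.length) (by omega)
    set T := List.replicate (n - μ.length - (l.length + 1)) 0 ++ l.reverse with hT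
    have lT : T.length = n - μ.length - 1 := by simp [hT]; omega
    have hTs : (T ++ [a]).Pairwise (· ≤ ·) := by
      rw [hT]
      simp only [List.pairwise_append, List.pairwise_replicate, List.pairwise_reverse,
        List.mem_append, List.mem_replicate, List.mem_reverse, List.mem_singleton]
      refine ⟨⟨by simp, hl'.pairwise, fun b hb c _ => by omega⟩, List.pairwise_singleton _ _, ?_⟩
      rintro b (hb | hb) c rfl
      · omega
      · exact ha b hb
    have e1 : ∀ i, padded n (μ ++ [a]) l i = (μ ++ (a :: T)).getD i 0 := by
      intro i
      simp only [padded, hT, List.length_append, List.length_singleton]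
      rw [show n - (μ.length + 1) - l.length = n - μ.length - (l.length + 1) by omega]
      simp
    have e2 : ∀ i, padded n μ (a :: l) i = (μ ++ (T ++ [a])).getD i 0 := by
      intro i
      simp [padded, hT]
    -- The rotation turns (μ, a, 0, …, 0, rev l) into (μ, 0, …, 0, rev l, a), whose tail is
    -- increasing because a is at least every entry of l.
    have e3 : (fun i : Fin n => padded n μ (a :: l) i.val) =
        (fun i : Fin n => padded n (μ ++ [a]) l i.val) ∘ w := by
      funext i
      simp only [Function.comp, e1, e2]
      rcases Nat.lt_or_ge i.val μ.length with h | h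
      · rw [hw i h, List.getD_append _ _ _ _ h, List.getD_append _ _ _ _ h]
      · rcases Nat.lt_or_ge (i.val + 1) n with h' | h'
        · rw [h1 i h h', List.getD_append_right μ _ _ _ h,
            List.getD_append_right μ _ _ _ (by omega), List.getD_append _ _ _ _ (by omega),
            show i.val + 1 - μ.length = (i.val - μ.length) + 1 by omega, List.getD_cons_succ]
        · rw [h2 i (by omega), List.getD_append_right μ _ _ _ h,
            List.getD_append_right μ _ _ _ (by omega),
            List.getD_append_right T _ _ _ (by omega),
            show i.val - μ.length - T.length = 0 by omega, Nat.sub_self]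
          simp
    rw [schurRec, weylLim, ih _ hl' (by simp; omega), e3]
    refine weylSymm_keyPoly hw fun p q hpq hp => ?_
    have e4 := congrFun e3 p
    have e5 := congrFun e3 q
    simp only [Function.comp] at e4 e5
    rw [← e4, ← e5, e2, e2, List.getD_append_right μ _ _ _ hp,
      List.getD_append_right μ _ _ _ (by omega)]
    have lq : q.val - μ.length < (T ++ [a]).length := by simp; omega
    have lp : p.val - μ.length < (T ++ [a]).length := by simp; omega
    rw [List.getD_eq_getElem _ _ lp, List.getD_eq_getElem _ _ lq]
    exact List.pairwise_iff_getElem.1 hTs _ _ lp lq (by omega)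

theorem almostSchur_eq_bodySum [CharZero 𝕜] (s : SigmaPair)
    (hn : s.comp.length + s.part.length ≤ n) :
    almostSchur 𝕜 s n = bodySum 𝕜 fun i : Fin n => padded n s.comp s.part i.val := by
  rw [almostSchur, schurRec_eq_keyPoly _ _ s.part_partition.1 hn, keyPoly_eq_bodySum]

end SchurKey

end AlmostSym

namespace AlmostSym

/-! ### Labellings without coinversions -/

section Coinv

variable {γ : List ℕ} {τ : ℕ × ℕ → Ordinal.{0}}

theorem mem_dg {u : ℕ × ℕ} :
    u ∈ dg γ ↔ 1 ≤ u.1 ∧ u.1 ≤ γ.length ∧ 1 ≤ u.2 ∧ u.2 ≤ height γ u.1 := by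
  obtain ⟨i, j⟩ := u
  simp only [dg, Finset.mem_biUnion, Finset.mem_Icc, Finset.mem_image, Prod.mk.injEq]
  grind

theorem mem_augDg {u : ℕ × ℕ} :
    u ∈ augDg γ ↔ 1 ≤ u.1 ∧ u.1 ≤ γ.length ∧ u.2 ≤ height γ u.1 := by
  obtain ⟨i, j⟩ := u
  simp only [augDg, Finset.mem_union, mem_dg, Finset.mem_Icc, Finset.mem_image, Prod.mk.injEq]
  grind

/-- The column heights, the columns being numbered from `0`. -/
def colHeight (γ : List ℕ) (c : Fin γ.length) : ℕ := height γ (c.val + 1)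

/-- The labels, the columns being numbered from `0`. -/
def colLabel (γ : List ℕ) (τ : ℕ × ℕ → Ordinal.{0}) (u : Fin γ.length × ℕ) : Ordinal.{0} :=
  τ (u.1.val + 1, u.2)

theorem sum_dg {M : Type*} [AddCommMonoid M] (f : ℕ × ℕ → M) : ∑ u ∈ dg γ, f u =
    ∑ c : Fin γ.length, ∑ j ∈ Finset.range (colHeight γ c), f (c.val + 1, j + 1) := by
  rw [Finset.sum_sigma']
  symm
  refine Finset.sum_nbij (fun x => (x.1.val + 1, x.2 + 1)) ?_ ?_ ?_ (fun _ _ => rfl)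
  · rintro ⟨c, j⟩ hx
    simp only [Finset.mem_sigma, Finset.mem_univ, Finset.mem_range, true_and] at hx
    rw [mem_dg]
    exact ⟨by simp, c.2, by simp, hx⟩
  · rintro ⟨c, j⟩ _ ⟨c', j'⟩ _ h
    simp only [Prod.mk.injEq, add_left_inj] at h
    obtain ⟨h1, rfl⟩ := h
    obtain rfl := Fin.ext h1
    rfl
  · rintro ⟨i, j⟩ hx
    rw [Finset.mem_coe, mem_dg] at hx
    simp only at hx
    obtain ⟨h1, h2, h3, h4⟩ := hx
    have e1 : i - 1 + 1 = i := by omega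
    refine ⟨⟨⟨i - 1, by omega⟩, j - 1⟩, ?_, ?_⟩
    · simp only [Finset.coe_sigma, Set.mem_sigma_iff, Finset.coe_univ, Set.mem_univ, true_and,
        Finset.coe_range, Set.mem_Iio, colHeight, e1]
      omega
    · simp only [e1, Nat.sub_add_cancel h3]

theorem armCard_eq (c : Fin γ.length) (j : ℕ) : armCard γ (c.val + 1, j + 1) =
    (∑ d, if d < c ∧ colHeight γ d ≤ colHeight γ c ∧ j + 1 ≤ colHeight γ d then 1 else 0) +
    ∑ d, if c < d ∧ colHeight γ d < colHeight γ c ∧ j ≤ colHeight γ d then 1 else 0 := by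
  rw [armCard, ← Finset.card_filter, ← Finset.card_filter]
  congr 1
  · symm
    refine Finset.card_nbij (fun d => (d.val + 1, j + 1)) ?_ ?_ ?_
    · intro d hd
      simp only [Finset.coe_filter, Finset.mem_univ, true_and, Set.mem_ofPred_eq, mem_dg] at hd ⊢
      exact ⟨⟨by simp, d.2, by simp, hd.2.2⟩, Nat.succ_lt_succ hd.1, hd.2.1⟩
    · intro d _ d' _ h
      simp only [Prod.mk.injEq, add_left_inj, and_true] at h
      exact Fin.ext h
    · rintro ⟨i, k⟩ hx
      simp only [Finset.coe_filter, Set.mem_ofPred_eq, mem_dg] at hx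
      obtain ⟨⟨h1, h2, h3, h4⟩, rfl, h6, h7⟩ := hx
      have e1 : i - 1 + 1 = i := by omega
      refine ⟨⟨i - 1, by omega⟩, ?_, by simp only [e1]⟩
      simp only [Finset.coe_filter, Finset.mem_univ, true_and, Set.mem_ofPred_eq, colHeight, e1,
        Fin.lt_def]
      exact ⟨by omega, h7, h4⟩
  · symm
    refine Finset.card_nbij (fun d => (d.val + 1, j)) ?_ ?_ ?_
    · intro d hd
      simp only [Finset.coe_filter, Finset.mem_univ, true_and, Set.mem_ofPred_eq, mem_augDg] at hd ⊢
      exact ⟨⟨by simp, d.2, hd.2.2⟩, Nat.succ_lt_succ hd.1, hd.2.1⟩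
    · intro d _ d' _ h
      simp only [Prod.mk.injEq, add_left_inj, and_true] at h
      exact Fin.ext h
    · rintro ⟨i, k⟩ hx
      simp only [Finset.coe_filter, Set.mem_ofPred_eq, mem_augDg, add_left_inj] at hx
      obtain ⟨⟨h1, h2, h3⟩, rfl, h6, h7⟩ := hx
      have e1 : i - 1 + 1 = i := by omega
      refine ⟨⟨i - 1, by omega⟩, ?_, by simp only [e1]⟩
      simp only [Finset.coe_filter, Finset.mem_univ, true_and, Set.mem_ofPred_eq, colHeight, e1,
        Fin.lt_def]
      exact ⟨by omega, h7, h3⟩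

theorem card_le_pairs : ((Finset.Icc 1 γ.length ×ˢ Finset.Icc 1 γ.length).filter fun p =>
      p.1 < p.2 ∧ height γ p.1 ≤ height γ p.2).card =
    ∑ c, ∑ d, if c < d ∧ colHeight γ c ≤ colHeight γ d then 1 else 0 := by
  rw [← Fintype.sum_prod_type' (fun c d => if c < d ∧ colHeight γ c ≤ colHeight γ d then 1 else 0),
    ← Finset.card_filter]
  symm
  refine Finset.card_nbij (fun x => (x.1.val + 1, x.2.val + 1)) ?_ ?_ ?_
  · rintro ⟨c, d⟩ hx
    simp only [Finset.coe_filter, Finset.mem_univ, true_and, Set.mem_ofPred_eq, Finset.mem_product,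
      Finset.mem_Icc] at hx ⊢
    exact ⟨⟨⟨by omega, c.2⟩, by omega, d.2⟩, Nat.succ_lt_succ hx.1, hx.2⟩
  · rintro ⟨c, d⟩ _ ⟨c', d'⟩ _ h
    simp only [Prod.mk.injEq, add_left_inj] at h
    exact Prod.ext (Fin.ext h.1) (Fin.ext h.2)
  · rintro ⟨i, k⟩ hx
    simp only [Finset.coe_filter, Set.mem_ofPred_eq, Finset.mem_product, Finset.mem_Icc] at hx
    obtain ⟨⟨⟨h1, h2⟩, h3, h4⟩, h5, h6⟩ := hx
    have e1 : i - 1 + 1 = i := by omega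
    have e2 : k - 1 + 1 = k := by omega
    refine ⟨(⟨i - 1, by omega⟩, ⟨k - 1, by omega⟩), ?_, by simp only [e1, e2]⟩
    simp only [Finset.coe_filter, Finset.mem_univ, true_and, Set.mem_ofPred_eq, colHeight, e1, e2,
      Fin.lt_def]
    exact ⟨by omega, h6⟩

theorem sum_range_ite_le (a b : ℕ) (P : Prop) [Decidable P] :
    (∑ j ∈ Finset.range b, if P ∧ j + 1 ≤ a then 1 else 0) = if P then min a b else 0 := by
  by_cases hP : P
  · rw [if_pos hP, ← Finset.card_filter]
    have : (Finset.range b).filter (fun j => P ∧ j + 1 ≤ a) = Finset.range (min a b) := by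
      ext j
      simp only [Finset.mem_filter, Finset.mem_range, hP, true_and, lt_min_iff]
      omega
    rw [this, Finset.card_range]
  · rw [if_neg hP]
    exact Finset.sum_eq_zero fun j _ => if_neg fun h => hP h.1

/-- Distribute the arms over pairs of columns c < d. If c is not taller, the arms in column d
contribute its height and the pair itself counts once more; if d is shorter, the arms in column c
contribute the height of d plus one, for the basement box. -/
theorem sum_armCard : (∑ u ∈ dg γ, armCard γ u) +
    ((Finset.Icc 1 γ.length ×ˢ Finset.Icc 1 γ.length).filter fun p =>
      p.1 < p.2 ∧ height γ p.1 ≤ height γ p.2).card =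
    ∑ c, ∑ d, if c < d then min (colHeight γ c) (colHeight γ d) + 1 else 0 := by
  have e1 : ∑ u ∈ dg γ, armCard γ u =
      (∑ c, ∑ d, if c < d ∧ colHeight γ c ≤ colHeight γ d then colHeight γ c else 0) +
      ∑ c, ∑ d, if c < d ∧ colHeight γ d < colHeight γ c then colHeight γ d + 1 else 0 := by
    rw [sum_dg]
    simp only [armCard_eq, Finset.sum_add_distrib]
    congr 1
    · rw [Finset.sum_comm]
      refine Finset.sum_congr rfl fun c _ => ?_
      rw [Finset.sum_comm]
      refine Finset.sum_congr rfl fun d _ => ?_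
      simp only [← and_assoc]
      rw [sum_range_ite_le]
      by_cases h : d < c ∧ colHeight γ d ≤ colHeight γ c
      · rw [if_pos h, if_pos h, min_eq_left h.2]
      · rw [if_neg h, if_neg h]
    · refine Finset.sum_congr rfl fun c _ => ?_
      rw [Finset.sum_comm]
      refine Finset.sum_congr rfl fun d _ => ?_
      simp only [← and_assoc, ← Nat.add_le_add_iff_right (n := 1) (k := colHeight γ d)]
      rw [sum_range_ite_le]
      by_cases h : c < d ∧ colHeight γ d < colHeight γ c
      · rw [if_pos h, if_pos h, min_eq_left h.2]
      · rw [if_neg h, if_neg h]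
  rw [e1, card_le_pairs]
  simp only [← Finset.sum_add_distrib]
  refine Finset.sum_congr rfl fun c _ => Finset.sum_congr rfl fun d _ => ?_
  by_cases h1 : c < d
  · rcases Nat.lt_or_ge (colHeight γ d) (colHeight γ c) with h2 | h2
    · rw [if_neg (by omega), if_pos ⟨h1, h2⟩, if_neg (by omega), if_pos h1, min_eq_right h2.le]
      omega
    · rw [if_pos ⟨h1, h2⟩, if_neg (by omega), if_pos ⟨h1, h2⟩, if_pos h1, min_eq_left h2]
  · rw [if_neg (fun h => h1 h.1), if_neg (fun h => h1 h.1), if_neg (fun h => h1 h.1), if_neg h1]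

end Coinv

end AlmostSym

namespace AlmostSym

/-! ### The statistic coinv as a sum over pairs of columns -/

section CoinvGood

variable {γ : List ℕ} {τ : ℕ × ℕ → Ordinal.{0}}

theorem mem_inversions {x : (ℕ × ℕ) × (ℕ × ℕ)} : x ∈ inversions γ τ ↔
    (x.1 ∈ augDg γ ∧ x.2 ∈ augDg γ) ∧ ((x.1.2 = x.2.2 ∧ x.2.1 < x.1.1) ∨
      (x.1.2 = x.2.2 + 1 ∧ x.1.1 < x.2.1)) ∧ τ x.2 < τ x.1 := by
  obtain ⟨⟨i, j⟩, ⟨k, l⟩⟩ := x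
  unfold inversions
  refine (@Finset.mem_filter _ _ (_) _ _).trans ?_
  simp only [Finset.mem_product, Attack, ReadsBefore, Ne, Prod.mk.injEq]
  refine and_congr_right fun _ => ?_
  rw [← and_assoc]
  refine and_congr_left fun _ => ?_
  omega

theorem sum_ite_eq_card {C : Type*} [Fintype C] (M : ℕ) (P : C → C → ℕ → Prop)
    [∀ c d j, Decidable (P c d j)] :
    (∑ c, ∑ d, ∑ j ∈ Finset.range M, if P c d j then 1 else 0) =
      ((Finset.univ ×ˢ Finset.univ ×ˢ Finset.range M).filter
        fun x : C × C × ℕ => P x.1 x.2.1 x.2.2).card := by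
  rw [Finset.card_filter, Finset.sum_product]
  exact Finset.sum_congr rfl fun c _ => by rw [Finset.sum_product]

theorem card_inversions_row {M : ℕ} (hM : ∀ c, colHeight γ c < M) :
    ((inversions γ τ).filter fun x => x.1.2 = x.2.2).card = ∑ c, ∑ d, if c < d then
      ∑ j ∈ Finset.range M, (if j ≤ colHeight γ c ∧ j ≤ colHeight γ d ∧
        colLabel γ τ (c, j) < colLabel γ τ (d, j) then 1 else 0) else 0 := by
  have e : ∀ c d, (if c < d then
      ∑ j ∈ Finset.range M, (if j ≤ colHeight γ c ∧ j ≤ colHeight γ d ∧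
        colLabel γ τ (c, j) < colLabel γ τ (d, j) then 1 else 0) else 0) =
      ∑ j ∈ Finset.range M, (if c < d ∧ j ≤ colHeight γ c ∧ j ≤ colHeight γ d ∧
        colLabel γ τ (c, j) < colLabel γ τ (d, j) then 1 else 0) := by
    intro c d
    by_cases h : c < d <;> simp [h]
  simp only [e]
  rw [sum_ite_eq_card]
  symm
  refine Finset.card_nbij (fun x : Fin γ.length × Fin γ.length × ℕ =>
    ((x.2.1.val + 1, x.2.2), (x.1.val + 1, x.2.2))) ?_ ?_ ?_
  · rintro ⟨c, d, j⟩ hx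
    simp only [Finset.coe_filter, Finset.mem_product, Finset.mem_univ, true_and, Finset.mem_range,
      Set.mem_ofPred_eq, mem_inversions, mem_augDg] at hx ⊢
    obtain ⟨h1, h2, h3, h4, h5⟩ := hx
    exact ⟨⟨⟨⟨by omega, d.2, h4⟩, by omega, c.2, h3⟩, Or.inl (Nat.succ_lt_succ h2), h5⟩, trivial⟩
  · rintro ⟨c, d, j⟩ _ ⟨c', d', j'⟩ _ h
    simp only [Prod.mk.injEq, add_left_inj] at h
    obtain ⟨⟨h1, rfl⟩, h2, _⟩ := h
    rw [Fin.ext h1, Fin.ext h2]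
  · rintro ⟨⟨i, j⟩, ⟨k, l⟩⟩ hx
    simp only [Finset.coe_filter, Set.mem_ofPred_eq, mem_inversions, mem_augDg] at hx
    obtain ⟨⟨⟨⟨h1, h2, h3⟩, h4, h5, h6⟩, h7, h8⟩, rfl⟩ := hx
    have e1 : i - 1 + 1 = i := by omega
    have e2 : k - 1 + 1 = k := by omega
    have := hM ⟨i - 1, by omega⟩
    simp only [colHeight, e1] at this
    refine ⟨(⟨k - 1, by omega⟩, ⟨i - 1, by omega⟩, j), ?_, by simp only [e1, e2]⟩
    simp only [Finset.coe_filter, Finset.mem_product, Finset.mem_univ, true_and, Finset.mem_range,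
      Set.mem_ofPred_eq, colHeight, colLabel, e1, e2, Fin.lt_def]
    exact ⟨by omega, by omega, h6, h3, h8⟩

theorem card_inversions_diag {M : ℕ} (hM : ∀ c, colHeight γ c < M) :
    ((inversions γ τ).filter fun x => ¬ x.1.2 = x.2.2).card = ∑ c, ∑ d, if c < d then
      ∑ j ∈ Finset.range M, (if j + 1 ≤ colHeight γ c ∧ j ≤ colHeight γ d ∧
        colLabel γ τ (d, j) < colLabel γ τ (c, j + 1) then 1 else 0) else 0 := by
  have e : ∀ c d, (if c < d then
      ∑ j ∈ Finset.range M, (if j + 1 ≤ colHeight γ c ∧ j ≤ colHeight γ d ∧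
        colLabel γ τ (d, j) < colLabel γ τ (c, j + 1) then 1 else 0) else 0) =
      ∑ j ∈ Finset.range M, (if c < d ∧ j + 1 ≤ colHeight γ c ∧ j ≤ colHeight γ d ∧
        colLabel γ τ (d, j) < colLabel γ τ (c, j + 1) then 1 else 0) := by
    intro c d
    by_cases h : c < d <;> simp [h]
  simp only [e]
  rw [sum_ite_eq_card]
  symm
  refine Finset.card_nbij (fun x : Fin γ.length × Fin γ.length × ℕ =>
    ((x.1.val + 1, x.2.2 + 1), (x.2.1.val + 1, x.2.2))) ?_ ?_ ?_
  · rintro ⟨c, d, j⟩ hx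
    simp only [Finset.coe_filter, Finset.mem_product, Finset.mem_univ, true_and, Finset.mem_range,
      Set.mem_ofPred_eq, mem_inversions, mem_augDg] at hx ⊢
    obtain ⟨h1, h2, h3, h4, h5⟩ := hx
    exact ⟨⟨⟨⟨by omega, c.2, h3⟩, by omega, d.2, h4⟩, Or.inr (Nat.succ_lt_succ h2), h5⟩, by omega⟩
  · rintro ⟨c, d, j⟩ _ ⟨c', d', j'⟩ _ h
    simp only [Prod.mk.injEq, add_left_inj] at h
    obtain ⟨⟨h1, rfl⟩, h2, _⟩ := h
    rw [Fin.ext h1, Fin.ext h2]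
  · rintro ⟨⟨i, j⟩, ⟨k, l⟩⟩ hx
    simp only [Finset.coe_filter, Set.mem_ofPred_eq, mem_inversions, mem_augDg] at hx
    obtain ⟨⟨⟨⟨h1, h2, h3⟩, h4, h5, h6⟩, h7, h8⟩, h9⟩ := hx
    have h10 : j = l + 1 := by omega
    subst h10
    have e1 : i - 1 + 1 = i := by omega
    have e2 : k - 1 + 1 = k := by omega
    have := hM ⟨i - 1, by omega⟩
    simp only [colHeight, e1] at this
    refine ⟨(⟨i - 1, by omega⟩, ⟨k - 1, by omega⟩, l), ?_, by simp only [e1, e2]⟩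
    simp only [Finset.coe_filter, Finset.mem_product, Finset.mem_univ, true_and, Finset.mem_range,
      Set.mem_ofPred_eq, colHeight, colLabel, e1, e2, Fin.lt_def]
    exact ⟨by omega, by omega, h3, h6, h8⟩

theorem card_inversions {M : ℕ} (hM : ∀ c, colHeight γ c < M) : (inversions γ τ).card =
    ∑ c, ∑ d, if c < d then pairInv M (colHeight γ) (colLabel γ τ) c d else 0 := by
  rw [← Finset.card_filter_add_card_filter_not (fun x => x.1.2 = x.2.2), card_inversions_row hM,
    card_inversions_diag hM]
  simp only [← Finset.sum_add_distrib]
  refine Finset.sum_congr rfl fun c _ => Finset.sum_congr rfl fun d _ => ?_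
  by_cases h : c < d
  · rw [if_pos h, if_pos h, if_pos h, pairInv]
  · rw [if_neg h, if_neg h, if_neg h]

/-- By `PairNonAttacking.pairInv_le` every summand is non-negative for non-attacking labellings with
increasing basement, so coinv vanishes only if every pair of columns has the maximal number of
inversions. -/
theorem coinv_of_descents_eq_empty (hd : descents γ τ = ∅) {M : ℕ} (hM : ∀ c, colHeight γ c < M) :
    coinv γ τ = ∑ c, ∑ d, if c < d then ((min (colHeight γ c) (colHeight γ d) + 1 : ℕ) : ℤ) -
      (pairInv M (colHeight γ) (colLabel γ τ) c d : ℕ) else 0 := by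
  have h1 := congrArg (Nat.cast (R := ℤ)) (sum_armCard (γ := γ))
  have h2 := congrArg (Nat.cast (R := ℤ)) (card_inversions (τ := τ) hM)
  have h3 : (∑ c, ∑ d, if c < d then ((min (colHeight γ c) (colHeight γ d) + 1 : ℕ) : ℤ) -
      (pairInv M (colHeight γ) (colLabel γ τ) c d : ℕ) else 0) =
      ((∑ c, ∑ d, if c < d then min (colHeight γ c) (colHeight γ d) + 1 else 0 : ℕ) : ℤ) -
      ((∑ c, ∑ d, if c < d then pairInv M (colHeight γ) (colLabel γ τ) c d else 0 : ℕ) : ℤ) := by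
    rw [Nat.cast_sum, Nat.cast_sum, ← Finset.sum_sub_distrib]
    refine Finset.sum_congr rfl fun c _ => ?_
    rw [Nat.cast_sum, Nat.cast_sum, ← Finset.sum_sub_distrib]
    refine Finset.sum_congr rfl fun d _ => ?_
    by_cases h : c < d
    · rw [if_pos h, if_pos h, if_pos h]
    · rw [if_neg h, if_neg h, if_neg h]; rfl
  rw [h3, ← h1, ← h2, coinv, inv, hd, Finset.sum_empty]
  push_cast
  ring

theorem descents_eq_empty_iff : descents γ τ = ∅ ↔ ∀ c j, j + 1 ≤ colHeight γ c →
    colLabel γ τ (c, j + 1) ≤ colLabel γ τ (c, j) := by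
  rw [descents, Finset.filter_eq_empty_iff]
  constructor
  · intro h c j hj
    exact not_lt.1 (h (x := (c.val + 1, j + 1)) (mem_dg.2 ⟨by simp, c.2, by simp, hj⟩))
  · rintro h ⟨i, j⟩ hx
    rw [mem_dg] at hx
    obtain ⟨h1, h2, h3, h4⟩ := hx
    simp only at h1 h2 h3 h4
    have e1 : i - 1 + 1 = i := by omega
    have := h ⟨i - 1, by omega⟩ (j - 1) (by simp only [colHeight, e1]; omega)
    simp only [colLabel, e1, Nat.sub_add_cancel h3] at this
    exact not_lt.2 this

theorem nonAttacking_iff : NonAttacking γ τ ↔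
    ∀ c d, c < d → PairNonAttacking (colHeight γ) (colLabel γ τ) c d := by
  constructor
  · intro h c d hcd
    refine ⟨fun j h1 h2 => ?_, fun j h1 h2 => ?_⟩
    · refine h (c.val + 1, j) (mem_augDg.2 ⟨by simp, c.2, h1⟩) (d.val + 1, j)
        (mem_augDg.2 ⟨by simp, d.2, h2⟩) ⟨?_, Or.inl rfl⟩
      rw [Ne, Prod.mk.injEq]
      exact fun h => by omega
    · refine h (c.val + 1, j + 1) (mem_augDg.2 ⟨by simp, c.2, h1⟩) (d.val + 1, j)
        (mem_augDg.2 ⟨by simp, d.2, h2⟩) ⟨?_, Or.inr (Or.inl ⟨rfl, Nat.succ_lt_succ hcd⟩)⟩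
      rw [Ne, Prod.mk.injEq]
      exact fun h => by omega
  · have row : ∀ i j k, (∀ c d, c < d → PairNonAttacking (colHeight γ) (colLabel γ τ) c d) →
        (i, j) ∈ augDg γ → (k, j) ∈ augDg γ → i < k → τ (i, j) ≠ τ (k, j) := by
      intro i j k h hu hv hik
      rw [mem_augDg] at hu hv
      obtain ⟨h1, h2, h3⟩ := hu
      obtain ⟨h4, h5, h6⟩ := hv
      simp only at h1 h2 h3 h4 h5 h6
      have e1 : i - 1 + 1 = i := by omega
      have e2 : k - 1 + 1 = k := by omega
      have := (h ⟨i - 1, by omega⟩ ⟨k - 1, by omega⟩ (by rw [Fin.lt_def]; simp only; omega)).row j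
      simp only [colHeight, colLabel, e1, e2] at this
      exact this h3 h6
    have diag : ∀ i j k, (∀ c d, c < d → PairNonAttacking (colHeight γ) (colLabel γ τ) c d) →
        (i, j + 1) ∈ augDg γ → (k, j) ∈ augDg γ → i < k → τ (i, j + 1) ≠ τ (k, j) := by
      intro i j k h hu hv hik
      rw [mem_augDg] at hu hv
      obtain ⟨h1, h2, h3⟩ := hu
      obtain ⟨h4, h5, h6⟩ := hv
      simp only at h1 h2 h3 h4 h5 h6
      have e1 : i - 1 + 1 = i := by omega
      have e2 : k - 1 + 1 = k := by omega
      have := (h ⟨i - 1, by omega⟩ ⟨k - 1, by omega⟩ (by rw [Fin.lt_def]; simp only; omega)).diag j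
      simp only [colHeight, colLabel, e1, e2] at this
      exact this h3 h6
    rintro h ⟨i, j⟩ hu ⟨k, l⟩ hv ⟨hne, hr | ⟨hr, hlt⟩ | ⟨hr, hlt⟩⟩
    · simp only at hr
      subst hr
      rcases lt_trichotomy i k with hik | rfl | hik
      · exact row i j k h hu hv hik
      · exact absurd rfl hne
      · exact (row k j i h hv hu hik).symm
    · simp only at hr hlt
      subst hr
      exact diag i l k h hu hv hlt
    · simp only at hr hlt
      subst hr
      exact (diag k j i h hv hu hlt).symm

/-- For increasing basements, the labellings without attacks, coinversions and descents are the
good ones. -/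
theorem good_iff_coinv (h0 : ∀ c d : Fin γ.length, c < d →
    colLabel γ τ (c, 0) < colLabel γ τ (d, 0)) :
    NonAttacking γ τ ∧ coinv γ τ = 0 ∧ descents γ τ = ∅ ↔
      Good (colHeight γ) (colLabel γ τ) := by
  obtain ⟨M, hM⟩ : ∃ M, ∀ c, colHeight γ c < M :=
    ⟨Finset.univ.sup (colHeight γ) + 1, fun c =>
      Nat.lt_succ_of_le (Finset.le_sup (f := colHeight γ) (Finset.mem_univ c))⟩
  rw [good_iff, ← descents_eq_empty_iff]
  have key : NonAttacking γ τ → descents γ τ = ∅ → (coinv γ τ = 0 ↔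
      ∀ c d, c < d → PairTri (colHeight γ) (colLabel γ τ) c d) := by
    intro hna hd
    rw [nonAttacking_iff] at hna
    have hle := descents_eq_empty_iff.1 hd
    have hp : ∀ c d, c < d → _ := fun c d hcd =>
      (hna c d hcd).pairInv_le (hle c) (hle d) (h0 c d hcd) (hM c) (hM d)
    rw [coinv_of_descents_eq_empty hd hM]
    have hnn : ∀ c d, (0 : ℤ) ≤ if c < d then
        ((min (colHeight γ c) (colHeight γ d) + 1 : ℕ) : ℤ) -
          (pairInv M (colHeight γ) (colLabel γ τ) c d : ℕ) else 0 := by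
      intro c d
      by_cases hcd : c < d
      · rw [if_pos hcd]
        have := (hp c d hcd).1
        omega
      · rw [if_neg hcd]
    rw [Finset.sum_eq_zero_iff_of_nonneg fun c _ => Finset.sum_nonneg fun d _ => hnn c d]
    refine ⟨fun h c d hcd => ?_, fun h c _ => Finset.sum_eq_zero fun d _ => ?_⟩
    · have := (Finset.sum_eq_zero_iff_of_nonneg fun d _ => hnn c d).1 (h c (Finset.mem_univ c)) d
        (Finset.mem_univ d)
      rw [if_pos hcd] at this
      exact (hp c d hcd).2.1 (by omega)
    · by_cases hcd : c < d
      · rw [if_pos hcd, (hp c d hcd).2.2 (h c d hcd), sub_self]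
      · rw [if_neg hcd]
  constructor
  · rintro ⟨h1, h2, h3⟩
    exact ⟨h3, fun c d hcd => ⟨nonAttacking_iff.1 h1 c d hcd, (key h1 h3).1 h2 c d hcd⟩⟩
  · rintro ⟨h3, h4⟩
    have h1 := nonAttacking_iff.2 fun c d hcd => (h4 c d hcd).1
    exact ⟨h1, (key h1 h3).2 fun c d hcd => (h4 c d hcd).2, h3⟩

end CoinvGood

end AlmostSym

namespace AlmostSym

/-! ### Separating the basement from the diagram -/

section BodyGood

variable {C Λ : Type*} [LinearOrder C] [LinearOrder Λ]

/-- The part of the conditions on a good labelling that does not involve the basement. -/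
structure BodyGood (h : C → ℕ) (τ : C × ℕ → Λ) : Prop where
  le : ∀ c j, 1 ≤ j → j + 1 ≤ h c → τ (c, j + 1) ≤ τ (c, j)
  row : ∀ c d, c < d → ∀ j, 1 ≤ j → j ≤ h c → j ≤ h d → τ (c, j) ≠ τ (d, j)
  diag : ∀ c d, c < d → ∀ j, 1 ≤ j → j + 1 ≤ h c → j ≤ h d → τ (c, j + 1) ≠ τ (d, j)
  first : ∀ c d, c < d → 1 ≤ h c → h c ≤ h d → τ (c, 1) ≤ τ (d, 1)
  left : ∀ c d, c < d → h c ≤ h d → ∀ j, 1 ≤ j → j + 1 ≤ h c →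
    ¬ (τ (d, j + 1) < τ (c, j + 1) ∧ τ (c, j + 1) < τ (d, j))
  right : ∀ c d, c < d → h d < h c → ∀ j, 1 ≤ j → j ≤ h d →
    ¬ (τ (c, j + 1) < τ (d, j) ∧ τ (d, j) < τ (c, j))

variable {h : C → ℕ} {τ : C × ℕ → Λ}

/-- Over an increasing basement with τ(c, 1) ≤ τ(c, 0) < τ(d, 0), the triple (d, 1), (c, 1), (d, 0)
is bad just when τ(d, 1) < τ(c, 1). So the basement values matter only through the bound on the
first row. -/
theorem good_iff_bodyGood (h0 : ∀ c d, c < d → τ (c, 0) < τ (d, 0)) :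
    Good h τ ↔ BodyGood h τ ∧ ∀ c, 1 ≤ h c → τ (c, 1) ≤ τ (c, 0) := by
  rw [good_iff]
  constructor
  · rintro ⟨h1, h2⟩
    refine ⟨⟨fun c j _ => h1 c j, fun c d hcd j _ => (h2 c d hcd).1.row j,
      fun c d hcd j _ => (h2 c d hcd).1.diag j, fun c d hcd hc hh => ?_,
      fun c d hcd hh j _ => (h2 c d hcd).2.left hh j,
      fun c d hcd hh j _ => (h2 c d hcd).2.right hh j⟩, fun c hc => h1 c 0 hc⟩
    exact not_lt.1 fun hlt =>
      (h2 c d hcd).2.left hh 0 hc ⟨hlt, (h1 c 0 hc).trans_lt (h0 c d hcd)⟩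
  · rintro ⟨hb, h1⟩
    refine ⟨fun c j hj => ?_, fun c d hcd => ⟨⟨fun j hc hd => ?_, fun j hc hd => ?_⟩,
      fun hh j hj => ?_, fun hh j hj => ?_⟩⟩
    · rcases Nat.eq_zero_or_pos j with rfl | hj0
      · exact h1 c hj
      · exact hb.le c j hj0 hj
    · rcases Nat.eq_zero_or_pos j with rfl | hj0
      · exact (h0 c d hcd).ne
      · exact hb.row c d hcd j hj0 hc hd
    · rcases Nat.eq_zero_or_pos j with rfl | hj0
      · exact ((h1 c hc).trans_lt (h0 c d hcd)).ne
      · exact hb.diag c d hcd j hj0 hc hd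
    · rcases Nat.eq_zero_or_pos j with rfl | hj0
      · exact fun hlt => not_lt.2 (hb.first c d hcd hj hh) hlt.1
      · exact hb.left c d hcd hh j hj0 hj
    · rcases Nat.eq_zero_or_pos j with rfl | hj0
      · exact fun hlt => lt_asymm (h0 c d hcd) hlt.2
      · exact hb.right c d hcd hh j hj0 hj

/-- Inserting empty columns and relabelling monotonically. -/
theorem bodyGood_iff_of_strictMono {C' Λ' : Type*} [LinearOrder C'] [LinearOrder Λ']
    {h' : C' → ℕ} {τ' : C' × ℕ → Λ'} {e : C → C'} (he : StrictMono e)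
    (hh : ∀ c, h' (e c) = h c) (h0 : ∀ d, d ∉ Set.range e → h' d = 0)
    (hτ : ∀ c j d k, 1 ≤ j → j ≤ h c → 1 ≤ k → k ≤ h d →
      (τ' (e c, j) < τ' (e d, k) ↔ τ (c, j) < τ (d, k))) :
    BodyGood h' τ' ↔ BodyGood h τ := by
  have hle : ∀ c j d k, 1 ≤ j → j ≤ h c → 1 ≤ k → k ≤ h d →
      (τ' (e c, j) ≤ τ' (e d, k) ↔ τ (c, j) ≤ τ (d, k)) := fun c j d k a1 a2 a3 a4 => by
    rw [← not_lt, hτ d k c j a3 a4 a1 a2, not_lt]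
  have hne : ∀ c j d k, 1 ≤ j → j ≤ h c → 1 ≤ k → k ≤ h d →
      (τ' (e c, j) ≠ τ' (e d, k) ↔ τ (c, j) ≠ τ (d, k)) := fun c j d k a1 a2 a3 a4 => by
    rw [← lt_or_lt_iff_ne, ← lt_or_lt_iff_ne, hτ c j d k a1 a2 a3 a4, hτ d k c j a3 a4 a1 a2]
  have hr : ∀ d, 1 ≤ h' d → ∃ c, e c = d := fun d hd => by
    by_contra hd'
    have := h0 d hd'
    omega
  constructor
  · intro hb
    constructor
    · intro c j h1 h2
      exact (hle c (j + 1) c j (by omega) h2 h1 (by omega)).1 (hb.le (e c) j h1 (by rwa [hh]))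
    · intro c d hcd j h1 h2 h3
      exact (hne c j d j h1 h2 h1 h3).1 (hb.row _ _ (he hcd) j h1 (by rwa [hh]) (by rwa [hh]))
    · intro c d hcd j h1 h2 h3
      exact (hne c (j + 1) d j (by omega) h2 h1 h3).1
        (hb.diag _ _ (he hcd) j h1 (by rwa [hh]) (by rwa [hh]))
    · intro c d hcd h1 h2
      exact (hle c 1 d 1 le_rfl h1 le_rfl (h1.trans h2)).1
        (hb.first _ _ (he hcd) (by rwa [hh]) (by rwa [hh, hh]))
    · intro c d hcd h1 j h2 h3
      rw [← hτ d (j + 1) c (j + 1) (by omega) (by omega) (by omega) h3,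
        ← hτ c (j + 1) d j (by omega) h3 h2 (by omega)]
      exact hb.left _ _ (he hcd) (by rwa [hh, hh]) j h2 (by rwa [hh])
    · intro c d hcd h1 j h2 h3
      rw [← hτ c (j + 1) d j (by omega) (by omega) h2 h3,
        ← hτ d j c j h2 h3 h2 (by omega)]
      exact hb.right _ _ (he hcd) (by rwa [hh, hh]) j h2 (by rwa [hh])
  · intro hb
    constructor
    · intro c' j h1 h2
      obtain ⟨c, rfl⟩ := hr c' (by omega)
      rw [hh] at h2
      exact (hle c (j + 1) c j (by omega) h2 h1 (by omega)).2 (hb.le c j h1 h2)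
    · intro c' d' hcd j h1 h2 h3
      obtain ⟨c, rfl⟩ := hr c' (by omega)
      obtain ⟨d, rfl⟩ := hr d' (by omega)
      rw [hh] at h2 h3
      exact (hne c j d j h1 h2 h1 h3).2 (hb.row _ _ (he.lt_iff_lt.1 hcd) j h1 h2 h3)
    · intro c' d' hcd j h1 h2 h3
      obtain ⟨c, rfl⟩ := hr c' (by omega)
      obtain ⟨d, rfl⟩ := hr d' (by omega)
      rw [hh] at h2 h3
      exact (hne c (j + 1) d j (by omega) h2 h1 h3).2
        (hb.diag _ _ (he.lt_iff_lt.1 hcd) j h1 h2 h3)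
    · intro c' d' hcd h1 h2
      obtain ⟨c, rfl⟩ := hr c' (by omega)
      obtain ⟨d, rfl⟩ := hr d' (by omega)
      rw [hh, hh] at h2
      rw [hh] at h1
      exact (hle c 1 d 1 le_rfl h1 le_rfl (h1.trans h2)).2
        (hb.first _ _ (he.lt_iff_lt.1 hcd) h1 h2)
    · intro c' d' hcd h1 j h2 h3
      obtain ⟨c, rfl⟩ := hr c' (by omega)
      obtain ⟨d, rfl⟩ := hr d' (by omega)
      rw [hh, hh] at h1
      rw [hh] at h3
      rw [hτ d (j + 1) c (j + 1) (by omega) (by omega) (by omega) h3,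
        hτ c (j + 1) d j (by omega) h3 h2 (by omega)]
      exact hb.left _ _ (he.lt_iff_lt.1 hcd) h1 j h2 h3
    · intro c' d' hcd h1 j h2 h3
      obtain ⟨c, rfl⟩ := hr c' (by omega)
      obtain ⟨d, rfl⟩ := hr d' (by omega)
      rw [hh, hh] at h1
      rw [hh] at h3
      rw [hτ c (j + 1) d j (by omega) (by omega) h2 h3,
        hτ d j c j h2 h3 h2 (by omega)]
      exact hb.right _ _ (he.lt_iff_lt.1 hcd) h1 j h2 h3

end BodyGood

end AlmostSym

namespace AlmostSym

/-! ### Labellings with bounded labels are fillings -/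

section StarFilling

variable (s : SigmaPair) {n : ℕ}

theorem length_shape : (shape s).length = s.comp.length + s.part.length := by simp [shape]

theorem colHeight_shape (c : Fin (shape s).length) :
    colHeight (shape s) c = (s.comp ++ s.part.reverse).getD c.val 0 := rfl

/-- The embedding of the columns of `μ * rev(λ)` into those of the padded composition. -/
def colEmb (hn : s.comp.length + s.part.length ≤ n) (c : Fin (shape s).length) : Fin n :=
  ⟨if c.val < s.comp.length then c.val else c.val + (n - s.comp.length - s.part.length), by
    have := c.2.trans_eq (length_shape s)
    split_ifs <;> omega⟩

variable (hn : s.comp.length + s.part.length ≤ n)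

theorem colEmb_of_lt {c : Fin (shape s).length} (h : c.val < s.comp.length) :
    (colEmb s hn c).val = c.val := if_pos h

theorem colEmb_of_le {c : Fin (shape s).length} (h : s.comp.length ≤ c.val) :
    (colEmb s hn c).val = c.val + (n - s.comp.length - s.part.length) := if_neg (not_lt.2 h)

theorem colEmb_strictMono : StrictMono (colEmb s hn) := by
  intro c d hcd
  rw [Fin.lt_def] at hcd ⊢
  simp only [colEmb]
  split_ifs <;> omega

theorem padded_colEmb (c : Fin (shape s).length) :
    padded n s.comp s.part (colEmb s hn c).val = colHeight (shape s) c := by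
  simp only [padded, colEmb, colHeight_shape]
  by_cases h : c.val < s.comp.length
  · rw [if_pos h, List.append_assoc, List.getD_append _ _ _ _ h, List.getD_append _ _ _ _ h]
  · rw [if_neg h, List.getD_append_right _ _ _ _ (by simp; omega),
      List.getD_append_right _ _ _ _ (by omega)]
    congr 1
    simp only [List.length_append, List.length_replicate]
    omega

theorem padded_of_notMem_range (d : Fin n) (hd : d ∉ Set.range (colEmb s hn)) :
    padded n s.comp s.part d.val = 0 := by
  have h1 : ¬ d.val < s.comp.length := fun h => hd
    ⟨⟨d.val, by rw [length_shape]; omega⟩, by ext; simp [colEmb, h]⟩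
  have h2 : d.val < n - s.part.length := by
    by_contra h
    refine hd ⟨⟨d.val - (n - s.comp.length - s.part.length), by rw [length_shape]; omega⟩, ?_⟩
    ext
    simp only [colEmb]
    rw [if_neg (by omega)]
    omega
  rw [padded, List.append_assoc, List.getD_append_right _ _ _ _ (by omega),
    List.getD_append _ _ _ _ (by simp; omega)]
  simp

variable {s}

theorem mem_dg_shape {c : Fin (shape s).length} {j : ℕ} (h1 : 1 ≤ j)
    (h2 : j ≤ colHeight (shape s) c) : (c.val + 1, j) ∈ dg (shape s) :=
  mem_dg.2 ⟨by simp, c.2, h1, h2⟩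

theorem star_base (σ : {u // u ∈ dg (shape s)} → ℕ) (c : Fin (shape s).length) :
    colLabel (shape s) (star s σ) (c, 0) = if c.val < s.comp.length then
      ((c.val + 1 : ℕ) : Ordinal) else Ordinal.omega0 + ((c.val - s.comp.length : ℕ) : Ordinal) := by
  rw [colLabel, star, dif_neg (fun h => by have := (mem_dg.1 h).2.2.1; simp at this)]
  simp only [Nat.succ_le_iff]
  congr 3
  omega

theorem star_body (σ : {u // u ∈ dg (shape s)} → ℕ) {c : Fin (shape s).length} {j : ℕ}
    (h1 : 1 ≤ j) (h2 : j ≤ colHeight (shape s) c) :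
    colLabel (shape s) (star s σ) (c, j) = (σ ⟨_, mem_dg_shape h1 h2⟩ : ℕ) := by
  rw [colLabel, star, dif_pos (mem_dg_shape h1 h2)]

theorem star_base_lt (σ : {u // u ∈ dg (shape s)} → ℕ) (c d : Fin (shape s).length) (hcd : c < d) :
    colLabel (shape s) (star s σ) (c, 0) < colLabel (shape s) (star s σ) (d, 0) := by
  rw [star_base, star_base]
  rw [Fin.lt_def] at hcd
  split_ifs with h1 h2 h2
  · exact_mod_cast Nat.succ_lt_succ hcd
  · exact (Ordinal.natCast_lt_omega0 _).trans_le le_self_add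
  · omega
  · rw [add_lt_add_iff_left]
    exact_mod_cast (by omega)

theorem mem_labellings_iff {σ : {u // u ∈ dg (shape s)} → ℕ} : σ ∈ labellings s ↔
    (∀ u, 1 ≤ σ u) ∧ Good (colHeight (shape s)) (colLabel (shape s) (star s σ)) := by
  rw [← good_iff_coinv (star_base_lt σ)]
  rfl

/-- The labelling of the diagram of `μ * rev(λ)` given by a labelling of the padded diagram. -/
def labelsOf (T : Fin n × ℕ → Fin n) (u : {u // u ∈ dg (shape s)}) : ℕ :=
  (T (colEmb s hn ⟨u.1.1 - 1, by have := mem_dg.1 u.2; omega⟩, u.1.2)).val + 1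

theorem labelsOf_mk (T : Fin n × ℕ → Fin n) {c : Fin (shape s).length} {j : ℕ}
    (hu : (c.val + 1, j) ∈ dg (shape s)) :
    labelsOf hn T ⟨(c.val + 1, j), hu⟩ = (T (colEmb s hn c, j)).val + 1 := rfl

theorem bodyGood_labelsOf (T : Fin n × ℕ → Fin n) :
    BodyGood (fun i : Fin n => padded n s.comp s.part i.val) T ↔
      BodyGood (colHeight (shape s)) (colLabel (shape s) (star s (labelsOf hn T))) := by
  refine bodyGood_iff_of_strictMono (colEmb_strictMono s hn) (padded_colEmb s hn)
    (padded_of_notMem_range s hn) ?_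
  intro c j d k h1 h2 h3 h4
  rw [star_body _ h1 h2, star_body _ h3 h4, labelsOf_mk, labelsOf_mk, Nat.cast_lt,
    Nat.add_lt_add_iff_right, Fin.lt_def]

theorem colHeight_shape_right {c : Fin (shape s).length} (hc : s.comp.length ≤ c.val) :
    1 ≤ colHeight (shape s) c ∧
      ∀ d : Fin (shape s).length, c ≤ d → colHeight (shape s) c ≤ colHeight (shape s) d := by
  have key : ∀ c : Fin (shape s).length, s.comp.length ≤ c.val → ∃ h,
      colHeight (shape s) c = s.part.reverse[c.val - s.comp.length]'h := by
    intro c hc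
    have h : c.val - s.comp.length < s.part.reverse.length := by
      have := c.2.trans_eq (length_shape s)
      rw [List.length_reverse]
      omega
    refine ⟨h, ?_⟩
    rw [colHeight_shape, List.getD_append_right _ _ _ _ hc,
      List.getD_eq_getElem _ _ h]
  obtain ⟨h1, e1⟩ := key c hc
  constructor
  · rw [e1]
    exact s.part_partition.2 _ (List.mem_reverse.1 (List.getElem_mem h1))
  · intro d hd
    obtain ⟨h2, e2⟩ := key d (hc.trans hd)
    rw [e1, e2]
    rcases hd.eq_or_lt with rfl | hd
    · exact le_rfl
    · exact List.pairwise_iff_getElem.1 (List.pairwise_reverse.2 s.part_partition.1.pairwise)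
        _ _ h1 h2 (by rw [Fin.lt_def] at hd; omega)

/-- In the columns after the `ℓ(μ)`-th the labels of the first row increase. -/
theorem BodyGood.first_row_le {T : Fin n × ℕ → Fin n}
    (hT : BodyGood (fun i : Fin n => padded n s.comp s.part i.val) T)
    {c : Fin (shape s).length} (hc : s.comp.length ≤ c.val) :
    T (colEmb s hn c, 1) ≤ colEmb s hn c := by
  -- Induction from the rightmost column. Heights weakly increase to the right, so `first` and `row`
  -- make the first row strictly increasing, and with k columns to the right the 1-based label is at
  -- most n − k.
  have key : ∀ k : ℕ, ∀ c : Fin (shape s).length, s.comp.length ≤ c.val →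
      c.val + k + 1 = (shape s).length → (T (colEmb s hn c, 1)).val + k + 1 ≤ n := by
    intro k
    induction k with
    | zero => exact fun c _ _ => (T (colEmb s hn c, 1)).2
    | succ k ih =>
      intro c hc hk
      let d : Fin (shape s).length := ⟨c.val + 1, by omega⟩
      have hcd : c < d := by rw [Fin.lt_def]; exact Nat.lt_succ_self _
      have h1 := colHeight_shape_right hc
      have h2 := h1.2 d hcd.le
      have hlt := colEmb_strictMono s hn hcd
      have e1 := hT.first _ _ hlt (by rw [padded_colEmb]; exact h1.1)
        (by rw [padded_colEmb, padded_colEmb]; exact h2)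
      have e2 := hT.row _ _ hlt 1 le_rfl (by rw [padded_colEmb]; exact h1.1)
        (by rw [padded_colEmb]; exact h1.1.trans h2)
      have e3 := Fin.lt_def.1 (lt_of_le_of_ne e1 e2)
      have := ih d (by simp only [d]; omega) (by simp only [d]; omega)
      omega
  have hlen := length_shape s
  have := key ((shape s).length - 1 - c.val) c hc (by omega)
  have := colEmb_of_le s hn hc
  rw [Fin.le_def]
  omega

/-- The two sides differ only in the basement. Over columns of μ the bounds on the first row
coincide; over the others the infinite labels impose nothing and the finite bound holds by
`BodyGood.first_row_le`. -/
theorem labelsOf_mem_iff {T : Fin n × ℕ → Fin n} (hb : ∀ c, T (c, 0) = c)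
    (ho : ∀ u : Fin n × ℕ, padded n s.comp s.part u.1.val < u.2 → T u = u.1) :
    labelsOf hn T ∈ labellings s ↔
      IsFilling (fun i : Fin n => padded n s.comp s.part i.val) T := by
  have h1 : IsFilling (fun i : Fin n => padded n s.comp s.part i.val) T ↔
      Good (fun i : Fin n => padded n s.comp s.part i.val) T :=
    ⟨fun h => h.good, fun h => ⟨hb, ho, h⟩⟩
  have hpos : ∀ u, 1 ≤ labelsOf (s := s) hn T u := fun u => Nat.succ_pos _
  rw [h1, mem_labellings_iff, and_iff_right hpos,
    good_iff_bodyGood (star_base_lt _), good_iff_bodyGood (fun c d hcd => by rwa [hb, hb]),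
    bodyGood_labelsOf hn]
  refine and_congr_right fun hg => ?_
  rw [← bodyGood_labelsOf hn] at hg
  constructor
  · intro h c hc
    by_cases hr : c ∈ Set.range (colEmb s hn)
    · obtain ⟨c, rfl⟩ := hr
      rw [hb]
      by_cases hcr : c.val < s.comp.length
      · rw [padded_colEmb] at hc
        have := h c hc
        rw [star_base, if_pos hcr, star_body _ le_rfl hc, labelsOf_mk, Nat.cast_le] at this
        have := colEmb_of_lt s hn hcr
        rw [Fin.le_def]
        omega
      · exact hg.first_row_le hn (by omega)
    · rw [padded_of_notMem_range s hn c hr] at hc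
      omega
  · intro h c hc
    rw [star_base, star_body _ le_rfl hc, labelsOf_mk]
    by_cases hcr : c.val < s.comp.length
    · have := h (colEmb s hn c) (by rwa [padded_colEmb])
      rw [hb, Fin.le_def] at this
      have := colEmb_of_lt s hn hcr
      rw [if_pos hcr, Nat.cast_le]
      omega
    · rw [if_neg hcr]
      exact ((Ordinal.natCast_lt_omega0 _).trans_le le_self_add).le

/-- Boxes not coming from the diagram, including the empty inserted columns, receive their column
number. Labels shift by one because `Fin n` starts at 0. -/
theorem exists_labelsOf_eq {σ : {u // u ∈ dg (shape s)} → ℕ} (h1 : ∀ u, 1 ≤ σ u)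
    (h2 : ∀ u, σ u ≤ n) : ∃ T : Fin n × ℕ → Fin n, (∀ c, T (c, 0) = c) ∧
      (∀ u : Fin n × ℕ, padded n s.comp s.part u.1.val < u.2 → T u = u.1) ∧ labelsOf hn T = σ := by
  have key : ∀ u : Fin n × ℕ, ∃ t : Fin n,
      (∀ c : Fin (shape s).length, colEmb s hn c = u.1 → ∀ hu : (c.val + 1, u.2) ∈ dg (shape s),
        t.val + 1 = σ ⟨_, hu⟩) ∧
      ((∀ c : Fin (shape s).length, colEmb s hn c = u.1 → (c.val + 1, u.2) ∉ dg (shape s)) →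
        t = u.1) := by
    rintro ⟨i, j⟩
    by_cases h : ∃ c : Fin (shape s).length, colEmb s hn c = i ∧ (c.val + 1, j) ∈ dg (shape s)
    · obtain ⟨c, rfl, hc⟩ := h
      have e1 := h1 ⟨_, hc⟩
      have e2 := h2 ⟨_, hc⟩
      refine ⟨⟨σ ⟨_, hc⟩ - 1, by omega⟩, fun d hd hu => ?_, fun h => absurd hc (h c rfl)⟩
      obtain rfl := (colEmb_strictMono s hn).injective hd
      exact Nat.sub_add_cancel e1
    · exact ⟨i, fun c hc hu => absurd ⟨c, hc, hu⟩ h, fun _ => rfl⟩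
  choose T hT1 hT2 using key
  refine ⟨T, fun c => hT2 (c, 0) fun d _ h => ?_, fun u hu => hT2 u fun d hd h => ?_, ?_⟩
  · have := (mem_dg.1 h).2.2.1
    simp at this
  · have e1 := (mem_dg.1 h).2.2.2
    have e2 := padded_colEmb s hn d
    rw [hd, colHeight] at e2
    simp only at e1
    omega
  · funext ⟨⟨i, j⟩, hu⟩
    have h3 := mem_dg.1 hu
    simp only at h3
    obtain ⟨i, rfl⟩ : ∃ k, i = k + 1 := ⟨i - 1, by omega⟩
    exact hT1 (colEmb s hn ⟨i, by omega⟩, j) ⟨i, by omega⟩ rfl hu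

theorem labelsOf_injOn : Set.InjOn (labelsOf (s := s) hn)
    {T | IsFilling (fun i : Fin n => padded n s.comp s.part i.val) T} := by
  intro T hT S hS h
  funext ⟨i, j⟩
  rcases Nat.eq_zero_or_pos j with rfl | hj
  · rw [hT.base, hS.base]
  · rcases Nat.lt_or_ge (padded n s.comp s.part i.val) j with hp | hp
    · rw [hT.outside (i, j) hp, hS.outside (i, j) hp]
    · by_cases hr : i ∈ Set.range (colEmb s hn)
      · obtain ⟨c, rfl⟩ := hr
        rw [padded_colEmb] at hp
        have := congrFun h ⟨_, mem_dg_shape hj hp⟩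
        rw [labelsOf_mk, labelsOf_mk, add_left_inj] at this
        exact Fin.ext this
      · rw [padded_of_notMem_range s hn i hr] at hp
        omega

theorem content_labelsOf (T : Fin n × ℕ → Fin n) (i : Fin n) :
    content (labelsOf (s := s) hn T) (i.val + 1) =
      ((bodyBoxes fun i : Fin n => padded n s.comp s.part i.val).filter fun u => T u = i).card := by
  rw [content]
  refine Finset.card_nbij (fun u => (colEmb s hn ⟨u.1.1 - 1, by have := mem_dg.1 u.2; omega⟩, u.1.2))
    ?_ ?_ ?_
  · rintro ⟨⟨k, j⟩, hu⟩ h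
    simp only [Finset.coe_filter, Finset.mem_univ, true_and, Set.mem_ofPred_eq, labelsOf,
      add_left_inj, mem_bodyBoxes, padded_colEmb] at h ⊢
    have h3 := mem_dg.1 hu
    simp only at h3
    refine ⟨⟨?_, by omega⟩, Fin.ext h⟩
    rw [colHeight, Nat.sub_add_cancel h3.1]
    exact h3.2.2.2
  · rintro ⟨⟨k, j⟩, hu⟩ _ ⟨⟨k', j'⟩, hu'⟩ _ h
    have h3 := mem_dg.1 hu
    have h4 := mem_dg.1 hu'
    simp only [Prod.mk.injEq] at h h3 h4
    have := Fin.ext_iff.1 ((colEmb_strictMono s hn).injective h.1)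
    simp only at this
    simp only [Subtype.mk.injEq, Prod.mk.injEq]
    omega
  · rintro ⟨d, j⟩ h
    simp only [Finset.coe_filter, Set.mem_ofPred_eq, mem_bodyBoxes] at h
    obtain ⟨⟨h1, h2⟩, h3⟩ := h
    by_cases hr : d ∈ Set.range (colEmb s hn)
    · obtain ⟨c, rfl⟩ := hr
      rw [padded_colEmb] at h1
      refine ⟨⟨(c.val + 1, j), mem_dg_shape (by omega) h1⟩, ?_, rfl⟩
      simp only [Finset.coe_filter, Finset.mem_univ, true_and, Set.mem_ofPred_eq, labelsOf_mk, h3]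
    · rw [padded_of_notMem_range s hn d hr] at h1
      omega

end StarFilling

end AlmostSym

namespace AlmostSym
open MvPolynomial (X rename)

/-! ### The monomial basis -/

section Basis

variable {𝕜 : Type*} [Field 𝕜] {n k : ℕ}

theorem count_ofSym {σ : Type*} [Fintype σ] [DecidableEq σ] {N : ℕ} (s : Sym σ N) {a : ℕ}
    (ha : a ≠ 0) : (Nat.Partition.ofSym s).parts.count a =
      (Finset.univ.filter fun i => Multiset.count i s.1 = a).card := by
  have e : (Nat.Partition.ofSym s).parts = s.1.toFinset.val.map fun i => Multiset.count i s.1 := rfl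
  rw [e, Multiset.count_map, ← Finset.filter_val, Finset.card_val]
  congr 1
  ext i
  simp only [Finset.mem_filter, Multiset.mem_toFinset, Finset.mem_univ, true_and]
  constructor
  · exact fun h => h.2.symm
  · exact fun h => ⟨Multiset.count_pos.1 (by omega), h.symm⟩

theorem partition_ext_count {N : ℕ} {π ρ : N.Partition}
    (h : ∀ a, a ≠ 0 → π.parts.count a = ρ.parts.count a) : π = ρ := by
  refine Nat.Partition.ext (Multiset.ext.2 fun a => ?_)
  rcases eq_or_ne a 0 with rfl | ha
  · rw [Multiset.count_eq_zero_of_notMem fun h => (π.parts_pos h).ne' rfl,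
      Multiset.count_eq_zero_of_notMem fun h => (ρ.parts_pos h).ne' rfl]
  · exact h a ha

-- The exponent 0 is left out because a partition does not record it.
open Classical in
theorem coeff_msymm {σ : Type*} [Fintype σ] [DecidableEq σ] {N : ℕ} (π : N.Partition) (δ : σ →₀ ℕ) :
    MvPolynomial.coeff δ (MvPolynomial.msymm σ 𝕜 π) =
      if ∀ a, a ≠ 0 → (Finset.univ.filter fun i => δ i = a).card = π.parts.count a
      then 1 else 0 := by
  have e1 : ∀ s : Sym σ N, (s.1.map (X (R := 𝕜))).prod =
      MvPolynomial.monomial (Multiset.toFinsupp s.1) 1 := by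
    intro s
    rw [MvPolynomial.monomial_eq, map_one, one_mul, Finsupp.prod, Multiset.toFinsupp_support,
      Finset.prod_multiset_map_count]
    simp only [Multiset.toFinsupp_apply]
  have e2 : ∀ s : Sym σ N, Nat.Partition.ofSym s = π ↔
      ∀ a, a ≠ 0 → (Finset.univ.filter fun i => Multiset.toFinsupp s.1 i = a).card =
        π.parts.count a := by
    intro s
    constructor
    · rintro rfl a ha
      exact (count_ofSym s ha).symm
    · exact fun h => partition_ext_count fun a ha => (count_ofSym s ha).trans (h a ha)
  rw [MvPolynomial.msymm, MvPolynomial.coeff_sum]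
  simp only [e1, MvPolynomial.coeff_monomial]
  split_ifs with h
  · have e3 : Multiset.toFinsupp (Finsupp.toMultiset δ) = δ := Finsupp.toMultiset_toFinsupp δ
    obtain rfl : Multiset.card (Finsupp.toMultiset δ) = N := by
      have h1 : (Nat.Partition.ofSym (Sym.mk (Finsupp.toMultiset δ) rfl)).parts = π.parts := by
        refine Multiset.ext.2 fun a => ?_
        rcases eq_or_ne a 0 with rfl | ha
        · rw [Multiset.count_eq_zero_of_notMem fun h => (Nat.Partition.parts_pos _ h).ne' rfl,
            Multiset.count_eq_zero_of_notMem fun h => (π.parts_pos h).ne' rfl]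
        · refine (count_ofSym _ ha).trans (Eq.trans ?_ (h a ha))
          exact congrArg (fun δ' : σ →₀ ℕ => (Finset.univ.filter fun i => δ' i = a).card) e3
      rw [← π.parts_sum, ← h1, Nat.Partition.parts_sum]
    rw [Finset.sum_eq_single
      (⟨Sym.mk (Finsupp.toMultiset δ) rfl, (e2 _).2 (fun a ha => (congrArg (fun δ' : σ →₀ ℕ =>
        (Finset.univ.filter fun i => δ' i = a).card) e3).trans (h a ha))⟩ :
        {a : Sym σ _ // Nat.Partition.ofSym a = π})]
    · exact if_pos e3
    · intro s _ hs
      rw [if_neg]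
      intro h'
      refine hs (Subtype.ext (Subtype.ext ?_))
      exact (Multiset.toFinsupp_toMultiset _).symm.trans (congrArg Finsupp.toMultiset h')
    · exact fun h => absurd (Finset.mem_univ _) h
  · refine Finset.sum_eq_zero fun s _ => if_neg ?_
    rintro rfl
    exact h ((e2 s.1).1 s.2)

/-- The exponent vector `β` is supported in the variables after the `k`-th, and its nonzero entries
form the multiset `ν`. -/
def TailFits (k : ℕ) (ν : List ℕ) (β : Fin n → ℕ) : Prop :=
  ∀ a, a ≠ 0 → (Finset.univ.filter fun i : Fin n => k ≤ i.val ∧ β i = a).card = ν.count a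

open Classical in
theorem coeff_msymmSeq (ν : List ℕ) (β : Fin n →₀ ℕ) :
    MvPolynomial.coeff β (msymmSeq 𝕜 k ν n) =
      if (∀ i : Fin n, i.val < k → β i = 0) ∧ TailFits k ν β then 1 else 0 := by
  have hinj : Function.Injective (Subtype.val : {i : Fin n // k ≤ i.val} → Fin n) :=
    Subtype.val_injective
  rw [msymmSeq]
  by_cases h1 : ∀ i : Fin n, i.val < k → β i = 0
  · have e : β = (β.comapDomain Subtype.val (hinj.injOn)).mapDomain
        (Subtype.val : {i : Fin n // k ≤ i.val} → Fin n) := by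
      rw [Finsupp.mapDomain_comapDomain _ hinj]
      intro i hi
      by_contra hik
      exact (Finsupp.mem_support_iff.1 hi) (h1 i (not_le.1 fun h => hik ⟨⟨i, h⟩, rfl⟩))
    conv_lhs => rw [e]
    rw [MvPolynomial.coeff_rename_mapDomain _ hinj, coeff_msymm]
    refine if_congr ?_ rfl rfl
    rw [and_iff_right h1, TailFits]
    refine forall_congr' fun a => forall_congr' fun ha => ?_
    rw [Nat.Partition.ofMultiset, Nat.Partition.count_ofSums_of_ne_zero _ ha, Multiset.coe_count]
    refine Eq.congr_left ?_
    refine Finset.card_nbij Subtype.val ?_ hinj.injOn ?_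
    · rintro ⟨i, hi⟩ h
      exact Finset.mem_filter.2 ⟨Finset.mem_univ _, hi, (Finset.mem_filter.1 h).2⟩
    · intro i hi
      have hi' := (Finset.mem_filter.1 hi).2
      exact ⟨⟨i, hi'.1⟩, Finset.mem_filter.2 ⟨Finset.mem_univ _, hi'.2⟩, rfl⟩
  · rw [if_neg fun h => h1 h.1]
    refine MvPolynomial.coeff_rename_eq_zero _ _ _ fun u hu => ?_
    exfalso
    apply h1
    rintro i hi
    rw [← hu, Finsupp.mapDomain_of_notMem_range]
    rintro ⟨⟨j, hj⟩, rfl⟩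
    exact absurd hi (not_lt.2 hj)

theorem res_eq_killCompl : (res n : MvPolynomial (Fin (n + 1)) 𝕜 →ₐ[𝕜] _) =
    MvPolynomial.killCompl (Fin.castSucc_injective n) := by
  refine MvPolynomial.algHom_ext fun i => ?_
  induction i using Fin.lastCases with
  | last =>
    rw [res_X_of_not_lt (by simp), MvPolynomial.killCompl, MvPolynomial.aeval_X, dif_neg]
    rintro ⟨j, hj⟩
    exact (Fin.castSucc_lt_last j).ne hj
  | cast i =>
    rw [res_X_of_lt (by simp), ← MvPolynomial.rename_X Fin.castSucc,
      MvPolynomial.killCompl_rename_app]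
    rfl

theorem coeff_res (f : MvPolynomial (Fin (n + 1)) 𝕜) (β : Fin n →₀ ℕ) :
    MvPolynomial.coeff β (res n f) = MvPolynomial.coeff (β.mapDomain Fin.castSucc) f := by
  have hinj := Fin.castSucc_injective n
  rw [res_eq_killCompl]
  induction f using MvPolynomial.induction_on' with
  | monomial δ c =>
    by_cases h : (δ.support : Set (Fin (n + 1))) ⊆ Set.range Fin.castSucc
    · rw [← Finsupp.mapDomain_comapDomain _ hinj δ h,
        MvPolynomial.killCompl_monomial_mapDomain, MvPolynomial.coeff_monomial,
        MvPolynomial.coeff_monomial]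
      exact if_congr (Finsupp.mapDomain_injective hinj).eq_iff.symm rfl rfl
    · rw [MvPolynomial.killCompl_monomial_eq_zero_of_not_subset hinj c h, MvPolynomial.coeff_zero,
        MvPolynomial.coeff_monomial, if_neg]
      rintro rfl
      refine h fun i hi => ?_
      by_contra hr
      exact (Finsupp.mem_support_iff.1 hi) (Finsupp.mapDomain_of_notMem_range _ _ hr)
  | add f g hf hg => rw [map_add, MvPolynomial.coeff_add, MvPolynomial.coeff_add, hf, hg]

open Classical in
theorem res_msymmSeq (ν : List ℕ) (n : ℕ) :
    res n (msymmSeq 𝕜 k ν (n + 1)) = msymmSeq 𝕜 k ν n := by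
  ext β
  rw [coeff_res, coeff_msymmSeq, coeff_msymmSeq]
  have hinj := Fin.castSucc_injective n
  have e1 : ∀ i : Fin n, β.mapDomain Fin.castSucc i.castSucc = β i := fun i =>
    Finsupp.mapDomain_apply hinj β i
  have e2 : β.mapDomain Fin.castSucc (Fin.last n) = 0 := by
    refine Finsupp.mapDomain_of_notMem_range _ _ ?_
    rintro ⟨j, hj⟩
    exact (Fin.castSucc_lt_last j).ne hj
  refine if_congr (and_congr ?_ ?_) rfl rfl
  · rw [Fin.forall_fin_succ', e2]
    simp [e1]
  · refine forall_congr' fun a => forall_congr' fun ha => Eq.congr_left ?_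
    symm
    refine Finset.card_nbij Fin.castSucc ?_ hinj.injOn ?_
    · intro i hi
      simpa [e1] using hi
    · intro i hi
      simp only [Finset.coe_filter, Finset.mem_univ, true_and, Set.mem_ofPred_eq] at hi
      induction i using Fin.lastCases with
      | last => exact absurd (e2.symm.trans hi.2).symm ha
      | cast i => exact ⟨i, by simpa [e1] using hi, rfl⟩

theorem res_monomialBasis (q : BasisIndex k) (n : ℕ) :
    res n (monomialBasis 𝕜 k q (n + 1)) = monomialBasis 𝕜 k q n := by
  rw [monomialBasis, Pi.mul_apply, Pi.mul_apply, map_mul, res_msymmSeq, monomialSeq, res_extend]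

theorem monomialSeq_eq {α : List ℕ} (hα : α.length ≤ n) : monomialSeq 𝕜 α n =
    MvPolynomial.monomial (Finsupp.equivFunOnFinite.symm fun i : Fin n => α.getD i.val 0) 1 := by
  rw [monomialSeq, extend_of_le hα, map_prod, MvPolynomial.monomial_eq, map_one, one_mul,
    Finsupp.prod_fintype _ _ (fun i => pow_zero _)]
  simp only [map_pow, MvPolynomial.rename_X]
  rw [← Finset.prod_subset (Finset.subset_univ (Finset.univ.map (Fin.castLEEmb hα)))]
  · rw [Finset.prod_map]
    refine Finset.prod_congr rfl fun i _ => ?_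
    simp
  · intro i _ hi
    have : α.length ≤ i.val := by
      by_contra h
      exact hi (Finset.mem_map.2 ⟨⟨i.val, by omega⟩, Finset.mem_univ _, Fin.ext rfl⟩)
    simp [List.getElem?_eq_none this]

/-- The exponent vector `β` occurs in `x^α m_ν[x_{k+1} + ⋯]`. -/
def Fits (k : ℕ) (q : SigmaPair) (β : Fin n → ℕ) : Prop :=
  (∀ i : Fin n, i.val < k → β i = q.comp.getD i.val 0) ∧ TailFits k q.part β

open Classical in
theorem coeff_monomialBasis (hn : k ≤ n) (q : BasisIndex k) (β : Fin n →₀ ℕ) :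
    MvPolynomial.coeff β (monomialBasis 𝕜 k q n) = if Fits k q.1 β then 1 else 0 := by
  rw [monomialBasis, Pi.mul_apply, monomialSeq_eq (q.2.trans hn), MvPolynomial.coeff_monomial_mul',
    coeff_msymmSeq, one_mul]
  set a : Fin n →₀ ℕ := Finsupp.equivFunOnFinite.symm fun i : Fin n => q.1.comp.getD i.val 0
  have ha : ∀ i, a i = q.1.comp.getD i.val 0 := fun i => rfl
  have ha0 : ∀ i : Fin n, k ≤ i.val → a i = 0 := fun i hi => by
    rw [ha, List.getD_eq_default _ _ (q.2.trans hi)]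
  -- Subtracting α changes nothing after position k, since ℓ(α) ≤ k.
  have ht : TailFits k q.1.part (β - a) ↔ TailFits k q.1.part β := by
    refine forall_congr' fun b => forall_congr' fun _ => Eq.congr_left ?_
    congr 1
    ext i
    simp only [Finset.mem_filter, Finset.mem_univ, true_and]
    refine and_congr_right fun hi => ?_
    rw [Finsupp.tsub_apply, ha0 i hi, Nat.sub_zero]
  rw [← ite_and]
  refine if_congr ?_ rfl rfl
  rw [ht, Fits, ← and_assoc]
  refine and_congr_left fun _ => ?_
  constructor
  · rintro ⟨h1, h2⟩ i hi
    have e1 := h1 i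
    have e2 := h2 i hi
    rw [Finsupp.tsub_apply] at e2
    rw [← ha]
    omega
  · intro h
    refine ⟨fun i => ?_, fun i hi => ?_⟩
    · by_cases hi : i.val < k
      · rw [h i hi, ha]
      · rw [ha0 i (by omega)]
        exact Nat.zero_le _
    · rw [Finsupp.tsub_apply, h i hi, ha, Nat.sub_self]

end Basis

end AlmostSym

namespace AlmostSym
open MvPolynomial (X rename)

/-! ### Every monomial belongs to exactly one basis function -/

section Fits

variable {𝕜 : Type*} [Field 𝕜] {n k : ℕ}

theorem exists_isReducedComp (L : List ℕ) : ∃ α : List ℕ, IsReducedComp α ∧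
    α.length ≤ L.length ∧ ∀ i, α.getD i 0 = L.getD i 0 := by
  induction L using List.reverseRecOn with
  | nil => exact ⟨[], fun h => absurd rfl h, le_rfl, fun _ => rfl⟩
  | append_singleton L a ih =>
    rcases eq_or_ne a 0 with rfl | ha
    · obtain ⟨α, h1, h2, h3⟩ := ih
      refine ⟨α, h1, h2.trans (by simp), fun i => ?_⟩
      rw [h3]
      rcases Nat.lt_or_ge i L.length with h | h
      · rw [List.getD_append _ _ _ _ h]
      · rw [List.getD_append_right _ _ _ _ h, List.getD_eq_default _ _ h]
        rcases Nat.eq_zero_or_pos (i - L.length) with h' | h'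
        · rw [h']; rfl
        · rw [List.getD_eq_default _ _ (by rw [List.length_singleton]; exact h')]
    · exact ⟨L ++ [a], fun h => by simpa using ha, le_rfl, fun _ => rfl⟩

theorem IsReducedComp.length_le {α β : List ℕ} (hα : IsReducedComp α)
    (h : ∀ i, α.getD i 0 = β.getD i 0) : α.length ≤ β.length := by
  by_contra hlt
  have hne : α ≠ [] := by rintro rfl; simp at hlt
  apply hα hne
  rw [List.getLast_eq_getElem, ← List.getD_eq_getElem _ 0, h, List.getD_eq_default]
  omega

theorem IsReducedComp.ext {α β : List ℕ} (hα : IsReducedComp α) (hβ : IsReducedComp β)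
    (h : ∀ i, α.getD i 0 = β.getD i 0) : α = β := by
  refine List.ext_getElem ((hα.length_le h).antisymm (hβ.length_le fun i => (h i).symm))
    fun i h1 h2 => ?_
  rw [← List.getD_eq_getElem _ 0, h, List.getD_eq_getElem]

/-- The composition consists of the first k exponents without trailing zeros, the partition of the
sorted nonzero exponents after them. -/
theorem exists_fits (hn : k ≤ n) (β : Fin n → ℕ) : ∃ q : BasisIndex k, Fits k q.1 β := by
  obtain ⟨α, h1, h2, h3⟩ := exists_isReducedComp (List.ofFn fun i : Fin k => β (Fin.castLE hn i))
  rw [List.length_ofFn] at h2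
  let m : Multiset ℕ := ((Finset.univ.filter fun i : Fin n => k ≤ i.val ∧ β i ≠ 0).val.map β)
  refine ⟨⟨⟨α, m.sort (· ≥ ·), h1, (m.pairwise_sort _).sortedGE, ?_⟩, h2⟩, ?_, ?_⟩
  · intro a ha
    rw [Multiset.mem_sort, Multiset.mem_map] at ha
    obtain ⟨i, hi, rfl⟩ := ha
    exact Nat.one_le_iff_ne_zero.2 (Finset.mem_filter.1 (Finset.mem_val ▸ hi)).2.2
  · intro i hi
    simp only
    rw [h3, List.getD_eq_getElem _ _ (by simpa using hi)]
    simp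
  · intro a ha
    simp only
    rw [← Multiset.coe_count, Multiset.sort_eq, Multiset.count_map, ← Finset.filter_val,
      Finset.card_val, Finset.filter_filter]
    congr 1
    ext i
    simp only [Finset.mem_filter, Finset.mem_univ, true_and]
    constructor
    · rintro ⟨h4, rfl⟩
      exact ⟨⟨h4, ha⟩, rfl⟩
    · rintro ⟨h4, rfl⟩
      exact ⟨h4.1, rfl⟩

theorem Fits.unique (hn : k ≤ n) {β : Fin n → ℕ} {q q' : BasisIndex k} (h : Fits k q.1 β)
    (h' : Fits k q'.1 β) : q = q' := by
  obtain ⟨⟨α, ν, h1, h2⟩, h3⟩ := q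
  obtain ⟨⟨α', ν', h1', h2'⟩, h3'⟩ := q'
  obtain ⟨e1, e2⟩ := h
  obtain ⟨e1', e2'⟩ := h'
  simp only at h3 h3' e1 e2 e1' e2'
  obtain rfl : α = α' := by
    refine h1.ext h1' fun i => ?_
    rcases Nat.lt_or_ge i k with hi | hi
    · exact (e1 ⟨i, by omega⟩ hi).symm.trans (e1' ⟨i, by omega⟩ hi)
    · rw [List.getD_eq_default _ _ (h3.trans hi), List.getD_eq_default _ _ (h3'.trans hi)]
  obtain rfl : ν = ν' := by
    have hp : ν.Perm ν' := by
      rw [List.perm_iff_count]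
      intro a
      rcases eq_or_ne a 0 with rfl | ha
      · rw [List.count_eq_zero.2 fun h => absurd (h2.2 0 h) (by omega),
          List.count_eq_zero.2 fun h => absurd (h2'.2 0 h) (by omega)]
      · rw [← e2 a ha, ← e2' a ha]
    exact hp.eq_of_pairwise' h2.1.pairwise h2'.1.pairwise
  rfl

/-- The exponent vector `(α, ν, 0, …, 0)`. -/
def stdExp (n k : ℕ) (q : SigmaPair) (i : Fin n) : ℕ :=
  if i.val < k then q.comp.getD i.val 0 else q.part.getD (i.val - k) 0

theorem fits_stdExp (q : SigmaPair) (hn : k + q.part.length ≤ n) : Fits k q (stdExp n k q) := by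
  refine ⟨fun i hi => if_pos hi, fun a ha => ?_⟩
  have e : ((q.part : List ℕ) : Multiset ℕ) = Finset.univ.val.map q.part.get := by
    rw [Fin.univ_val_map, List.ofFn_get]
  rw [← Multiset.coe_count, e, Multiset.count_map, ← Finset.filter_val, Finset.card_val]
  symm
  refine Finset.card_nbij (fun i => ⟨k + i.val, by omega⟩) ?_ ?_ ?_
  · intro i hi
    have := (Finset.mem_filter.1 hi).2
    refine Finset.mem_filter.2 ⟨Finset.mem_univ _, Nat.le_add_right _ _, ?_⟩
    rw [stdExp, if_neg (by simp), Nat.add_sub_cancel_left, List.getD_eq_getElem _ _ i.2, this]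
    rfl
  · intro i _ j _ h
    simpa [Fin.ext_iff] using h
  · intro i hi
    obtain ⟨h1, h2⟩ := (Finset.mem_filter.1 hi).2
    rw [stdExp, if_neg (by omega)] at h2
    have h3 : i.val - k < q.part.length := by
      by_contra h
      rw [List.getD_eq_default _ _ (by omega)] at h2
      exact ha h2.symm
    refine ⟨⟨i.val - k, h3⟩, Finset.mem_filter.2 ⟨Finset.mem_univ _, ?_⟩, ?_⟩
    · rw [← h2, List.getD_eq_getElem _ _ h3]
      rfl
    · ext
      simp only
      omega

/-- The number of zeros is what remains of the n − k tail positions after the nonzero values. -/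
theorem card_tail_eq {β β' : Fin n → ℕ} (h : ∀ a, a ≠ 0 →
    (Finset.univ.filter fun i : Fin n => k ≤ i.val ∧ β i = a).card =
      (Finset.univ.filter fun i : Fin n => k ≤ i.val ∧ β' i = a).card) (a : ℕ) :
    (Finset.univ.filter fun i : Fin n => k ≤ i.val ∧ β i = a).card =
      (Finset.univ.filter fun i : Fin n => k ≤ i.val ∧ β' i = a).card := by
  rcases eq_or_ne a 0 with rfl | ha
  · obtain ⟨M, hM⟩ : ∃ M, ∀ i, β i < M ∧ β' i < M :=
      ⟨∑ i, (β i + β' i) + 1, fun i => by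
        have := Finset.single_le_sum (f := fun i => β i + β' i) (fun _ _ => Nat.zero_le _)
          (Finset.mem_univ i)
        omega⟩
    have key : ∀ γ : Fin n → ℕ, (∀ i, γ i < M + 1) →
        (Finset.univ.filter fun i : Fin n => k ≤ i.val).card =
          (∑ b ∈ Finset.range M,
            (Finset.univ.filter fun i : Fin n => k ≤ i.val ∧ γ i = b + 1).card) +
          (Finset.univ.filter fun i : Fin n => k ≤ i.val ∧ γ i = 0).card := by
      intro γ hγ
      rw [Finset.card_eq_sum_card_fiberwise (f := γ) (t := Finset.range (M + 1))
        (fun i _ => Finset.mem_coe.2 (Finset.mem_range.2 (hγ i))), Finset.sum_range_succ']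
      simp only [Finset.filter_filter]
    have e1 := key β fun i => by have := (hM i).1; omega
    have e2 := key β' fun i => by have := (hM i).2; omega
    rw [Finset.sum_congr rfl fun b _ => h (b + 1) (Nat.succ_ne_zero b)] at e1
    omega
  · exact h a ha

/-- Every value occurs equally often in the two tails, so their fibres can be matched. -/
theorem Fits.exists_perm {q : SigmaPair} {β β' : Fin n → ℕ} (h : Fits k q β) (h' : Fits k q β') :
    ∃ w : Equiv.Perm (Fin n), IsTail k w ∧ β ∘ w = β' := by
  classical
  have hc := card_tail_eq fun a ha => (h.2 a ha).trans (h'.2 a ha).symm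
  have e : ∀ a, Nonempty ({x : {i : Fin n // k ≤ i.val} // β' x.1 = a} ≃
      {x : {i : Fin n // k ≤ i.val} // β x.1 = a}) := by
    intro a
    refine Fintype.card_eq.1 ?_
    rw [Fintype.card_congr (Equiv.subtypeSubtypeEquivSubtypeInter _ (fun i => β' i = a)),
      Fintype.card_congr (Equiv.subtypeSubtypeEquivSubtypeInter _ (fun i => β i = a)),
      Fintype.card_subtype, Fintype.card_subtype, hc a]
  let v : Equiv.Perm {i : Fin n // k ≤ i.val} := Equiv.ofFiberEquiv fun a => (e a).some
  have hv : ∀ x, β (v x).1 = β' x.1 := fun x => Equiv.ofFiberEquiv_map (fun a => (e a).some) x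
  refine ⟨Equiv.Perm.ofSubtype v, fun i hi => ?_, ?_⟩
  · exact Equiv.Perm.ofSubtype_apply_of_not_mem v (by omega)
  · funext i
    by_cases hi : k ≤ i.val
    · rw [Function.comp, Equiv.Perm.ofSubtype_apply_of_mem v hi]
      exact hv ⟨i, hi⟩
    · rw [Function.comp, Equiv.Perm.ofSubtype_apply_of_not_mem v hi, h.1 i (by omega),
        h'.1 i (by omega)]

theorem TailSymm.coeff_eq {F : MvPolynomial (Fin n) 𝕜} (hF : TailSymm k F) {q : SigmaPair}
    {β β' : Fin n →₀ ℕ} (h : Fits k q β) (h' : Fits k q β') :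
    MvPolynomial.coeff β F = MvPolynomial.coeff β' F := by
  obtain ⟨w, hw, e⟩ := h.exists_perm h'
  have e1 : β = β'.mapDomain w := by
    ext i
    rw [← w.apply_symm_apply i, Finsupp.mapDomain_apply w.injective, ← congrFun e]
    rfl
  rw [e1, ← rename_of_isTail hF hw, MvPolynomial.coeff_rename_mapDomain _ w.injective,
    rename_of_isTail hF hw]

end Fits

/-! ### Kostka coefficients -/

section Kostka

variable {s : SigmaPair} {n : ℕ} (𝕜 : Type*) [Field 𝕜]

open Classical in
theorem coeff_bodySum (h : Fin n → ℕ) (β : Fin n →₀ ℕ) :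
    MvPolynomial.coeff β (bodySum 𝕜 h) = (((fillings h).filter fun T =>
      ∀ i, ((bodyBoxes h).filter fun u => T u = i).card = β i).card : 𝕜) := by
  rw [bodySum, MvPolynomial.coeff_sum, Finset.card_filter, Nat.cast_sum]
  refine Finset.sum_congr rfl fun T _ => ?_
  have e : bodyWeight 𝕜 h T =
      MvPolynomial.monomial (∑ u ∈ bodyBoxes h, Finsupp.single (T u) 1) 1 := by
    rw [bodyWeight, MvPolynomial.monomial_sum_one]
    rfl
  rw [e, MvPolynomial.coeff_monomial, Nat.cast_ite, Nat.cast_one, Nat.cast_zero]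
  refine if_congr ?_ rfl rfl
  rw [Finsupp.ext_iff]
  refine forall_congr' fun i => ?_
  rw [Finsupp.finsetSum_apply, Finset.card_filter]
  simp only [Finsupp.single_apply]

/-- Prescribing the content by `stdExp` includes zeros beyond ℓ(μ)+ℓ(ν), which is the bound on the
labels in `kostkaLabellings`. -/
theorem image_labelsOf (hn : s.comp.length + s.part.length ≤ n) (q : SigmaPair)
    (hq : s.comp.length + q.part.length ≤ n) :
    labelsOf (s := s) hn '' {T | IsFilling (fun i : Fin n => padded n s.comp s.part i.val) T ∧
      ∀ i, ((bodyBoxes fun i : Fin n => padded n s.comp s.part i.val).filter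
        fun u => T u = i).card = stdExp n s.comp.length q i} = kostkaLabellings s q := by
  ext σ
  constructor
  · rintro ⟨T, ⟨hT, hc⟩, rfl⟩
    have hc' : ∀ i : Fin n, content (labelsOf (s := s) hn T) (i.val + 1) =
        stdExp n s.comp.length q i := fun i => (content_labelsOf hn T i).trans (hc i)
    refine ⟨(labelsOf_mem_iff hn hT.base hT.outside).2 hT, fun u => ?_, fun i hi => ?_,
      fun i hi => ?_⟩
    · by_contra hu
      have h1 := hc' (T (colEmb s hn ⟨u.1.1 - 1, by have := mem_dg.1 u.2; omega⟩, u.1.2))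
      have h2 : labelsOf hn T u =
        (T (colEmb s hn ⟨u.1.1 - 1, by have := mem_dg.1 u.2; omega⟩, u.1.2)).val + 1 := rfl
      rw [← h2, stdExp, if_neg (by omega), List.getD_eq_default _ _ (by omega), content,
        Finset.card_eq_zero] at h1
      exact Finset.notMem_empty u (h1 ▸ Finset.mem_filter.2 ⟨Finset.mem_univ u, rfl⟩)
    · rw [Finset.mem_Icc] at hi
      have := hc' ⟨i - 1, by omega⟩
      simp only [stdExp, Nat.sub_add_cancel hi.1] at this
      rw [this, if_pos (by omega), height]
    · rw [Finset.mem_Icc] at hi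
      have := hc' ⟨s.comp.length + i - 1, by omega⟩
      simp only [stdExp] at this
      rw [Nat.sub_add_cancel (by omega), if_neg (by omega),
        show s.comp.length + i - 1 - s.comp.length = i - 1 by omega] at this
      rw [this, height]
  · rintro ⟨h1, h2, h3, h4⟩
    obtain ⟨T, t1, t2, rfl⟩ := exists_labelsOf_eq hn h1.1 fun u => (h2 u).trans hq
    refine ⟨T, ⟨(labelsOf_mem_iff hn t1 t2).1 h1, fun i => ?_⟩, rfl⟩
    rw [← content_labelsOf hn, stdExp]
    split_ifs with hi
    · rw [h3 _ (Finset.mem_Icc.2 ⟨by omega, by omega⟩), height, Nat.add_sub_cancel]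
    · by_cases hi' : i.val - s.comp.length < q.part.length
      · have := h4 (i.val - s.comp.length + 1) (Finset.mem_Icc.2 ⟨by omega, by omega⟩)
        rw [height, Nat.add_sub_cancel,
          show s.comp.length + (i.val - s.comp.length + 1) = i.val + 1 by omega] at this
        exact this
      · rw [List.getD_eq_default _ _ (by omega), content, Finset.card_eq_zero,
          Finset.filter_eq_empty_iff]
        intro u _ hu
        have := h2 u
        omega

theorem kostkaLabellings_finite (s q : SigmaPair) : (kostkaLabellings s q).Finite := by
  rw [← image_labelsOf (n := s.comp.length + s.part.length + q.part.length) (by omega) q (by omega)]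
  exact ((finite_isFilling _).subset fun T hT => hT.1).image _

theorem coeff_bodySum_stdExp (hn : s.comp.length + s.part.length ≤ n) (q : SigmaPair)
    (hq : s.comp.length + q.part.length ≤ n) :
    MvPolynomial.coeff (Finsupp.equivFunOnFinite.symm (stdExp n s.comp.length q))
      (bodySum 𝕜 fun i : Fin n => padded n s.comp s.part i.val) =
      ((kostkaLabellings s q).ncard : 𝕜) := by
  classical
  rw [coeff_bodySum, ← image_labelsOf hn q hq, Set.InjOn.ncard_image
    ((labelsOf_injOn hn).mono fun T hT => hT.1), ← Set.ncard_coe_finset]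
  congr 2
  ext T
  simp [mem_fillings]

theorem padded_mono {i j : ℕ} (hi : s.comp.length ≤ i) (hij : i ≤ j) (hj : j < n)
    (hn : s.comp.length + s.part.length ≤ n) :
    padded n s.comp s.part i ≤ padded n s.comp s.part j := by
  simp only [padded, List.append_assoc]
  rw [List.getD_append_right _ _ _ _ hi, List.getD_append_right _ _ _ _ (hi.trans hij)]
  set T := List.replicate (n - s.comp.length - s.part.length) 0 ++ s.part.reverse with hT
  have hTs : T.Pairwise (· ≤ ·) := by
    rw [hT, List.pairwise_append]
    refine ⟨by simp [List.pairwise_replicate], List.pairwise_reverse.2 s.part_partition.1.pairwise,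
      fun a ha b _ => ?_⟩
    rw [(List.mem_replicate.1 ha).2]
    exact Nat.zero_le _
  have hl : T.length = n - s.comp.length := by simp [hT]; omega
  rw [List.getD_eq_getElem _ _ (by omega), List.getD_eq_getElem _ _ (by omega)]
  rcases hij.eq_or_lt with rfl | hij
  · exact le_rfl
  · exact List.pairwise_iff_getElem.1 hTs _ _ (by omega) (by omega) (by omega)

/-- The padded composition increases after ℓ(μ), so the polynomial is symmetric there and any
fitting monomial has the coefficient of (α, ν, 0, …, 0). -/
theorem coeff_bodySum_of_fits (hn : s.comp.length + s.part.length ≤ n) {q : SigmaPair}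
    (hq : s.comp.length + q.part.length ≤ n) {β : Fin n →₀ ℕ} (h : Fits s.comp.length q β) :
    MvPolynomial.coeff β (bodySum 𝕜 fun i : Fin n => padded n s.comp s.part i.val) =
      ((kostkaLabellings s q).ncard : 𝕜) := by
  rw [← coeff_bodySum_stdExp 𝕜 hn q hq]
  refine TailSymm.coeff_eq (k := s.comp.length) ?_ h (fits_stdExp q hq)
  exact fun i j hij hi => rename_bodySum 𝕜 hij (padded_mono hi (by omega) j.2 hn)

theorem Fits.length_le {k : ℕ} {q : SigmaPair} {β : Fin n → ℕ} (h : Fits k q β) (hk : k ≤ n) :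
    k + q.part.length ≤ n := by
  have e : q.part.length ≤ (Finset.univ.filter fun i : Fin n => k ≤ i.val).card := by
    have h1 : q.part.length = ∑ a ∈ q.part.toFinset, q.part.count a := by
      rw [List.sum_toFinset_count_eq_length]
    rw [h1, Finset.sum_congr rfl fun a ha => (h.2 a (by
      have := q.part_partition.2 a (List.mem_toFinset.1 ha)
      omega)).symm, ← Finset.card_biUnion]
    · refine Finset.card_le_card fun i hi => ?_
      obtain ⟨a, _, hi⟩ := Finset.mem_biUnion.1 hi
      exact Finset.mem_filter.2 ⟨Finset.mem_univ i, (Finset.mem_filter.1 hi).2.1⟩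
    · intro a _ b _ hab
      refine Finset.disjoint_left.2 fun i hi hi' => hab ?_
      exact (Finset.mem_filter.1 hi).2.2.symm.trans (Finset.mem_filter.1 hi').2.2
  have h2 : (Finset.univ.filter fun i : Fin n => k ≤ i.val).card ≤ n - k := by
    have := Finset.card_le_card_of_injOn (s := Finset.univ.filter fun i : Fin n => k ≤ i.val)
      (t := Finset.Ico k n) Fin.val
      (fun i hi => Finset.mem_coe.2 (Finset.mem_Ico.2 ⟨(Finset.mem_filter.1 hi).2, i.2⟩))
      Fin.val_injective.injOn
    rwa [Nat.card_Ico] at this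
  omega

/-- Every part of ν is positive, so each of the labels ℓ(μ)+1, …, ℓ(μ)+ℓ(ν) needs a box of its own.
-/
theorem length_le_of_mem_kostkaLabellings {q : SigmaPair} {σ : {u // u ∈ dg (shape s)} → ℕ}
    (hσ : σ ∈ kostkaLabellings s q) : q.part.length ≤ (dg (shape s)).card := by
  obtain ⟨_, _, _, h⟩ := hσ
  have h1 : Finset.Icc 1 q.part.length ⊆
      Finset.univ.image fun u : {u // u ∈ dg (shape s)} => σ u - s.comp.length := by
    intro i hi
    have e := h i hi
    rw [Finset.mem_Icc] at hi
    have h2 : 0 < content σ (s.comp.length + i) := by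
      rw [e, height, List.getD_eq_getElem _ _ (by omega)]
      exact q.part_partition.2 _ (List.getElem_mem _)
    obtain ⟨u, hu⟩ := Finset.card_pos.1 h2
    refine Finset.mem_image.2 ⟨u, Finset.mem_univ u, ?_⟩
    rw [(Finset.mem_filter.1 hu).2, Nat.add_sub_cancel_left]
  have h2 := (Finset.card_le_card h1).trans Finset.card_image_le
  rwa [Nat.card_Icc, Nat.add_sub_cancel, Finset.card_univ, Fintype.card_coe] at h2

theorem finite_kostkaLabellings_nonempty (s : SigmaPair) :
    {q : BasisIndex s.comp.length | (kostkaLabellings s q.1).Nonempty}.Finite := by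
  classical
  -- This many variables suffice for every content that occurs. The map to exponents is then
  -- injective with values in the support of one polynomial; over ℚ a nonzero count stays nonzero.
  set n := s.comp.length + s.part.length + (dg (shape s)).card with hn
  refine Set.Finite.of_finite_image (f := fun q =>
    (Finsupp.equivFunOnFinite.symm (stdExp n s.comp.length q.1) : Fin n →₀ ℕ)) ?_ ?_
  · refine (Finset.finite_toSet (MvPolynomial.support
      (bodySum ℚ fun i : Fin n => padded n s.comp s.part i.val))).subset ?_
    rintro _ ⟨q, ⟨σ, hσ⟩, rfl⟩
    have := length_le_of_mem_kostkaLabellings hσ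
    rw [Finset.mem_coe, MvPolynomial.mem_support_iff,
      coeff_bodySum_stdExp ℚ (by omega) q.1 (by omega), Nat.cast_ne_zero]
    exact ((Set.ncard_pos (kostkaLabellings_finite s q.1)).2 ⟨σ, hσ⟩).ne'
  · rintro q ⟨σ, hσ⟩ q' ⟨σ', hσ'⟩ h
    have h1 := length_le_of_mem_kostkaLabellings hσ
    have h2 := length_le_of_mem_kostkaLabellings hσ'
    have h3 := Finsupp.equivFunOnFinite.symm.injective h
    have f1 := fits_stdExp (n := n) (k := s.comp.length) q.1 (by omega)
    have f2 := fits_stdExp (n := n) (k := s.comp.length) q'.1 (by omega)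
    rw [← h3] at f2
    exact f1.unique (by omega) f2

/-- The numbers of labellings, as a finitely supported function. -/
def kostkaNumbers (s : SigmaPair) : BasisIndex s.comp.length →₀ 𝕜 :=
  Finsupp.onFinset (finite_kostkaLabellings_nonempty s).toFinset
    (fun q => ((kostkaLabellings s q.1).ncard : 𝕜)) fun q hq => by
      rw [Set.Finite.mem_toFinset]
      by_contra h
      rw [Set.mem_ofPred_eq, Set.not_nonempty_iff_eq_empty] at h
      exact hq (by rw [h, Set.ncard_empty, Nat.cast_zero])

theorem coeff_linearCombination {k : ℕ} (hn : k ≤ n) (c : BasisIndex k →₀ 𝕜) {q : BasisIndex k}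
    {β : Fin n →₀ ℕ} (h : Fits k q.1 β) :
    MvPolynomial.coeff β (Finsupp.linearCombination 𝕜 (monomialBasis 𝕜 k) c n) = c q := by
  classical
  rw [Finsupp.linearCombination_apply, Finsupp.sum, Finset.sum_apply, MvPolynomial.coeff_sum]
  simp only [Pi.smul_apply, MvPolynomial.coeff_smul, coeff_monomialBasis hn]
  rw [Finset.sum_eq_single q]
  · rw [if_pos h, smul_eq_mul, mul_one]
  · intro q' _ hq'
    rw [if_neg fun h' => hq' (h'.unique hn h), smul_zero]
  · intro hq
    rw [Finsupp.notMem_support_iff.1 hq, zero_smul]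

/-- The coefficient c q is read off at the monomial (α, ν), in just enough variables for it to
exist. -/
theorem linearIndependent_monomialBasis (k : ℕ) : LinearIndependent 𝕜 (monomialBasis 𝕜 k) := by
  rw [linearIndependent_iff]
  intro c hc
  ext q
  rw [← coeff_linearCombination 𝕜 (n := k + q.1.part.length) (Nat.le_add_right _ _) c
    (β := Finsupp.equivFunOnFinite.symm (stdExp _ k q.1)) (fits_stdExp q.1 le_rfl), hc]
  rfl

theorem eq_of_res {F G : PolySeq 𝕜} (hF : ∀ n, res n (F (n + 1)) = F n)
    (hG : ∀ n, res n (G (n + 1)) = G n) (N : ℕ) (h : ∀ n, N ≤ n → F n = G n) : F = G := by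
  have key : ∀ d n, N ≤ n + d → F n = G n := by
    intro d
    induction d with
    | zero => exact h
    | succ d ih => exact fun n hn => by rw [← hF, ← hG, ih (n + 1) (by omega)]
  exact funext fun n => key N n (by omega)

/-- Both sides are compatible with restriction, so it suffices to compare coefficients in at least
ℓ(μ)+ℓ(λ) variables, where the key polynomial formula is available. -/
theorem almostSchur_eq_linearCombination [CharZero 𝕜] (s : SigmaPair) : almostSchur 𝕜 s =
    Finsupp.linearCombination 𝕜 (monomialBasis 𝕜 s.comp.length) (kostkaNumbers 𝕜 s) := by
  refine eq_of_res 𝕜 (fun n => res_schurRec n _ _) (fun n => ?_) (s.comp.length + s.part.length)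
    fun n hn => ?_
  · simp only [Finsupp.linearCombination_apply, Finsupp.sum, Finset.sum_apply, Pi.smul_apply,
      map_sum, map_smul, res_monomialBasis]
  · rw [almostSchur_eq_bodySum s hn]
    ext β
    obtain ⟨q, hq⟩ := exists_fits (k := s.comp.length) (by omega) β
    rw [coeff_linearCombination 𝕜 (by omega) _ hq,
      coeff_bodySum_of_fits 𝕜 hn (hq.length_le (by omega)) hq]
    rfl

/-- Linear independence turns `Function.invFun` into a genuine left inverse. -/
theorem kostkaCoeffs_eq [CharZero 𝕜] (s : SigmaPair) :
    kostkaCoeffs 𝕜 s = kostkaNumbers 𝕜 s := by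
  rw [kostkaCoeffs, almostSchur_eq_linearCombination]
  exact Function.leftInverse_invFun (linearIndependent_monomialBasis 𝕜 _) _

theorem kostka_eq [CharZero 𝕜] {q : SigmaPair} (h : q.comp.length ≤ s.comp.length) :
    kostka 𝕜 s q = ((kostkaLabellings s q).ncard : 𝕜) := by
  rw [kostka, dif_pos h, kostkaCoeffs_eq]
  rfl

end Kostka

end AlmostSym

theorem mainTheorem4 (𝕜 : Type*) [Field 𝕜] [CharZero 𝕜] (p : AlmostSym.SigmaPair) :
    LinearIndependent 𝕜 (AlmostSym.monomialBasis 𝕜 p.comp.length) ∧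
    AlmostSym.almostSchur 𝕜 p =
      Finsupp.linearCombination 𝕜 (AlmostSym.monomialBasis 𝕜 p.comp.length)
        (AlmostSym.kostkaCoeffs 𝕜 p) ∧
    (∀ q : AlmostSym.SigmaPair, ∃ N : ℕ, AlmostSym.kostka 𝕜 p q = (N : 𝕜)) ∧
    (∀ q : AlmostSym.SigmaPair, q.comp.length ≤ p.comp.length →
      (AlmostSym.kostkaLabellings p q).Finite ∧
      AlmostSym.kostka 𝕜 p q = ((AlmostSym.kostkaLabellings p q).ncard : 𝕜)) := by
  refine ⟨AlmostSym.linearIndependent_monomialBasis 𝕜 _, ?_, fun q => ?_, fun q hq =>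
    ⟨AlmostSym.kostkaLabellings_finite p q, AlmostSym.kostka_eq 𝕜 hq⟩⟩
  · rw [AlmostSym.kostkaCoeffs_eq, AlmostSym.almostSchur_eq_linearCombination]
  · by_cases hq : q.comp.length ≤ p.comp.length
    · exact ⟨_, AlmostSym.kostka_eq 𝕜 hq⟩
    · exact ⟨0, by rw [AlmostSym.kostka, dif_neg hq, Nat.cast_zero]⟩

end
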